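/- Let $\phi$ be the standard Gaussian distribution on $\mathbb{R}$. For $\beta>0$, $h>0$ put $$\operatorname{RS}(\beta,h)=\inf_{q\ge 0}\Big[\int\log\cosh(h+\beta\sqrt{q}\,x)\,\phi(dx)+\frac{\beta^2(1-q)^2}{4}\Big],$$ and from now on let $q=q(\beta,h)$ be the unique solution in $[0,\infty)$ of $q=\int\tanh^2(h+\beta\sqrt q\,x)\,\phi(dx)$. *Deterministic sequences.* Let $\operatorname{Th}(x)=\tanh(h+\beta x)$, let $Z,Z',Z''$ be independent standard Gaussian variables, and for $t\in[0,q]$ let $\psi(t)=E\big[\operatorname{Th}(\sqrt t\,Z+\sqrt{q-t}\,Z')\operatorname{Th}(\sqrt t\,Z+\sqrt{q-t}\,Z'')\big]$. Put $\gamma_1=E\tanh(h+\beta\sqrt q\,Z)$, $\rho_1=\sqrt q\,\gamma_1$, and for $k\ge2$, with $\Gamma_{k-1}^2=\sum_{j=1}^{k-1}\gamma_j^2$, $$\rho_k=\psi(\rho_{k-1}),\qquad \gamma_k=\frac{\rho_k-\Gamma_{k-1}^2}{\sqrt{q-\Gamma_{k-1}^2}}.$$ *Model.* For each $N$ let $\mathbf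 g=(g_{ij})_{1\le i,j\le N}$ be i.i.d. centered Gaussian random variables with variance $1/N$ on a probability space $(\Omega,\mathcal F,\mathbb P)$, and $$Z_N=2^{-N}\sum_{\sigma\in\{-1,1\}^N}\exp\Big[\frac{\beta}{\sqrt2}\sum_{i,j=1}^N g_{ij}\sigma_i\sigma_j+h\sum_{i=1}^N\sigma_i\Big].$$ *The $\sigma$-fields.* On $\mathbb R^N$ let $\langle x,y\rangle=\frac1N\sum_i x_iy_i$, $\|x\|=\sqrt{\langle x,x\rangle}$ and $(a\otimes b)_{ij}=a_ib_j/N$. Start with $\mathbf g^{(1)}=\mathbf g$, $\phi^{(1)}=\mathbf 1=(1,\dots,1)$. For $k\ge1$ put $\xi^{(k)}=\mathbf g^{(k)}\phi^{(k)}$, $\eta^{(k)}=(\mathbf g^{(k)})^T\phi^{(k)}$, $\zeta^{(k)}=(\xi^{(k)}+\eta^{(k)})/\sqrt2$, $$\mathbf h^{(k+1)}=h\mathbf 1+\beta\sum_{s=1}^{k-1}\gamma_s\zeta^{(s)}+\beta\sqrt{q-\Gamma_{k-1}^2}\,\zeta^{(k)},\qquad \mathbf m^{(k+1)}=\tanh(\mathbf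 h^{(k+1)})\ \text{(componentwise)},$$ $$\phi^{(k+1)}=\frac{\mathbf m^{(k+1)}-\sum_{s=1}^k\langle\mathbf m^{(k+1)},\phi^{(s)}\rangle\phi^{(s)}}{\big\|\mathbf m^{(k+1)}-\sum_{s=1}^k\langle\mathbf m^{(k+1)},\phi^{(s)}\rangle\phi^{(s)}\big\|},$$ $$\mathbf g^{(k+1)}=\mathbf g^{(k)}-\xi^{(k)}\otimes\phi^{(k)}-\phi^{(k)}\otimes\eta^{(k)}+\langle\phi^{(k)},\xi^{(k)}\rangle\,\phi^{(k)}\otimes\phi^{(k)}$$ (the denominator is almost surely nonzero if $N>k$; where it vanishes put $\phi^{(k+1)}=0$). Let $\mathcal G_k=\sigma(\xi^{(m)},\eta^{(m)}:1\le m\le k)$. **Proposition.** There is $\beta_0>0$ such that for all $0<\beta\le\beta_0$ and all $h>0$, $$\lim_{k\to\infty}\limsup_{N\to\infty}\mathbb E\left|\frac1N\log\mathbb E(Z_N\mid\mathcal G_k)-\operatorname{RS}(\beta,h)\right|=0.$$ -/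

import Mathlib

open MeasureTheory ProbabilityTheory Filter Topology
open scoped NNReal ENNReal Matrix

namespace SK

noncomputable section

/-! ### Deterministic quantities -/

/-- The standard Gaussian distribution `φ` on `ℝ`. -/
abbrev stdGauss : Measure ℝ := gaussianReal 0 1

/-- The replica-symmetric functional, as a function of `q`. -/
def rsFunctional (β h q : ℝ) : ℝ :=
  (∫ x, Real.log (Real.cosh (h + β * √q * x)) ∂stdGauss) + β ^ 2 * (1 - q) ^ 2 / 4

/-- The replica-symmetric free energy: the infimum over `q ≥ 0` of the functional above. -/
def RS (β h : ℝ) : ℝ := ⨅ q : ℝ≥0, rsFunctional β h q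

/-- The right-hand side of the fixed point equation for `q`. -/
def overlapMap (β h q : ℝ) : ℝ := ∫ x, Real.tanh (h + β * √q * x) ^ 2 ∂stdGauss

/-- The number `q = q(β, h)`: the nonnegative solution of `q = ∫ tanh² (h + β √q x) φ(dx)`. For
`h ≠ 0` there is exactly one, so that taking the least one is only a way of naming it. That it does
solve the equation is `overlap_spec` below. -/
def overlap (β h : ℝ) : ℝ := sInf {q : ℝ | 0 ≤ q ∧ q = overlapMap β h q}

/-- `Th x = tanh (h + β x)`. -/
def Th (β h x : ℝ) : ℝ := Real.tanh (h + β * x)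

/-- `ψ(t) = E Th(√t Z + √(q - t) Z') Th(√t Z + √(q - t) Z'')` with independent standard Gaussian
`Z, Z', Z''`. -/
def psi (β h t : ℝ) : ℝ :=
  ∫ z, ∫ z', ∫ z'', Th β h (√t * z + √(overlap β h - t) * z') *
    Th β h (√t * z + √(overlap β h - t) * z'') ∂stdGauss ∂stdGauss ∂stdGauss

/-- `γ₁ = E tanh(h + β √q Z)`. -/
def gammaOne (β h : ℝ) : ℝ := ∫ z, Real.tanh (h + β * √(overlap β h) * z) ∂stdGauss

/-- The sequence `ρ_k`, `k ≥ 1`: `ρ₁ = √q γ₁`, `ρ_k = ψ(ρ_{k-1})`. The value at `0` is unused. -/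
def rho (β h : ℝ) : ℕ → ℝ
  | 0 => 0
  | 1 => √(overlap β h) * gammaOne β h
  | k + 2 => psi β h (rho β h (k + 1))

/-- The sequence `γ_k`, `k ≥ 1`, with
`γ_k = (ρ_k - ∑_{j<k} γ_j²) / √(q - ∑_{j<k} γ_j²)` for `k ≥ 2`. The value at `0` is unused. -/
def gamma (β h : ℝ) : ℕ → ℝ
  | 0 => 0
  | 1 => gammaOne β h
  | k + 2 =>
    (rho β h (k + 2) - ∑ j ∈ (Finset.Icc 1 (k + 1)).attach, gamma β h j.1 ^ 2) /
      √(overlap β h - ∑ j ∈ (Finset.Icc 1 (k + 1)).attach, gamma β h j.1 ^ 2)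
decreasing_by
  all_goals
    have := Finset.mem_Icc.1 j.2
    omega

/-- `Γ_k² = ∑_{j=1}^k γ_j²`. -/
def GammaSq (β h : ℝ) (k : ℕ) : ℝ := ∑ j ∈ Finset.Icc 1 k, gamma β h j ^ 2

theorem gamma_add_two (β h : ℝ) (k : ℕ) :
    gamma β h (k + 2) =
      (rho β h (k + 2) - GammaSq β h (k + 1)) / √(overlap β h - GammaSq β h (k + 1)) := by
  rw [gamma, GammaSq, Finset.sum_attach _ (fun j => gamma β h j ^ 2)]

/-! ### The recursive modification of the interaction matrix -/

/-- `⟨x, y⟩ = N⁻¹ ∑ x_i y_i`. -/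
def ip {N : ℕ} (x y : Fin N → ℝ) : ℝ := (N : ℝ)⁻¹ * ∑ i, x i * y i

/-- `‖x‖ = √⟨x, x⟩`. -/
def nrm {N : ℕ} (x : Fin N → ℝ) : ℝ := √(ip x x)

/-- `(a ⊗ b)_{ij} = a_i b_j / N`. -/
def tens {N : ℕ} (a b : Fin N → ℝ) : Matrix (Fin N) (Fin N) ℝ :=
  Matrix.of fun i j => a i * b j / N

/-- A pair `(g^{(k)}, φ^{(k)})`. -/
abbrev Pair (N : ℕ) := Matrix (Fin N) (Fin N) ℝ × (Fin N → ℝ)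

/-- `ξ = g φ`. -/
def xi {N : ℕ} (a : Pair N) : Fin N → ℝ := a.1 *ᵥ a.2

/-- `η = gᵀ φ`. -/
def eta {N : ℕ} (a : Pair N) : Fin N → ℝ := a.1ᵀ *ᵥ a.2

/-- `ζ = (ξ + η) / √2`. -/
def zeta {N : ℕ} (a : Pair N) : Fin N → ℝ := fun i => (xi a i + eta a i) / √2

/-- `ξ ⊗ φ + φ ⊗ η - ⟨φ, ξ⟩ (φ ⊗ φ)`. -/
def rhoMat {N : ℕ} (a : Pair N) : Matrix (Fin N) (Fin N) ℝ :=
  tens (xi a) a.2 + tens a.2 (eta a) - ip a.2 (xi a) • tens a.2 a.2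

/-- `h^{(k+1)} = h 1 + β ∑_{s=1}^{k-1} γ_s ζ^{(s)} + β √(q - Γ_{k-1}²) ζ^{(k)}`, computed from the
pairs `a s = (g^{(s)}, φ^{(s)})`, `1 ≤ s ≤ k`. -/
def nextField (β h : ℝ) {N : ℕ} (a : ℕ → Pair N) (k : ℕ) : Fin N → ℝ := fun i =>
  h + β * ∑ s ∈ Finset.Icc 1 (k - 1), gamma β h s * zeta (a s) i +
    β * √(overlap β h - GammaSq β h (k - 1)) * zeta (a k) i

/-- `m^{(k+1)} = tanh h^{(k+1)}`. -/
def nextMag (β h : ℝ) {N : ℕ} (a : ℕ → Pair N) (k : ℕ) : Fin N → ℝ := fun i =>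
  Real.tanh (nextField β h a k i)

/-- `m^{(k+1)} - ∑_{s=1}^k ⟨m^{(k+1)}, φ^{(s)}⟩ φ^{(s)}`. -/
def nextResidual (β h : ℝ) {N : ℕ} (a : ℕ → Pair N) (k : ℕ) : Fin N → ℝ :=
  nextMag β h a k - ∑ s ∈ Finset.Icc 1 k, ip (nextMag β h a k) (a s).2 • (a s).2

/-- `(g^{(k+1)}, φ^{(k+1)})`, computed from the pairs `a s = (g^{(s)}, φ^{(s)})`, `1 ≤ s ≤ k`:
`g^{(k+1)} = g^{(k)} - ρ^{(k)}`, and `φ^{(k+1)}` is the normalized residual. -/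
def next (β h : ℝ) {N : ℕ} (a : ℕ → Pair N) (k : ℕ) : Pair N :=
  ((a k).1 - rhoMat (a k), (nrm (nextResidual β h a k))⁻¹ • nextResidual β h a k)

/-- The sequence `(g^{(k)}, φ^{(k)})`, `k ≥ 1`, started at `(g, 1)`. The value at `0` is unused. See
`iter_succ` for the recursion. -/
def iter (β h : ℝ) {N : ℕ} (g : Matrix (Fin N) (Fin N) ℝ) : ℕ → Pair N
  | 0 => (0, 0)
  | 1 => (g, 1)
  | k + 2 => next β h (fun s => if s < k + 2 then iter β h g s else (0, 0)) (k + 1)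

theorem next_congr (β h : ℝ) {N : ℕ} {a b : ℕ → Pair N} {k : ℕ} (hk : 1 ≤ k)
    (hab : ∀ s, 1 ≤ s → s ≤ k → a s = b s) : next β h a k = next β h b k := by
  have e1 : nextMag β h a k = nextMag β h b k := by
    funext i
    simp only [nextMag, nextField]
    rw [hab k hk le_rfl, Finset.sum_congr rfl fun s hs => ?_]
    have := Finset.mem_Icc.1 hs
    rw [hab s (by omega) (by omega)]
  have e2 : nextResidual β h a k = nextResidual β h b k := by
    simp only [nextResidual, e1]
    rw [Finset.sum_congr rfl fun s hs => ?_]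
    have := Finset.mem_Icc.1 hs
    rw [hab s (by omega) (by omega)]
  rw [next, next, e2, hab k hk le_rfl]

theorem iter_succ (β h : ℝ) {N : ℕ} (g : Matrix (Fin N) (Fin N) ℝ) {k : ℕ} (hk : 1 ≤ k) :
    iter β h g (k + 1) = next β h (iter β h g) k := by
  obtain ⟨k, rfl⟩ : ∃ l, k = l + 1 := ⟨k - 1, by omega⟩
  rw [iter]
  refine next_congr β h hk fun s _ hs => ?_
  rw [if_pos (by omega)]

/-! ### The model -/

/-- The value of a spin: `true ↦ 1`, `false ↦ -1`. -/
def spin (b : Bool) : ℝ := if b then 1 else -1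

/-- The Hamiltonian `H_{β,h}(σ)`, for a realization `g` of the interactions. -/
def hamiltonian (β h : ℝ) {N : ℕ} (g : Matrix (Fin N) (Fin N) ℝ) (σ : Fin N → Bool) : ℝ :=
  β / √2 * ∑ i, ∑ j, g i j * spin (σ i) * spin (σ j) + h * ∑ i, spin (σ i)

/-- The partition function `Z_{N,β,h} = 2^{-N} ∑_σ exp H_{β,h}(σ)`. -/
def partitionFunction (β h : ℝ) {N : ℕ} (g : Matrix (Fin N) (Fin N) ℝ) : ℝ :=
  (2 ^ N)⁻¹ * ∑ σ : Fin N → Bool, Real.exp (hamiltonian β h g σ)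

/-- `𝒢_k = σ(ξ^{(m)}, η^{(m)} : 1 ≤ m ≤ k)`, for a random interaction matrix `g`. -/
abbrev sigmaField (β h : ℝ) {Ω : Type*} {N : ℕ} (g : Ω → Matrix (Fin N) (Fin N) ℝ) (k : ℕ) :
    MeasurableSpace Ω :=
  ⨆ m ∈ Finset.Icc 1 k,
    MeasurableSpace.comap (fun ω => xi (iter β h (g ω) m)) inferInstance ⊔
      MeasurableSpace.comap (fun ω => eta (iter β h (g ω) m)) inferInstance

/-- `E |N⁻¹ log E(Z_N | 𝒢_k) - RS(β, h)|`, as an element of `[0, ∞]`, for a random interaction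
matrix `g`. -/
def firstMomentError (β h : ℝ) {Ω : Type*} [MeasurableSpace Ω] (P : Measure Ω) {N : ℕ}
    (g : Ω → Matrix (Fin N) (Fin N) ℝ) (k : ℕ) : ℝ≥0∞ :=
  ∫⁻ ω, ENNReal.ofReal |(N : ℝ)⁻¹ *
      Real.log ((P[fun ω' => partitionFunction β h (g ω') | sigmaField β h g k]) ω) - RS β h| ∂P

/-! ### The number `q` is well defined -/

theorem continuous_tanh : Continuous Real.tanh := by
  have : Real.tanh = fun x => Real.sinh x / Real.cosh x := by
    funext x; exact Real.tanh_eq_sinh_div_cosh x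
  rw [this]
  exact Real.continuous_sinh.div Real.continuous_cosh fun x => (Real.cosh_pos x).ne'

theorem tanh_sq_le_one (x : ℝ) : Real.tanh x ^ 2 ≤ 1 := by
  rw [Real.tanh_eq_sinh_div_cosh, div_pow, div_le_one (by have := Real.cosh_pos x; positivity)]
  linarith [Real.cosh_sq x]

theorem continuous_overlapMap (β h : ℝ) : Continuous (overlapMap β h) := by
  refine continuous_of_dominated (bound := fun _ => 1) ?_ ?_ (integrable_const _) ?_
  · intro q
    exact ((continuous_tanh.comp (by fun_prop)).pow 2).aestronglyMeasurable
  · intro q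
    refine Eventually.of_forall fun x => ?_
    rw [Real.norm_eq_abs, abs_of_nonneg (sq_nonneg _)]
    exact tanh_sq_le_one _
  · refine Eventually.of_forall fun x => ?_
    exact (continuous_tanh.comp (by fun_prop)).pow 2

theorem overlapMap_le_one (β h q : ℝ) : overlapMap β h q ≤ 1 := by
  have h1 : overlapMap β h q ≤ ∫ _, (1 : ℝ) ∂stdGauss := by
    refine integral_mono_of_nonneg (Eventually.of_forall fun x => sq_nonneg _)
      (integrable_const _) (Eventually.of_forall fun x => tanh_sq_le_one _)
  simpa using h1

theorem overlap_spec (β h : ℝ) :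
    0 ≤ overlap β h ∧ overlap β h = overlapMap β h (overlap β h) := by
  have hcl : IsClosed {q : ℝ | 0 ≤ q ∧ q = overlapMap β h q} :=
    (isClosed_le continuous_const continuous_id).inter
      (isClosed_eq continuous_id (continuous_overlapMap β h))
  refine hcl.csInf_mem ?_ ⟨0, fun q hq => hq.1⟩
  have hivt := intermediate_value_Icc (zero_le_one (α := ℝ))
    (f := fun q => q - overlapMap β h q)
    (continuous_id.sub (continuous_overlapMap β h)).continuousOn
  obtain ⟨q, hq, hq0⟩ := hivt (show (0 : ℝ) ∈ Set.Icc _ _ from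
    ⟨by
      have : 0 ≤ overlapMap β h 0 := integral_nonneg fun x => sq_nonneg _
      simpa using this, by simpa using overlapMap_le_one β h 1⟩)
  exact ⟨q, hq.1, by simpa [sub_eq_zero] using hq0⟩

/-! ### The infimum and the conditional expectation are meaningful -/

theorem rsFunctional_nonneg (β h q : ℝ) : 0 ≤ rsFunctional β h q :=
  add_nonneg (integral_nonneg fun x => Real.log_nonneg (Real.one_le_cosh _)) (by positivity)

theorem bddBelow_rsFunctional (β h : ℝ) :
    BddBelow (Set.range fun q : ℝ≥0 => rsFunctional β h q) :=
  ⟨0, by rintro _ ⟨q, rfl⟩; exact rsFunctional_nonneg β h q⟩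

theorem measurable_xi {Ω : Type*} [MeasurableSpace Ω] {N : ℕ} {a : Ω → Pair N}
    (h1 : ∀ i j, Measurable fun ω => (a ω).1 i j) (h2 : ∀ i, Measurable fun ω => (a ω).2 i)
    (i : Fin N) : Measurable fun ω => xi (a ω) i := by
  simp only [xi, Matrix.mulVec, dotProduct]
  exact Finset.measurable_sum _ fun j _ => (h1 i j).mul (h2 j)

theorem measurable_eta {Ω : Type*} [MeasurableSpace Ω] {N : ℕ} {a : Ω → Pair N}
    (h1 : ∀ i j, Measurable fun ω => (a ω).1 i j) (h2 : ∀ i, Measurable fun ω => (a ω).2 i)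
    (i : Fin N) : Measurable fun ω => eta (a ω) i := by
  simp only [eta, Matrix.mulVec, dotProduct, Matrix.transpose_apply]
  exact Finset.measurable_sum _ fun j _ => (h1 j i).mul (h2 j)

theorem measurable_ip {Ω : Type*} [MeasurableSpace Ω] {N : ℕ} {x y : Ω → Fin N → ℝ}
    (hx : ∀ i, Measurable fun ω => x ω i) (hy : ∀ i, Measurable fun ω => y ω i) :
    Measurable fun ω => ip (x ω) (y ω) :=
  measurable_const.mul (Finset.measurable_sum _ fun i _ => (hx i).mul (hy i))

theorem measurable_iter (β h : ℝ) {Ω : Type*} [MeasurableSpace Ω] {N : ℕ}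
    {g : Ω → Matrix (Fin N) (Fin N) ℝ} (hg : ∀ i j, Measurable fun ω => g ω i j) (k : ℕ) :
    (∀ i j, Measurable fun ω => (iter β h (g ω) k).1 i j) ∧
      ∀ i, Measurable fun ω => (iter β h (g ω) k).2 i := by
  induction k using Nat.strong_induction_on with
  | _ k ih =>
  match k, ih with
  | 0, _ => simp [iter]
  | 1, _ => simpa [iter] using hg
  | k + 2, ih =>
    have ihk := ih (k + 1) (by omega)
    have hx := measurable_xi ihk.1 ihk.2
    have he := measurable_eta ihk.1 ihk.2
    have hz : ∀ s, s < k + 2 → ∀ i, Measurable fun ω => zeta (iter β h (g ω) s) i := by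
      intro s hs i
      have h1 := measurable_xi (ih s hs).1 (ih s hs).2 i
      have h2 := measurable_eta (ih s hs).1 (ih s hs).2 i
      exact (h1.add h2).div_const _
    have hm : ∀ i, Measurable fun ω => nextMag β h (iter β h (g ω)) (k + 1) i := by
      intro i
      refine continuous_tanh.measurable.comp ?_
      refine (measurable_const.add (measurable_const.mul
        (Finset.measurable_sum _ fun s hs => ?_))).add (measurable_const.mul (hz _ (by omega) i))
      have := Finset.mem_Icc.1 hs
      exact measurable_const.mul (hz s (by omega) i)
    have hr : ∀ i, Measurable fun ω => nextResidual β h (iter β h (g ω)) (k + 1) i := by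
      intro i
      simp only [nextResidual, Pi.sub_apply, Finset.sum_apply, Pi.smul_apply, smul_eq_mul]
      refine (hm i).sub (Finset.measurable_sum _ fun s hs => ?_)
      have := Finset.mem_Icc.1 hs
      have h2 := (ih s (by omega)).2
      exact (measurable_ip hm h2).mul (h2 i)
    have e : ∀ ω, iter β h (g ω) (k + 2) = next β h (iter β h (g ω)) (k + 1) :=
      fun ω => iter_succ β h (g ω) (by omega)
    simp only [e, next]
    obtain ⟨i1, i2⟩ := ihk
    constructor
    · intro i j
      simp only [rhoMat, tens, Matrix.sub_apply, Matrix.add_apply, Matrix.smul_apply,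
        Matrix.of_apply, smul_eq_mul]
      exact (i1 i j).sub (((((hx i).mul (i2 j)).div_const _).add
        (((i2 i).mul (he j)).div_const _)).sub
        ((measurable_ip i2 hx).mul (((i2 i).mul (i2 j)).div_const _)))
    · intro i
      simp only [nrm, Pi.smul_apply, smul_eq_mul]
      exact (measurable_ip hr hr).sqrt.inv.mul (hr i)

theorem sigmaField_le (β h : ℝ) {Ω : Type*} [m : MeasurableSpace Ω] {N : ℕ}
    {g : Ω → Matrix (Fin N) (Fin N) ℝ} (hg : ∀ i j, Measurable fun ω => g ω i j) (k : ℕ) :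
    sigmaField β h g k ≤ m := by
  refine iSup₂_le fun s _ => sup_le ?_ ?_
  · exact (measurable_pi_lambda _ fun i => measurable_xi (measurable_iter β h hg s).1
      (measurable_iter β h hg s).2 i).comap_le
  · exact (measurable_pi_lambda _ fun i => measurable_eta (measurable_iter β h hg s).1
      (measurable_iter β h hg s).2 i).comap_le

theorem integrable_partitionFunction (β h : ℝ) {Ω : Type*} [MeasurableSpace Ω] {P : Measure Ω}
    [IsProbabilityMeasure P] {N : ℕ} {g : Ω → Matrix (Fin N) (Fin N) ℝ}
    (hg : ∀ i j, Measurable fun ω => g ω i j)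
    (hlaw : ∀ i j, P.map (fun ω => g ω i j) = gaussianReal 0 (N : ℝ≥0)⁻¹)
    (hind : iIndepFun (fun (p : Fin N × Fin N) ω => g ω p.1 p.2) P) :
    Integrable (fun ω => partitionFunction β h (g ω)) P := by
  refine (integrable_finsetSum _ fun σ _ => ?_).const_mul _
  let X : Fin N × Fin N → Ω → ℝ := fun p ω =>
    β / √2 * (spin (σ p.1) * spin (σ p.2)) * g ω p.1 p.2
  have hX : ∀ p, Measurable (X p) := fun p => (hg p.1 p.2).const_mul _
  have hXi : iIndepFun X P :=
    hind.comp (fun p x => β / √2 * (spin (σ p.1) * spin (σ p.2)) * x)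
      fun p => measurable_const.mul measurable_id
  have key := hXi.integrable_exp_mul_sum (t := 1) hX (s := Finset.univ) fun p _ => by
    have h1 := integrable_exp_mul_gaussianReal (μ := 0) (v := (N : ℝ≥0)⁻¹)
      (β / √2 * (spin (σ p.1) * spin (σ p.2)))
    rw [← hlaw p.1 p.2] at h1
    have h2 := h1.comp_measurable (hg p.1 p.2)
    simpa [X, Function.comp_def] using h2
  refine (key.const_mul (Real.exp (h * ∑ i, spin (σ i)))).congr (Eventually.of_forall fun ω => ?_)
  simp only [hamiltonian, X, Finset.sum_apply, one_mul]
  rw [← Real.exp_add, add_comm, Fintype.sum_prod_type]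
  simp only [Finset.mul_sum]
  congr 2
  refine Finset.sum_congr rfl fun i _ => Finset.sum_congr rfl fun j _ => ?_
  ring

end

end SK

namespace SK
/-! ### Hyperbolic functions -/

/-! The conditional expectation is explicit. Let `Q_k` be the orthogonal projection along `φ^{(1)},
…, φ^{(k)}`. Then `g^{(k+1)} = Q_k g Q_k` (`iter_fst_eq`), and the vectors `ξ^{(m)}, η^{(m)}`, `m ≤
k`, are blind to this compressed part. Replacing it by `Q_k w Q_k`, with `w` an independent copy of
`g`, changes none of them (`iter_add_conj`) and preserves the law of the matrix
(`measurePreserving_resample`). Hence `E(Z_N | 𝒢_k)` is the average of the partition function over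
`w`, a Gaussian integral that equals `annealed` (`condExp_partitionFunction`).

The sum over `σ` in `annealed` is handled by a Laplace argument (`abs_log_annealed_sub_le`). Under
the product measure with fields `h^{(k+1)}`, whose mean is `m^{(k+1)}`, the remaining exponent
depends only on the `2k` linear functionals `⟨σ, φ^{(m)}⟩` and `⟨σ, ζ^{(m)}⟩`. It is expanded to
second order around the values of these functionals at `m^{(k+1)}`. The centered functionals are
sub-Gaussian on the scale `N^{-1/2}`, so for small `β` the exponential of `N` times the quadratic
remainder costs at most a factor `2^k`, which is negligible after `N⁻¹ log`. The linear term has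
mean zero, which gives the lower bound by Jensen's inequality; in the upper bound it costs a
multiple of the squared gradient.

The inner products in this expansion converge in probability as `N → ∞`. To see this, the matrix is
realized on another space, where its products with each new direction are built from fresh Gaussian
vectors (`explored`, `map_explored`). There `ζ^{(m)}` is the fresh vector `y_m` up to finitely many
small projections (`zeta_explored_of_unit`), so the fields are asymptotically Gaussian with variance
`β² q` and covariances `β² ρ_j`, and the law of large numbers applies. An induction on the step
(`controlled`) shows that no direction degenerates and gives `⟨m^{(k+1)}, φ^{(s)}⟩ → γ_s`.

Finally `k → ∞`. As `q` is a fixed point and `tanh` is `1`-Lipschitz, `q - ψ(t) ≤ β² (q - t)`, so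
`ρ_k` and `Γ_k²` tend to `q` (`tendsto_GammaSq`). The gradient then vanishes and the main term tends
to `β² (1 - q)² / 4`; together with the average of `log cosh` this is the functional at `q`, which
is its minimum (`RS_eq`). A second-moment bound that is uniform in `N` turns convergence in
probability into convergence in the mean (`limsup_lintegral_le`). -/

theorem hasDerivAt_tanh (x : ℝ) : HasDerivAt Real.tanh (1 - Real.tanh x ^ 2) x := by
  have e : Real.tanh = fun x => Real.sinh x / Real.cosh x :=
    funext fun x => Real.tanh_eq_sinh_div_cosh x
  rw [e]
  have hc := (Real.cosh_pos x).ne'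
  refine ((Real.hasDerivAt_sinh x).div (Real.hasDerivAt_cosh x) hc).congr_deriv ?_
  field_simp

theorem abs_tanh_le_one (x : ℝ) : |Real.tanh x| ≤ 1 := (Real.abs_tanh_lt_one x).le

theorem hasDerivAt_log_cosh (x : ℝ) :
    HasDerivAt (fun x => Real.log (Real.cosh x)) (Real.tanh x) x := by
  rw [Real.tanh_eq_sinh_div_cosh]
  exact (Real.hasDerivAt_cosh x).log (Real.cosh_pos x).ne'

theorem abs_tanh_sub_le (x y : ℝ) : |Real.tanh x - Real.tanh y| ≤ |x - y| := by
  have := Convex.norm_image_sub_le_of_norm_hasDerivWithin_le (f := Real.tanh) (C := 1)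
    (s := Set.univ) (x := y) (y := x)
    (fun z _ => (hasDerivAt_tanh z).hasDerivWithinAt) (fun z _ => by
      rw [Real.norm_eq_abs, abs_le]
      have := tanh_sq_le_one z
      constructor <;> nlinarith [sq_nonneg (Real.tanh z)]) convex_univ trivial trivial
  simpa using this

theorem abs_log_cosh_sub_le (x y : ℝ) :
    |Real.log (Real.cosh x) - Real.log (Real.cosh y)| ≤ |x - y| := by
  have := Convex.norm_image_sub_le_of_norm_hasDerivWithin_le
    (f := fun x => Real.log (Real.cosh x)) (C := 1)
    (s := Set.univ) (x := y) (y := x)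
    (fun z _ => (hasDerivAt_log_cosh z).hasDerivWithinAt) (fun z _ => by
      rw [Real.norm_eq_abs]
      exact abs_tanh_le_one z) convex_univ trivial trivial
  simpa using this

theorem abs_log_cosh_le (x : ℝ) : |Real.log (Real.cosh x)| ≤ |x| := by
  simpa using abs_log_cosh_sub_le x 0

theorem continuous_log_cosh : Continuous fun x => Real.log (Real.cosh x) :=
  continuous_iff_continuousAt.2 fun x => (hasDerivAt_log_cosh x).continuousAt

/-- The second derivative of `log cosh` is `1 - tanh² ≤ 1`. In the proof, the gap `F` between the
two sides has derivative `tanh x + s - tanh (x + s)`, of the sign of `s` by the Lipschitz bound.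
This is the one-spin sub-Gaussian estimate behind `sum_gibbs_mul_exp_le`. -/
theorem log_cosh_add_le (x s : ℝ) :
    Real.log (Real.cosh (x + s)) ≤ Real.log (Real.cosh x) + s * Real.tanh x + s ^ 2 / 2 := by
  let F : ℝ → ℝ := fun s =>
    Real.log (Real.cosh x) + s * Real.tanh x + s ^ 2 / 2 - Real.log (Real.cosh (x + s))
  have hF : ∀ s, HasDerivAt F (Real.tanh x + s - Real.tanh (x + s)) s := fun s => by
    have h1 : HasDerivAt (fun s => Real.log (Real.cosh (x + s))) (Real.tanh (x + s)) s := by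
      have := (hasDerivAt_log_cosh (x + s)).comp s ((hasDerivAt_id s).const_add x)
      simpa [Function.comp_def] using this
    have h2 := ((((hasDerivAt_id s).mul_const (Real.tanh x)).const_add
      (Real.log (Real.cosh x))).add (((hasDerivAt_id s).pow 2).div_const 2)).sub h1
    refine h2.congr_deriv ?_
    simp
  have hc : Continuous F := continuous_iff_continuousAt.2 fun s => (hF s).continuousAt
  have h0 : F 0 = 0 := by simp [F]
  suffices h : 0 ≤ F s by simp only [F] at h; linarith
  rw [← h0]
  rcases le_total 0 s with hs | hs
  · refine monotoneOn_of_deriv_nonneg (convex_Ici 0) hc.continuousOn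
      (fun s _ => (hF s).differentiableAt.differentiableWithinAt) (fun t ht => ?_)
      Set.self_mem_Ici hs hs
    rw [(hF t).deriv]
    rw [interior_Ici] at ht
    have := abs_tanh_sub_le (x + t) x
    have ht' : 0 < t := ht
    rw [add_sub_cancel_left, abs_of_pos ht'] at this
    linarith [le_abs_self (Real.tanh (x + t) - Real.tanh x)]
  · refine antitoneOn_of_deriv_nonpos (convex_Iic 0) hc.continuousOn
      (fun s _ => (hF s).differentiableAt.differentiableWithinAt) (fun t ht => ?_)
      hs Set.self_mem_Iic hs
    rw [(hF t).deriv]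
    rw [interior_Iic] at ht
    have := abs_tanh_sub_le (x + t) x
    have ht' : t < 0 := ht
    rw [add_sub_cancel_left, abs_of_neg ht'] at this
    linarith [neg_abs_le (Real.tanh (x + t) - Real.tanh x)]

/-! ### Gaussian integration by parts -/

theorem integrable_abs_stdGauss : Integrable (fun x : ℝ => |x|) stdGauss :=
  ((memLp_id_gaussianReal' (μ := 0) (v := 1) 1 (by simp)).integrable le_rfl).abs

theorem integrable_sq_stdGauss : Integrable (fun x : ℝ => x ^ 2) stdGauss :=
  (memLp_id_gaussianReal' (μ := 0) (v := 1) 2 (by simp)).integrable_sq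

theorem integral_sq_stdGauss : ∫ x, x ^ 2 ∂stdGauss = 1 := by
  have h := variance_fun_id_gaussianReal (μ := 0) (v := 1)
  rw [variance_eq_integral (by fun_prop)] at h
  simpa using h

theorem integrable_of_bounded {α : Type*} [MeasurableSpace α] {μ : Measure α} [IsFiniteMeasure μ]
    {f : α → ℝ} (hf : AEStronglyMeasurable f μ) {C : ℝ} (hC : ∀ x, |f x| ≤ C) : Integrable f μ :=
  (integrable_const C).mono' hf (Eventually.of_forall hC)

theorem hasDerivAt_gaussianPDFReal (x : ℝ) :
    HasDerivAt (gaussianPDFReal 0 1) (-(x * gaussianPDFReal 0 1 x)) x := by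
  have h1 : HasDerivAt (fun x : ℝ => -(x - 0) ^ 2 / (2 * ((1 : ℝ≥0) : ℝ))) (-x) x := by
    have := (((hasDerivAt_id x).sub_const 0).pow 2).neg.div_const (2 * ((1 : ℝ≥0) : ℝ))
    refine this.congr_deriv ?_
    simp
    ring
  have h2 := h1.exp.const_mul (√(2 * Real.pi * ((1 : ℝ≥0) : ℝ)))⁻¹
  rw [gaussianPDFReal_def]
  refine h2.congr_deriv ?_
  simp only [sub_zero]
  ring

/-- Gaussian integration by parts. -/
theorem integral_id_mul_stdGauss {f f' : ℝ → ℝ} (hf : ∀ x, HasDerivAt f (f' x) x)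
    (hm : Measurable f') {C : ℝ} (hC : ∀ x, |f x| ≤ C) (hC' : ∀ x, |f' x| ≤ C) :
    ∫ x, x * f x ∂stdGauss = ∫ x, f' x ∂stdGauss := by
  have hfm : Measurable f :=
    (continuous_iff_continuousAt.2 fun x => (hf x).continuousAt).measurable
  -- Integrability is moved to Lebesgue measure, where the identity is ordinary integration by parts
  -- against a density `p` with `p' = -x p`.
  have key : ∀ u : ℝ → ℝ, Integrable u stdGauss →
      Integrable (fun x => gaussianPDFReal 0 1 x * u x) volume := by
    intro u hu
    change Integrable u (gaussianReal 0 1) at hu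
    rw [gaussianReal_of_var_ne_zero 0 one_ne_zero] at hu
    rw [integrable_withDensity_iff_integrable_smul' (measurable_gaussianPDF _ _)
      (ae_of_all _ fun _ => gaussianPDF_lt_top)] at hu
    simpa [toReal_gaussianPDF] using hu
  have i1 : Integrable f stdGauss := integrable_of_bounded hfm.aestronglyMeasurable hC
  have i2 : Integrable f' stdGauss := integrable_of_bounded hm.aestronglyMeasurable hC'
  have i3 : Integrable (fun x => x * f x) stdGauss := by
    refine (integrable_abs_stdGauss.const_mul C).mono'
      (measurable_id.mul hfm).aestronglyMeasurable (Eventually.of_forall fun x => ?_)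
    rw [Real.norm_eq_abs, abs_mul, mul_comm]
    exact mul_le_mul_of_nonneg_right (hC x) (abs_nonneg _)
  have h := integral_mul_deriv_eq_deriv_mul_of_integrable (u := f) (u' := f')
    (v := gaussianPDFReal 0 1) (v' := fun x => -(x * gaussianPDFReal 0 1 x))
    (fun x _ => hf x) (fun x _ => hasDerivAt_gaussianPDFReal x)
    ((key _ i3).neg.congr (Eventually.of_forall fun x => by simp; ring))
    ((key _ i2).congr (Eventually.of_forall fun x => by simp; ring))
    ((key _ i1).congr (Eventually.of_forall fun x => by simp; ring))
  rw [integral_gaussianReal_eq_integral_smul one_ne_zero,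
    integral_gaussianReal_eq_integral_smul one_ne_zero]
  have e1 : ∫ x, gaussianPDFReal 0 1 x • (x * f x) =
      - ∫ x, f x * -(x * gaussianPDFReal 0 1 x) := by
    rw [← integral_neg]
    congr 1; funext x; simp; ring
  rw [e1, h, neg_neg]
  congr 1; funext x; simp; ring

theorem integral_id_mul_tanh (h b : ℝ) :
    ∫ x, x * Real.tanh (h + b * x) ∂stdGauss =
      b * ∫ x, (1 - Real.tanh (h + b * x) ^ 2) ∂stdGauss := by
  rw [← integral_const_mul]
  refine integral_id_mul_stdGauss (C := 1 + |b|) (fun x => ?_) ?_ (fun x => ?_) (fun x => ?_)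
  · have := (hasDerivAt_tanh (h + b * x)).comp x (((hasDerivAt_id x).const_mul b).const_add h)
    refine this.congr_deriv ?_
    simp [mul_comm]
  · have := continuous_tanh
    exact (by fun_prop : Continuous _).measurable
  · linarith [abs_tanh_le_one (h + b * x), abs_nonneg b]
  · have h1 : 0 ≤ 1 - Real.tanh (h + b * x) ^ 2 := by linarith [tanh_sq_le_one (h + b * x)]
    rw [abs_mul, abs_of_nonneg h1]
    nlinarith [abs_nonneg b, sq_nonneg (Real.tanh (h + b * x))]

/-! ### The replica-symmetric functional -/

/-- The variable is `s = √q` and not `q`: the square root is singular at `0`, whereas in `s` the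
differentiated integrand is dominated by a multiple of `|x|`. -/
theorem hasDerivAt_integral_comp {F F' : ℝ → ℝ} (hF : ∀ x, HasDerivAt F (F' x) x)
    (hF' : Measurable F') {C : ℝ} (hC : ∀ x, |F' x| ≤ C) (hFC : ∀ x, |F x| ≤ |F 0| + C * |x|)
    (h β s : ℝ) :
    HasDerivAt (fun s => ∫ x, F (h + β * s * x) ∂stdGauss)
      (β * ∫ x, x * F' (h + β * s * x) ∂stdGauss) s := by
  have hFc : Continuous F := continuous_iff_continuousAt.2 fun x => (hF x).continuousAt
  have hC0 : 0 ≤ C := (abs_nonneg _).trans (hC 0)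
  rw [← integral_const_mul]
  refine (hasDerivAt_integral_of_dominated_loc_of_deriv_le (s := Set.univ)
    (F' := fun s x => β * (x * F' (h + β * s * x)))
    (bound := fun x => |β| * C * |x|) univ_mem ?_ ?_ ?_ ?_ ?_ ?_).2
  · exact Eventually.of_forall fun t => (by fun_prop : Continuous _).aestronglyMeasurable
  · refine Integrable.mono' (g := fun x => (|F 0| + C * |h|) + C * |β * s| * |x|)
      ((integrable_const _).add (integrable_abs_stdGauss.const_mul _))
      (by fun_prop : Continuous _).aestronglyMeasurable (Eventually.of_forall fun x => ?_)
    rw [Real.norm_eq_abs]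
    refine (hFC _).trans ?_
    have := abs_add_le h (β * s * x)
    rw [abs_mul (β * s)] at this
    nlinarith
  · exact (by fun_prop : Measurable _).aestronglyMeasurable
  · refine Eventually.of_forall fun x t _ => ?_
    rw [Real.norm_eq_abs, abs_mul, abs_mul]
    have := mul_le_mul_of_nonneg_left (hC (h + β * t * x)) (mul_nonneg (abs_nonneg β) (abs_nonneg x))
    linarith
  · exact integrable_abs_stdGauss.const_mul _
  · refine Eventually.of_forall fun x t _ => ?_
    have h1 : HasDerivAt (fun t => h + β * t * x) (β * x) t := by
      have := (((hasDerivAt_id t).const_mul β).mul_const x).const_add h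
      simpa using this
    refine ((hF _).comp t h1).congr_deriv ?_
    ring

theorem hasDerivAt_integral_log_cosh (h β s : ℝ) :
    HasDerivAt (fun s => ∫ x, Real.log (Real.cosh (h + β * s * x)) ∂stdGauss)
      (β ^ 2 * s * (1 - ∫ x, Real.tanh (h + β * s * x) ^ 2 ∂stdGauss)) s := by
  refine (hasDerivAt_integral_comp hasDerivAt_log_cosh continuous_tanh.measurable abs_tanh_le_one
    (fun x => by simpa using abs_log_cosh_le x) h β s).congr_deriv ?_
  rw [integral_id_mul_tanh, integral_sub (integrable_const _)]
  · simp; ring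
  · refine integrable_of_bounded (C := 1) ?_ fun x => ?_
    · have := continuous_tanh
      exact (by fun_prop : Continuous _).aestronglyMeasurable
    · rw [abs_of_nonneg (sq_nonneg _)]
      exact tanh_sq_le_one _

/-- Integration by parts turns the derivative into `β² s` times the mean of the second derivative of
`tanh²`, namely `2 (1 - tanh²)(1 - 3 tanh²) ≤ 2`. The bound makes `s² - E tanh²` nondecreasing when
`β² ≤ 1`. -/
theorem hasDerivAt_integral_tanh_sq (h β s : ℝ) :
    ∃ c, HasDerivAt (fun s => ∫ x, Real.tanh (h + β * s * x) ^ 2 ∂stdGauss) c s ∧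
      (0 ≤ s → c ≤ 2 * β ^ 2 * s) := by
  have hct := continuous_tanh
  have d1 : ∀ x, HasDerivAt (fun x => Real.tanh x ^ 2)
      (2 * Real.tanh x * (1 - Real.tanh x ^ 2)) x := fun x => by
    refine ((hasDerivAt_tanh x).pow 2).congr_deriv ?_
    simp
  have b1 : ∀ x, |2 * Real.tanh x * (1 - Real.tanh x ^ 2)| ≤ 2 := fun x => by
    have h1 := abs_tanh_le_one x
    have h2 := tanh_sq_le_one x
    rw [abs_mul, abs_mul, abs_two, abs_of_nonneg (by linarith : 0 ≤ 1 - Real.tanh x ^ 2)]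
    nlinarith [abs_nonneg (Real.tanh x), sq_nonneg (Real.tanh x)]
  have d2 : ∀ x, HasDerivAt (fun x => 2 * Real.tanh x * (1 - Real.tanh x ^ 2))
      (2 * (1 - Real.tanh x ^ 2) * (1 - 3 * Real.tanh x ^ 2)) x := fun x => by
    refine (((hasDerivAt_tanh x).const_mul 2).mul ((d1 x).const_sub 1)).congr_deriv ?_
    ring
  have hd := hasDerivAt_integral_comp d1 (by fun_prop) b1 (fun x => by
    have h2 := tanh_sq_le_one x
    have h3 := abs_tanh_sub_le x 0
    have h4 := abs_tanh_le_one x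
    simp only [Real.tanh_zero, sub_zero] at h3
    have h5 : Real.tanh x ^ 2 ≤ |Real.tanh x| := by
      rw [← sq_abs]
      nlinarith [abs_nonneg (Real.tanh x)]
    rw [abs_of_nonneg (sq_nonneg _)]
    simp
    linarith [abs_nonneg x]) h β s
  have e : ∫ x, x * (2 * Real.tanh (h + β * s * x) * (1 - Real.tanh (h + β * s * x) ^ 2)) ∂stdGauss
      = ∫ x, β * s * (2 * (1 - Real.tanh (h + β * s * x) ^ 2) *
        (1 - 3 * Real.tanh (h + β * s * x) ^ 2)) ∂stdGauss := by
    refine integral_id_mul_stdGauss (C := 2 + 6 * |β * s|) (fun x => ?_) (by fun_prop)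
      (fun x => (b1 _).trans (by linarith [abs_nonneg (β * s)])) (fun x => ?_)
    · have := (d2 (h + β * s * x)).comp x (((hasDerivAt_id x).const_mul (β * s)).const_add h)
      refine this.congr_deriv ?_
      simp only [mul_one]; ring
    · rw [abs_mul]
      have h2 := tanh_sq_le_one (h + β * s * x)
      have : |2 * (1 - Real.tanh (h + β * s * x) ^ 2) *
        (1 - 3 * Real.tanh (h + β * s * x) ^ 2)| ≤ 6 := by
        rw [abs_le]
        constructor <;> nlinarith [sq_nonneg (Real.tanh (h + β * s * x))]
      nlinarith [abs_nonneg (β * s)]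
  rw [e, integral_const_mul] at hd
  have bb : ∫ x, 2 * (1 - Real.tanh (h + β * s * x) ^ 2) *
        (1 - 3 * Real.tanh (h + β * s * x) ^ 2) ∂stdGauss ≤ 2 := by
    have : ∫ x, 2 * (1 - Real.tanh (h + β * s * x) ^ 2) *
        (1 - 3 * Real.tanh (h + β * s * x) ^ 2) ∂stdGauss ≤ ∫ x, (2 : ℝ) ∂stdGauss := by
      refine integral_mono (integrable_of_bounded (C := 6)
        (by fun_prop : Continuous _).aestronglyMeasurable fun x => ?_) (integrable_const _) fun x => ?_
      · have h2 := tanh_sq_le_one (h + β * s * x)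
        rw [abs_le]
        constructor <;> nlinarith [sq_nonneg (Real.tanh (h + β * s * x))]
      · have h2 := tanh_sq_le_one (h + β * s * x)
        simp only
        nlinarith [sq_nonneg (Real.tanh (h + β * s * x))]
    simpa using this
  set I := ∫ x, 2 * (1 - Real.tanh (h + β * s * x) ^ 2) *
        (1 - 3 * Real.tanh (h + β * s * x) ^ 2) ∂stdGauss
  refine ⟨_, hd, fun hs => ?_⟩
  · have : s * I ≤ 2 * s := by nlinarith
    nlinarith [sq_nonneg β]

/-- As a function of `s = √q` the functional has derivative `β² s D(s)` with `D(s) = s² - E tanh²`.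
Here `D` is nondecreasing on `s ≥ 0` and vanishes at the root of the overlap, so the functional
decreases up to that point and increases beyond it. -/
theorem RS_eq {β h : ℝ} (hβ : β ^ 2 ≤ 1) : RS β h = rsFunctional β h (overlap β h) := by
  obtain ⟨hq0, hq⟩ := overlap_spec β h
  set q := overlap β h
  let D : ℝ → ℝ := fun s => s ^ 2 - ∫ x, Real.tanh (h + β * s * x) ^ 2 ∂stdGauss
  have hD : ∀ s, ∃ c, HasDerivAt D c s ∧ (0 ≤ s → 0 ≤ c) := fun s => by
    obtain ⟨c, hc, hc'⟩ := hasDerivAt_integral_tanh_sq h β s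
    refine ⟨_, ((hasDerivAt_id s).pow 2).sub hc, fun hs => ?_⟩
    have := hc' hs
    simp
    nlinarith
  have hDmono : MonotoneOn D (Set.Ici 0) := by
    refine monotoneOn_of_deriv_nonneg (convex_Ici 0)
      (fun s _ => (hD s).choose_spec.1.continuousAt.continuousWithinAt)
      (fun s _ => (hD s).choose_spec.1.differentiableAt.differentiableWithinAt) (fun s hs => ?_)
    rw [interior_Ici] at hs
    rw [(hD s).choose_spec.1.deriv]
    exact (hD s).choose_spec.2 (le_of_lt hs)
  have hDq : D (√q) = 0 := by
    simp only [D, Real.sq_sqrt hq0]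
    rw [sub_eq_zero]
    exact hq
  let F : ℝ → ℝ := fun s =>
    (∫ x, Real.log (Real.cosh (h + β * s * x)) ∂stdGauss) + β ^ 2 * (1 - s ^ 2) ^ 2 / 4
  have hF : ∀ s, HasDerivAt F (β ^ 2 * s * D s) s := fun s => by
    have h2 : HasDerivAt (fun s : ℝ => β ^ 2 * (1 - s ^ 2) ^ 2 / 4) (-(β ^ 2 * s * (1 - s ^ 2))) s := by
      have := (((((hasDerivAt_id s).pow 2).const_sub 1).pow 2).const_mul (β ^ 2)).div_const 4
      refine this.congr_deriv ?_
      simp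
      ring
    refine ((hasDerivAt_integral_log_cosh h β s).add h2).congr_deriv ?_
    simp only [D]
    ring
  have hFc : Continuous F := continuous_iff_continuousAt.2 fun s => (hF s).continuousAt
  have hmin : ∀ s, 0 ≤ s → F (√q) ≤ F s := by
    intro s hs
    rcases le_total (√q) s with h1 | h1
    · refine monotoneOn_of_deriv_nonneg (convex_Ici (√q)) hFc.continuousOn
        (fun s _ => (hF s).differentiableAt.differentiableWithinAt) (fun t ht => ?_)
        Set.self_mem_Ici h1 h1
      rw [interior_Ici] at ht
      have ht0 : 0 ≤ t := (Real.sqrt_nonneg q).trans (le_of_lt ht)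
      rw [(hF t).deriv]
      have : 0 ≤ D t := by
        rw [← hDq]
        exact hDmono (Real.sqrt_nonneg q) ht0 (le_of_lt ht)
      positivity
    · refine antitoneOn_of_deriv_nonpos (convex_Icc 0 (√q)) hFc.continuousOn
        (fun s _ => (hF s).differentiableAt.differentiableWithinAt) (fun t ht => ?_)
        ⟨hs, h1⟩ ⟨Real.sqrt_nonneg q, le_rfl⟩ h1
      rw [interior_Icc] at ht
      rw [(hF t).deriv]
      have : D t ≤ 0 := by
        rw [← hDq]
        exact hDmono ht.1.le (Real.sqrt_nonneg q) ht.2.le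
      have h3 : 0 ≤ β ^ 2 * t := mul_nonneg (sq_nonneg _) ht.1.le
      exact mul_nonpos_of_nonneg_of_nonpos h3 this
  have hrs : ∀ p, 0 ≤ p → rsFunctional β h p = F (√p) := fun p hp => by
    simp only [rsFunctional, F, Real.sq_sqrt hp]
  refine le_antisymm (ciInf_le_of_le (bddBelow_rsFunctional β h) ⟨q, hq0⟩ le_rfl) ?_
  refine le_ciInf fun p => ?_
  rw [hrs q hq0, hrs p p.2]
  exact hmin _ (Real.sqrt_nonneg _)

/-! ### Gaussian pairs -/

/-- `(A, B)` is a centered Gaussian pair with `E A² = u`, `E A B = t`, `E B² = v`. -/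
structure IsGaussPair {Ω : Type*} [MeasurableSpace Ω] (P : Measure Ω) (A B : Ω → ℝ)
    (u t v : ℝ) : Prop where
  meas_left : Measurable A
  meas_right : Measurable B
  char_eq : ∀ a b : ℝ, ∫ ω, Complex.exp ((a * A ω + b * B ω : ℝ) * Complex.I) ∂P =
    Complex.exp ((-(a ^ 2 * u + 2 * a * b * t + b ^ 2 * v) / 2 : ℝ))

theorem integral_exp_stdGauss (a : ℝ) :
    ∫ x, Complex.exp ((a * x : ℝ) * Complex.I) ∂stdGauss = Complex.exp ((-(a ^ 2) / 2 : ℝ)) := by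
  have := charFun_gaussianReal (μ := 0) (v := 1) a
  rw [charFun_apply_real] at this
  push_cast
  rw [this]
  congr 1
  push_cast
  simp
  ring

theorem integral_exp_sum_of_iIndepFun {Ω ι : Type*} [MeasurableSpace Ω] {P : Measure Ω}
    [IsProbabilityMeasure P] [Fintype ι] {X : ι → Ω → ℝ} (hX : ∀ i, Measurable (X i))
    (hlaw : ∀ i, P.map (X i) = stdGauss) (hind : iIndepFun X P) (a : ι → ℝ) :
    ∫ ω, Complex.exp ((∑ i, a i * X i ω : ℝ) * Complex.I) ∂P =
      Complex.exp ((-(∑ i, a i ^ 2) / 2 : ℝ)) := by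
  have h1 := hind.map_fun_eq_pi_map fun i => (hX i).aemeasurable
  simp only [hlaw] at h1
  have h2 : ∫ ω, Complex.exp ((∑ i, a i * X i ω : ℝ) * Complex.I) ∂P =
      ∫ x : ι → ℝ, ∏ i, Complex.exp ((a i * x i : ℝ) * Complex.I)
        ∂(Measure.pi fun _ => stdGauss) := by
    rw [← h1, integral_map (measurable_pi_lambda _ hX).aemeasurable
      (by fun_prop : Continuous _).aestronglyMeasurable]
    congr 1; funext ω
    rw [← Complex.exp_sum, ← Finset.sum_mul]
    push_cast
    rfl
  rw [h2, integral_fintype_prod_eq_prod (f := fun i x => Complex.exp ((a i * x : ℝ) * Complex.I))]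
  simp only [integral_exp_stdGauss]
  rw [← Complex.exp_sum]
  congr 1
  push_cast
  rw [← Finset.sum_div, Finset.sum_neg_distrib]

namespace IsGaussPair

variable {Ω Ω' : Type*} [MeasurableSpace Ω] [MeasurableSpace Ω'] {P : Measure Ω} {P' : Measure Ω'}
  {A B : Ω → ℝ} {A' B' : Ω' → ℝ} {u t v : ℝ}

theorem comb (hP : IsGaussPair P A B u t v) (a b c d : ℝ) :
    IsGaussPair P (fun ω => a * A ω + b * B ω) (fun ω => c * A ω + d * B ω)
      (a ^ 2 * u + 2 * a * b * t + b ^ 2 * v) (a * c * u + (a * d + b * c) * t + b * d * v)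
      (c ^ 2 * u + 2 * c * d * t + d ^ 2 * v) where
  meas_left := (hP.meas_left.const_mul a).add (hP.meas_right.const_mul b)
  meas_right := (hP.meas_left.const_mul c).add (hP.meas_right.const_mul d)
  char_eq := fun x y => by
    have := hP.char_eq (x * a + y * c) (x * b + y * d)
    convert this using 4 <;> ring_nf

theorem symm (hP : IsGaussPair P A B u t v) : IsGaussPair P B A v t u := by
  have := hP.comb 0 1 1 0
  simpa using this

/-- A pair may be degenerate, since only its characteristic function is prescribed. This instance
makes one-dimensional statements special cases of two-dimensional ones. -/
theorem scaled {u : ℝ} (hu : 0 ≤ u) :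
    IsGaussPair stdGauss (fun x => √u * x) (fun x => √u * x) u u u where
  meas_left := measurable_id.const_mul _
  meas_right := measurable_id.const_mul _
  char_eq := fun a b => by
    have := integral_exp_stdGauss ((a + b) * √u)
    rw [mul_pow, Real.sq_sqrt hu] at this
    convert this using 4 <;> ring_nf

variable [IsProbabilityMeasure P] [IsProbabilityMeasure P']

theorem map_eq (hP : IsGaussPair P A B u t v) (hP' : IsGaussPair P' A' B' u t v) :
    P.map (fun ω => (A ω, B ω)) = P'.map (fun ω => (A' ω, B' ω)) := by
  have m1 := hP.meas_left.prodMk hP.meas_right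
  have m2 := hP'.meas_left.prodMk hP'.meas_right
  have := Measure.isProbabilityMeasure_map (μ := P) m1.aemeasurable
  have := Measure.isProbabilityMeasure_map (μ := P') m2.aemeasurable
  refine Measure.ext_of_charFunDual (funext fun L => ?_)
  obtain ⟨c, d, e⟩ : ∃ c d, ∀ a b : ℝ, L (a, b) = c * a + d * b := by
    refine ⟨L (1, 0), L (0, 1), fun a b => ?_⟩
    have : ((a, b) : ℝ × ℝ) = a • (1, 0) + b • (0, 1) := by simp
    rw [this, map_add, map_smul, map_smul]
    simp [mul_comm]
  rw [charFunDual_apply, charFunDual_apply,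
    integral_map m1.aemeasurable (by fun_prop : Continuous _).aestronglyMeasurable,
    integral_map m2.aemeasurable (by fun_prop : Continuous _).aestronglyMeasurable]
  simp only [e]
  rw [hP.char_eq, hP'.char_eq]

/-- Expectations may thus be computed in the most convenient realization of the pair. Integrability
is not needed, because both sides integrate `f` against the same law. -/
theorem integral_eq (hP : IsGaussPair P A B u t v) (hP' : IsGaussPair P' A' B' u t v)
    {f : ℝ × ℝ → ℝ} (hf : Measurable f) :
    ∫ ω, f (A ω, B ω) ∂P = ∫ ω, f (A' ω, B' ω) ∂P' := by
  have m1 := hP.meas_left.prodMk hP.meas_right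
  have m2 := hP'.meas_left.prodMk hP'.meas_right
  rw [← integral_map (f := f) m1.aemeasurable hf.aestronglyMeasurable, hP.map_eq hP',
    integral_map m2.aemeasurable hf.aestronglyMeasurable]

theorem integral_left (hP : IsGaussPair P A B u t v) (hu : 0 ≤ u) {f : ℝ → ℝ}
    (hf : Measurable f) : ∫ ω, f (A ω) ∂P = ∫ x, f (√u * x) ∂stdGauss := by
  have h1 : IsGaussPair P A A u u u := by
    have := hP.comb 1 0 1 0
    simpa using this
  exact h1.integral_eq (scaled hu) (f := fun p => f p.1) (hf.comp measurable_fst)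

theorem integral_sq_left (hP : IsGaussPair P A B u t v) (hu : 0 ≤ u) : ∫ ω, A ω ^ 2 ∂P = u := by
  rw [hP.integral_left hu (f := fun x => x ^ 2) (by fun_prop)]
  simp only [mul_pow, Real.sq_sqrt hu]
  rw [integral_const_mul, integral_sq_stdGauss, mul_one]

theorem memLp_left (hP : IsGaussPair P A B u t v) (hu : 0 ≤ u) (p : ℝ≥0) : MemLp A p P := by
  have h1 : IsGaussPair P A A u u u := by
    have := hP.comb 1 0 1 0
    simpa using this
  have h2 := h1.map_eq (scaled hu)
  have h3 := congrArg (Measure.map Prod.fst) h2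
  rw [Measure.map_map measurable_fst (hP.meas_left.prodMk hP.meas_left),
    Measure.map_map measurable_fst (by fun_prop)] at h3
  have h4 : MemLp (fun x : ℝ => √u * x) p stdGauss := (memLp_id_gaussianReal p).const_mul _
  have h5 : MemLp id p (P.map A) := by
    have : P.map A = stdGauss.map fun x => √u * x := h3
    rw [this, memLp_map_measure_iff aestronglyMeasurable_id (by fun_prop)]
    exact h4
  exact (memLp_map_measure_iff aestronglyMeasurable_id hP.meas_left.aemeasurable).1 h5

theorem memLp_right (hP : IsGaussPair P A B u t v) (hv : 0 ≤ v) (p : ℝ≥0) : MemLp B p P :=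
  hP.symm.memLp_left hv p

theorem of_iIndepFun {ι : Type*} [Fintype ι] {X : ι → Ω → ℝ} (hX : ∀ i, Measurable (X i))
    (hlaw : ∀ i, P.map (X i) = stdGauss) (hind : iIndepFun X P) (a b : ι → ℝ) :
    IsGaussPair P (fun ω => ∑ i, a i * X i ω) (fun ω => ∑ i, b i * X i ω)
      (∑ i, a i ^ 2) (∑ i, a i * b i) (∑ i, b i ^ 2) where
  meas_left := Finset.measurable_sum _ fun i _ => (hX i).const_mul _
  meas_right := Finset.measurable_sum _ fun i _ => (hX i).const_mul _
  char_eq := fun x y => by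
    have := integral_exp_sum_of_iIndepFun hX hlaw hind fun i => x * a i + y * b i
    convert this using 4
    · rw [Finset.mul_sum, Finset.mul_sum, ← Finset.sum_add_distrib]
      congr 2
      exact Finset.sum_congr rfl fun i _ => by ring
    · congr 2
      rw [Finset.mul_sum, Finset.mul_sum, Finset.mul_sum, ← Finset.sum_add_distrib,
        ← Finset.sum_add_distrib]
      exact Finset.sum_congr rfl fun i _ => by ring

end IsGaussPair

/-! ### The function `ψ` and its contraction towards `q`. -/

theorem isGaussPair_psi {q t : ℝ} (ht : 0 ≤ t) (htq : t ≤ q) :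
    IsGaussPair (stdGauss.prod (stdGauss.prod stdGauss))
      (fun z => √t * z.1 + √(q - t) * z.2.1) (fun z => √t * z.1 + √(q - t) * z.2.2) q t q where
  meas_left := by fun_prop
  meas_right := by fun_prop
  char_eq := fun a b => by
    have e : ∀ z : ℝ × ℝ × ℝ, Complex.exp ((a * (√t * z.1 + √(q - t) * z.2.1) +
        b * (√t * z.1 + √(q - t) * z.2.2) : ℝ) * Complex.I) =
        Complex.exp (((a + b) * √t * z.1 : ℝ) * Complex.I) *
          (Complex.exp ((a * √(q - t) * z.2.1 : ℝ) * Complex.I) *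
            Complex.exp ((b * √(q - t) * z.2.2 : ℝ) * Complex.I)) := fun z => by
      rw [← Complex.exp_add, ← Complex.exp_add]
      congr 1
      push_cast
      ring
    simp only [e]
    rw [integral_prod_mul (f := fun x : ℝ => Complex.exp (((a + b) * √t * x : ℝ) * Complex.I))
      (g := fun z : ℝ × ℝ => Complex.exp ((a * √(q - t) * z.1 : ℝ) * Complex.I) *
            Complex.exp ((b * √(q - t) * z.2 : ℝ) * Complex.I)),
      integral_prod_mul (f := fun x : ℝ => Complex.exp ((a * √(q - t) * x : ℝ) * Complex.I))
      (g := fun x : ℝ => Complex.exp ((b * √(q - t) * x : ℝ) * Complex.I)),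
      integral_exp_stdGauss, integral_exp_stdGauss, integral_exp_stdGauss,
      ← Complex.exp_add, ← Complex.exp_add, ← Complex.ofReal_add, ← Complex.ofReal_add]
    congr 2
    rw [mul_pow, mul_pow, mul_pow, Real.sq_sqrt ht, Real.sq_sqrt (sub_nonneg.2 htq)]
    ring

theorem measurable_Th (β h : ℝ) : Measurable (Th β h) := by
  have := continuous_tanh
  exact (by unfold Th; fun_prop : Continuous (Th β h)).measurable

theorem abs_Th_le_one (β h x : ℝ) : |Th β h x| ≤ 1 := abs_tanh_le_one _

theorem psi_eq {β h t : ℝ} (ht : 0 ≤ t) (htq : t ≤ overlap β h) {Ω : Type*} [MeasurableSpace Ω]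
    {P : Measure Ω} [IsProbabilityMeasure P] {A B : Ω → ℝ}
    (hP : IsGaussPair P A B (overlap β h) t (overlap β h)) :
    psi β h t = ∫ ω, Th β h (A ω) * Th β h (B ω) ∂P := by
  have hm := measurable_Th β h
  rw [hP.integral_eq (isGaussPair_psi ht htq) (f := fun p => Th β h p.1 * Th β h p.2) (by fun_prop)]
  rw [psi, integral_prod, integral_congr_ae (Eventually.of_forall fun z => ?_)]
  · simp only
    rw [integral_prod]
    refine integrable_of_bounded (C := 1) (by fun_prop : Measurable _).aestronglyMeasurable fun x => ?_
    rw [abs_mul]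
    exact mul_le_one₀ (abs_Th_le_one _ _ _) (abs_nonneg _) (abs_Th_le_one _ _ _)
  · refine integrable_of_bounded (C := 1) (by fun_prop : Measurable _).aestronglyMeasurable fun x => ?_
    rw [abs_mul]
    exact mul_le_one₀ (abs_Th_le_one _ _ _) (abs_nonneg _) (abs_Th_le_one _ _ _)

theorem overlap_eq_integral (β h : ℝ) {Ω : Type*} [MeasurableSpace Ω]
    {P : Measure Ω} [IsProbabilityMeasure P] {A B : Ω → ℝ} {t v : ℝ}
    (hP : IsGaussPair P A B (overlap β h) t v) :
    ∫ ω, Th β h (A ω) ^ 2 ∂P = overlap β h := by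
  have hm := measurable_Th β h
  rw [hP.integral_left (overlap_spec β h).1 (f := fun x => Th β h x ^ 2) (by fun_prop)]
  conv_rhs => rw [(overlap_spec β h).2]
  simp only [overlapMap, Th, mul_assoc]

/-- Expand the square: by the fixed point equation both `E Th(A)²` and `E Th(B)²` equal `q`, and the
mixed term is `ψ(t)`. -/
theorem overlap_sub_psi {β h t : ℝ} (ht : 0 ≤ t) (htq : t ≤ overlap β h) {Ω : Type*}
    [MeasurableSpace Ω] {P : Measure Ω} [IsProbabilityMeasure P] {A B : Ω → ℝ}
    (hP : IsGaussPair P A B (overlap β h) t (overlap β h)) :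
    overlap β h - psi β h t = (∫ ω, (Th β h (A ω) - Th β h (B ω)) ^ 2 ∂P) / 2 := by
  have hm := measurable_Th β h
  have hA := hP.meas_left
  have hB := hP.meas_right
  have i1 : Integrable (fun ω => Th β h (A ω) ^ 2) P := by
    refine integrable_of_bounded (C := 1) (by fun_prop : Measurable _).aestronglyMeasurable fun x => ?_
    rw [abs_of_nonneg (sq_nonneg _)]
    exact tanh_sq_le_one _
  have i2 : Integrable (fun ω => Th β h (B ω) ^ 2) P := by
    refine integrable_of_bounded (C := 1) (by fun_prop : Measurable _).aestronglyMeasurable fun x => ?_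
    rw [abs_of_nonneg (sq_nonneg _)]
    exact tanh_sq_le_one _
  have i3 : Integrable (fun ω => Th β h (A ω) * Th β h (B ω)) P := by
    refine integrable_of_bounded (C := 1) (by fun_prop : Measurable _).aestronglyMeasurable fun x => ?_
    rw [abs_mul]
    exact mul_le_one₀ (abs_Th_le_one _ _ _) (abs_nonneg _) (abs_Th_le_one _ _ _)
  have e : ∀ ω, (Th β h (A ω) - Th β h (B ω)) ^ 2 = Th β h (A ω) ^ 2 + Th β h (B ω) ^ 2 -
    2 * (Th β h (A ω) * Th β h (B ω)) := fun ω => by ring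
  simp only [e]
  have e1 := integral_sub (i1.add i2) (i3.const_mul 2)
  simp only [Pi.add_apply] at e1
  rw [e1, integral_add i1 i2, integral_const_mul,
    ← psi_eq ht htq hP, overlap_eq_integral β h hP, overlap_eq_integral β h hP.symm]
  ring

theorem abs_Th_sub_le (β h x y : ℝ) : |Th β h x - Th β h y| ≤ |β| * |x - y| := by
  refine (abs_tanh_sub_le _ _).trans ?_
  rw [← abs_mul]
  apply le_of_eq
  congr 1
  ring

/-- `Th` is `|β|`-Lipschitz and `E (A - B)² = 2 (q - t)`. This contraction drives the convergence of
all deterministic sequences. -/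
theorem overlap_sub_psi_le {β h t : ℝ} (ht : 0 ≤ t) (htq : t ≤ overlap β h) :
    overlap β h - psi β h t ≤ β ^ 2 * (overlap β h - t) := by
  have hP := isGaussPair_psi ht htq
  rw [overlap_sub_psi ht htq hP]
  have h2 := (hP.comb 1 (-1) 1 (-1)).integral_sq_left (by nlinarith)
  have hm := measurable_Th β h
  have h3 := integral_mono_of_nonneg (μ := stdGauss.prod (stdGauss.prod stdGauss))
    (Eventually.of_forall fun ω => sq_nonneg (Th β h (√t * ω.1 + √(overlap β h - t) * ω.2.1) -
      Th β h (√t * ω.1 + √(overlap β h - t) * ω.2.2)))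
    ((((hP.comb 1 (-1) 1 (-1)).memLp_left (by nlinarith) 2).integrable_sq).const_mul (β ^ 2))
    (Eventually.of_forall fun ω => by
      have := abs_Th_sub_le β h (√t * ω.1 + √(overlap β h - t) * ω.2.1)
        (√t * ω.1 + √(overlap β h - t) * ω.2.2)
      have h4 := pow_le_pow_left₀ (abs_nonneg _) this 2
      rw [sq_abs, mul_pow, sq_abs, sq_abs] at h4
      convert h4 using 2
      ring)
  rw [integral_const_mul, h2] at h3
  linarith

/-- Otherwise `Th(A) = Th(B)` almost surely, hence `A = B` by injectivity of `tanh`, against `E (A -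
B)² = 2 (q - t) > 0`. Strictness is what keeps the denominators `√(q - Γ²)` positive. -/
theorem psi_lt_overlap {β h t : ℝ} (hβ : 0 < β) (ht : 0 ≤ t) (htq : t < overlap β h) :
    psi β h t < overlap β h := by
  have hP := isGaussPair_psi ht htq.le
  have h1 := overlap_sub_psi ht htq.le hP
  have hm := measurable_Th β h
  by_contra hcon
  have h0 : ∫ ω, (Th β h (√t * ω.1 + √(overlap β h - t) * ω.2.1) -
      Th β h (√t * ω.1 + √(overlap β h - t) * ω.2.2)) ^ 2
        ∂(stdGauss.prod (stdGauss.prod stdGauss)) = 0 :=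
    le_antisymm (by linarith) (integral_nonneg fun ω => sq_nonneg _)
  rw [integral_eq_zero_iff_of_nonneg (fun ω => sq_nonneg _)] at h0
  · have h2 := (hP.comb 1 (-1) 1 (-1)).integral_sq_left (by nlinarith)
    rw [integral_congr_ae (g := fun _ => 0)] at h2
    · simp at h2
      linarith
    · filter_upwards [h0] with ω hω
      have h3 : Real.tanh _ = Real.tanh _ := sub_eq_zero.1 (pow_eq_zero_iff two_ne_zero |>.1 hω)
      have h4 := Real.tanh_injective h3
      have h5 : β * (√t * ω.1 + √(overlap β h - t) * ω.2.1) =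
        β * (√t * ω.1 + √(overlap β h - t) * ω.2.2) := by linarith
      have h6 := mul_left_cancel₀ hβ.ne' h5
      rw [h6]
      ring
  · refine integrable_of_bounded (C := 4) (((hm.comp hP.meas_left).sub
      (hm.comp hP.meas_right)).pow_const 2).aestronglyMeasurable fun x => ?_
    rw [abs_of_nonneg (sq_nonneg _)]
    have h1 := abs_le.1 (abs_Th_le_one β h (√t * x.1 + √(overlap β h - t) * x.2.1))
    have h2 := abs_le.1 (abs_Th_le_one β h (√t * x.1 + √(overlap β h - t) * x.2.2))
    nlinarith

/-! ### The deterministic sequences -/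

theorem gamma_one (β h : ℝ) : gamma β h 1 = gammaOne β h := by rw [gamma]

theorem rho_one (β h : ℝ) : rho β h 1 = √(overlap β h) * gammaOne β h := by rw [rho]

theorem rho_add_two (β h : ℝ) (k : ℕ) : rho β h (k + 2) = psi β h (rho β h (k + 1)) := by rw [rho]

theorem GammaSq_zero (β h : ℝ) : GammaSq β h 0 = 0 := by simp [GammaSq]

theorem GammaSq_succ (β h : ℝ) (k : ℕ) :
    GammaSq β h (k + 1) = GammaSq β h k + gamma β h (k + 1) ^ 2 := by
  rw [GammaSq, GammaSq, Finset.sum_Icc_succ_top (by omega)]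

theorem overlap_pos {β h : ℝ} (hh : 0 < h) : 0 < overlap β h := by
  obtain ⟨h0, h1⟩ := overlap_spec β h
  rcases h0.eq_or_lt with h2 | h2
  · rw [← h2] at h1
    simp only [overlapMap, Real.sqrt_zero, mul_zero, zero_mul, add_zero] at h1
    simp only [integral_const, probReal_univ, smul_eq_mul, one_mul] at h1
    have h3 := pow_eq_zero_iff two_ne_zero |>.1 h1.symm
    have := Real.tanh_injective (h3.trans Real.tanh_zero.symm)
    linarith
  · exact h2

/-- The general form of `gamma_add_two`, which includes the case `k = 1`. -/
theorem gamma_succ {β h : ℝ} (hh : 0 < h) (k : ℕ) : gamma β h (k + 1) =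
    (rho β h (k + 1) - GammaSq β h k) / √(overlap β h - GammaSq β h k) := by
  match k with
  | 0 =>
    have := Real.sqrt_pos.2 (overlap_pos (β := β) hh)
    rw [gamma_one, rho_one, GammaSq_zero, sub_zero, sub_zero]
    field_simp
  | k + 1 => exact gamma_add_two β h k

/-- Symmetrize in `x`: since `tanh` is odd and increasing and `h > 0`, the sum `tanh (h + b x) +
tanh (h - b x)` is nonnegative. -/
theorem integral_tanh_nonneg {h : ℝ} (hh : 0 < h) (b : ℝ) :
    0 ≤ ∫ x, Real.tanh (h + b * x) ∂stdGauss := by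
  have hct := continuous_tanh
  have hi : ∀ b : ℝ, Integrable (fun x => Real.tanh (h + b * x)) stdGauss := fun b =>
    integrable_of_bounded (C := 1) (by fun_prop : Continuous _).aestronglyMeasurable
      fun x => abs_tanh_le_one _
  have e : ∫ x, Real.tanh (h + b * x) ∂stdGauss = ∫ x, Real.tanh (h + -b * x) ∂stdGauss := by
    have h1 : Measure.map (fun x : ℝ => -x) stdGauss = stdGauss := by
      have := gaussianReal_map_neg (μ := 0) (v := 1)
      simpa using this
    conv_lhs => rw [← h1]
    rw [integral_map (by fun_prop) (by fun_prop : Continuous _).aestronglyMeasurable]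
    congr 1; funext x; congr 1; ring
  have h2 : 0 ≤ ∫ x, (Real.tanh (h + b * x) + Real.tanh (h + -b * x)) ∂stdGauss := by
    refine integral_nonneg fun x => ?_
    have hmono : Monotone Real.tanh := monotone_of_deriv_nonneg
      (fun x => (hasDerivAt_tanh x).differentiableAt) fun x => by
        rw [(hasDerivAt_tanh x).deriv]
        linarith [tanh_sq_le_one x]
    have := hmono (show b * x - h ≤ h + b * x by linarith)
    rw [show h + -b * x = -(b * x - h) by ring, Real.tanh_neg]
    simp only [Pi.zero_apply]
    linarith
  rw [integral_add (hi b) (hi (-b)), ← e] at h2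
  linarith

theorem gammaOne_nonneg {β h : ℝ} (hh : 0 < h) : 0 ≤ gammaOne β h :=
  integral_tanh_nonneg hh _

/-- At `t = 0` the two factors are independent. Combined with `psi_lt_overlap`, this yields `γ₁² <
q`, the start of the induction in `rho_bounds`. -/
theorem psi_zero (β h : ℝ) : psi β h 0 = gammaOne β h ^ 2 := by
  simp only [psi, Real.sqrt_zero, zero_mul, zero_add, sub_zero]
  simp only [integral_const_mul, integral_mul_const]
  simp only [integral_const, probReal_univ, one_smul]
  rw [sq]
  simp only [gammaOne, Th, mul_assoc]

/-! ### Convergence of `ρ_k` and `Γ_k²` to `q`. -/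

section sequences

variable {β h : ℝ} (hβ : 0 < β) (hβ1 : β < 1) (hh : 0 < h)

include hβ hβ1 hh

/-- The four claims support each other in one induction: the contraction gives `t ≤ ψ(t)` for `t <
q`, strictness gives `ψ(t) < q`, and these bounds control the increment `γ²` of `Γ²`. -/
theorem rho_bounds (k : ℕ) : GammaSq β h k ≤ rho β h (k + 1) ∧ rho β h (k + 1) < overlap β h ∧
    rho β h (k + 1) ≤ rho β h (k + 2) ∧ 0 ≤ rho β h (k + 1) := by
  have hq := overlap_pos (β := β) hh
  have hstep : ∀ t, 0 ≤ t → t < overlap β h → t ≤ psi β h t ∧ psi β h t < overlap β h := by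
    intro t ht htq
    refine ⟨?_, psi_lt_overlap hβ ht htq⟩
    have := overlap_sub_psi_le ht htq.le
    have h2 : β ^ 2 ≤ 1 := by nlinarith
    nlinarith [mul_nonneg (sub_nonneg.2 h2) (sub_nonneg.2 htq.le)]
  induction k with
  | zero =>
    have h1 := gammaOne_nonneg (β := β) hh
    have h2 : gammaOne β h ^ 2 < overlap β h := by
      rw [← psi_zero]
      exact (hstep 0 le_rfl hq).2
    have h3 : gammaOne β h < √(overlap β h) := Real.lt_sqrt_of_sq_lt h2
    have h4 : rho β h 1 < overlap β h := by
      rw [rho_one]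
      nlinarith [Real.sq_sqrt hq.le, Real.sqrt_pos.2 hq]
    have h5 : 0 ≤ rho β h 1 := by
      rw [rho_one]
      positivity
    refine ⟨by rw [GammaSq_zero]; exact h5, h4, ?_, h5⟩
    rw [rho_add_two]
    exact (hstep _ h5 h4).1
  | succ k ih =>
    obtain ⟨h1, h2, h3, h4⟩ := ih
    have h5 : rho β h (k + 2) < overlap β h := by
      rw [rho_add_two]
      exact (hstep _ h4 h2).2
    have h6 : 0 ≤ rho β h (k + 2) := h4.trans h3
    refine ⟨?_, h5, ?_, h6⟩
    · refine le_trans ?_ h3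
      -- What remains is `(ρ - Γ²)² / (q - Γ²) ≤ ρ - Γ²`, which holds because `Γ² ≤ ρ < q`.
      rw [GammaSq_succ, gamma_succ hh, div_pow, Real.sq_sqrt (by linarith), ← le_sub_iff_add_le',
        div_le_iff₀ (by linarith)]
      nlinarith
    · rw [rho_add_two β h (k + 1)]
      exact (hstep _ h6 h5).1

theorem GammaSq_lt_overlap (k : ℕ) : GammaSq β h k < overlap β h :=
  (rho_bounds hβ hβ1 hh k).1.trans_lt (rho_bounds hβ hβ1 hh k).2.1

theorem gamma_mul_sqrt (k : ℕ) : gamma β h (k + 1) * √(overlap β h - GammaSq β h k) =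
    rho β h (k + 1) - GammaSq β h k := by
  have := Real.sqrt_pos.2 (sub_pos.2 (GammaSq_lt_overlap hβ hβ1 hh k))
  rw [gamma_succ hh]
  field_simp

theorem gamma_nonneg (k : ℕ) : 0 ≤ gamma β h (k + 1) := by
  rw [gamma_succ hh]
  exact div_nonneg (by linarith [(rho_bounds hβ hβ1 hh k).1]) (Real.sqrt_nonneg _)

theorem overlap_sub_rho_le (k : ℕ) :
    overlap β h - rho β h (k + 1) ≤ (β ^ 2) ^ k * overlap β h := by
  induction k with
  | zero => linarith [(rho_bounds hβ hβ1 hh 0).2.2.2]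
  | succ k ih =>
    rw [rho_add_two]
    have h1 := rho_bounds hβ hβ1 hh k
    have := overlap_sub_psi_le h1.2.2.2 h1.2.1.le
    rw [pow_succ]
    nlinarith [sq_nonneg β]

/-- With `a = q - Γ_k²` and `r = ρ_{k+1} - Γ_k²`, the left side is `a - r² / a`, and `2 (a - r) - (a
- r² / a) = (a - r)² / a ≥ 0`. As `a - r = q - ρ_{k+1}`, the geometric decay passes from `ρ` to
`Γ²`. -/
theorem overlap_sub_GammaSq_le (k : ℕ) :
    overlap β h - GammaSq β h (k + 1) ≤ 2 * ((β ^ 2) ^ k * overlap β h) := by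
  have h1 := rho_bounds hβ hβ1 hh k
  have h2 := GammaSq_lt_overlap hβ hβ1 hh k
  have h3 := overlap_sub_rho_le hβ hβ1 hh k
  refine le_trans ?_ (mul_le_mul_of_nonneg_left h3 zero_le_two)
  rw [GammaSq_succ, gamma_succ hh, div_pow, Real.sq_sqrt (by linarith)]
  have h4 : 0 < overlap β h - GammaSq β h k := by linarith
  rw [← sub_nonneg]
  have e : 2 * (overlap β h - rho β h (k + 1)) - (overlap β h - (GammaSq β h k +
      (rho β h (k + 1) - GammaSq β h k) ^ 2 / (overlap β h - GammaSq β h k))) =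
      (overlap β h - rho β h (k + 1)) ^ 2 / (overlap β h - GammaSq β h k) := by
    field_simp
    ring
  rw [e]
  positivity

theorem tendsto_GammaSq : Tendsto (GammaSq β h) atTop (𝓝 (overlap β h)) := by
  rw [← tendsto_add_atTop_iff_nat 1]
  have h1 : Tendsto (fun k => 2 * ((β ^ 2) ^ k * overlap β h)) atTop (𝓝 0) := by
    have := tendsto_pow_atTop_nhds_zero_of_lt_one (sq_nonneg β) (by nlinarith : β ^ 2 < 1)
    simpa using (this.mul_const (overlap β h)).const_mul 2
  have h2 : Tendsto (fun k => overlap β h - GammaSq β h (k + 1)) atTop (𝓝 0) :=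
    squeeze_zero (fun k => by linarith [GammaSq_lt_overlap hβ hβ1 hh (k + 1)])
      (overlap_sub_GammaSq_le hβ hβ1 hh) h1
  simpa using h2.const_sub (overlap β h)

end sequences

/-! ### Algebra of the normalized inner product -/

section algebra

variable {N : ℕ}

theorem ip_eq_dotProduct (x y : Fin N → ℝ) : ip x y = (N : ℝ)⁻¹ * (x ⬝ᵥ y) := rfl

theorem ip_comm (x y : Fin N → ℝ) : ip x y = ip y x := by
  rw [ip_eq_dotProduct, ip_eq_dotProduct, dotProduct_comm]

theorem ip_add_left (x y z : Fin N → ℝ) : ip (x + y) z = ip x z + ip y z := by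
  simp only [ip_eq_dotProduct, add_dotProduct, mul_add]

theorem ip_sub_left (x y z : Fin N → ℝ) : ip (x - y) z = ip x z - ip y z := by
  simp only [ip_eq_dotProduct, sub_dotProduct, mul_sub]

theorem ip_smul_left (c : ℝ) (x y : Fin N → ℝ) : ip (c • x) y = c * ip x y := by
  simp only [ip_eq_dotProduct, smul_dotProduct, smul_eq_mul]
  ring

theorem ip_zero_left (x : Fin N → ℝ) : ip 0 x = 0 := by simp [ip]

theorem ip_sum_left {ι : Type*} (s : Finset ι) (f : ι → Fin N → ℝ) (y : Fin N → ℝ) :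
    ip (∑ i ∈ s, f i) y = ∑ i ∈ s, ip (f i) y := by
  simp only [ip_eq_dotProduct, sum_dotProduct, Finset.mul_sum]

theorem ip_add_right (x y z : Fin N → ℝ) : ip x (y + z) = ip x y + ip x z := by
  rw [ip_comm, ip_add_left, ip_comm y, ip_comm z]

theorem ip_sub_right (x y z : Fin N → ℝ) : ip x (y - z) = ip x y - ip x z := by
  rw [ip_comm, ip_sub_left, ip_comm y, ip_comm z]

theorem ip_smul_right (c : ℝ) (x y : Fin N → ℝ) : ip x (c • y) = c * ip x y := by
  rw [ip_comm, ip_smul_left, ip_comm y]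

theorem ip_zero_right (x : Fin N → ℝ) : ip x 0 = 0 := by simp [ip]

theorem ip_sum_right {ι : Type*} (s : Finset ι) (f : ι → Fin N → ℝ) (y : Fin N → ℝ) :
    ip y (∑ i ∈ s, f i) = ∑ i ∈ s, ip y (f i) := by
  rw [ip_comm, ip_sum_left]
  exact Finset.sum_congr rfl fun i _ => ip_comm _ _

theorem ip_self_nonneg (x : Fin N → ℝ) : 0 ≤ ip x x :=
  mul_nonneg (by positivity) (Finset.sum_nonneg fun i _ => mul_self_nonneg _)

theorem nrm_sq (x : Fin N → ℝ) : nrm x ^ 2 = ip x x := Real.sq_sqrt (ip_self_nonneg x)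

theorem nrm_nonneg (x : Fin N → ℝ) : 0 ≤ nrm x := Real.sqrt_nonneg _

theorem ip_sq_le (x y : Fin N → ℝ) : ip x y ^ 2 ≤ ip x x * ip y y := by
  have h := Finset.sum_mul_sq_le_sq_mul_sq Finset.univ x y
  have hN : 0 ≤ ((N : ℝ)⁻¹) ^ 2 := by positivity
  have := mul_le_mul_of_nonneg_left h hN
  simp only [ip, ← sq]
  calc _ = _ := by rw [mul_pow]
    _ ≤ _ := this
    _ = _ := by ring

theorem abs_ip_le (x y : Fin N → ℝ) : |ip x y| ≤ nrm x * nrm y := by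
  refine abs_le_of_sq_le_sq ?_ (mul_nonneg (nrm_nonneg _) (nrm_nonneg _))
  rw [mul_pow, nrm_sq, nrm_sq]
  exact ip_sq_le x y

theorem nrm_add_le (x y : Fin N → ℝ) : nrm (x + y) ≤ nrm x + nrm y := by
  refine abs_le_of_sq_le_sq' ?_ (add_nonneg (nrm_nonneg _) (nrm_nonneg _)) |>.2
  rw [nrm_sq, add_sq, nrm_sq, nrm_sq, ip_add_left, ip_add_right, ip_add_right, ip_comm y x]
  linarith [le_abs_self (ip x y), abs_ip_le x y]

theorem nrm_smul (c : ℝ) (x : Fin N → ℝ) : nrm (c • x) = |c| * nrm x := by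
  rw [nrm, nrm, ip_smul_left, ip_smul_right, ← mul_assoc, Real.sqrt_mul (mul_self_nonneg c),
    Real.sqrt_mul_self_eq_abs]

theorem nrm_zero : nrm (0 : Fin N → ℝ) = 0 := by simp [nrm, ip_zero_left]

theorem nrm_sum_le {ι : Type*} (s : Finset ι) (f : ι → Fin N → ℝ) :
    nrm (∑ i ∈ s, f i) ≤ ∑ i ∈ s, nrm (f i) := by
  classical
  induction s using Finset.induction_on with
  | empty => simp [nrm_zero]
  | insert i s hi ih =>
    rw [Finset.sum_insert hi, Finset.sum_insert hi]
    exact (nrm_add_le _ _).trans (by linarith)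

theorem tens_mulVec (a b v : Fin N → ℝ) : tens a b *ᵥ v = ip b v • a := by
  funext i
  simp only [tens, Matrix.mulVec, dotProduct, Matrix.of_apply, ip, Pi.smul_apply, smul_eq_mul]
  rw [Finset.mul_sum, Finset.sum_mul]
  exact Finset.sum_congr rfl fun j _ => by ring

theorem tens_transpose (a b : Fin N → ℝ) : (tens a b)ᵀ = tens b a := by
  ext i j
  simp only [tens, Matrix.transpose_apply, Matrix.of_apply]
  ring

theorem mul_tens (M : Matrix (Fin N) (Fin N) ℝ) (a b : Fin N → ℝ) :
    M * tens a b = tens (M *ᵥ a) b := by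
  ext i j
  simp only [tens, Matrix.mul_apply, Matrix.of_apply, Matrix.mulVec, dotProduct]
  rw [Finset.sum_mul, Finset.sum_div]
  exact Finset.sum_congr rfl fun j _ => by ring

theorem tens_mul (M : Matrix (Fin N) (Fin N) ℝ) (a b : Fin N → ℝ) :
    tens a b * M = tens a (Mᵀ *ᵥ b) := by
  rw [← Matrix.transpose_transpose (tens a b * M), Matrix.transpose_mul, tens_transpose, mul_tens,
    tens_transpose]

theorem tens_smul_left (c : ℝ) (a b : Fin N → ℝ) : tens (c • a) b = c • tens a b := by
  ext i j
  simp only [tens, Matrix.of_apply, Pi.smul_apply, smul_eq_mul, Matrix.smul_apply]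
  ring

theorem tens_zero_left (b : Fin N → ℝ) : tens 0 b = 0 := by
  ext i j
  simp [tens]

theorem ip_mulVec (M : Matrix (Fin N) (Fin N) ℝ) (a b : Fin N → ℝ) :
    ip (M *ᵥ a) b = ip a (Mᵀ *ᵥ b) := by
  simp only [ip_eq_dotProduct, Matrix.dotProduct_mulVec, Matrix.vecMul_transpose]

/-! ### The orthogonal projections -/

/-- `φ_1, …, φ_k` are orthogonal, and each of them has norm `1` or `0`. -/
def OrthoFamily (φ : ℕ → Fin N → ℝ) (k : ℕ) : Prop :=
  (∀ s ∈ Finset.Icc 1 k, ∀ t ∈ Finset.Icc 1 k, s ≠ t → ip (φ s) (φ t) = 0) ∧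
    ∀ s ∈ Finset.Icc 1 k, φ s = 0 ∨ ip (φ s) (φ s) = 1

/-- The projection along `φ_1, …, φ_k`. -/
noncomputable def coproj (φ : ℕ → Fin N → ℝ) (k : ℕ) : Matrix (Fin N) (Fin N) ℝ :=
  1 - ∑ s ∈ Finset.Icc 1 k, tens (φ s) (φ s)

theorem coproj_zero (φ : ℕ → Fin N → ℝ) : coproj φ 0 = 1 := by simp [coproj]

theorem coproj_succ (φ : ℕ → Fin N → ℝ) (k : ℕ) :
    coproj φ (k + 1) = coproj φ k - tens (φ (k + 1)) (φ (k + 1)) := by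
  rw [coproj, coproj, Finset.sum_Icc_succ_top (by omega), sub_sub]

theorem coproj_transpose (φ : ℕ → Fin N → ℝ) (k : ℕ) : (coproj φ k)ᵀ = coproj φ k := by
  simp [coproj, Matrix.transpose_sub, Matrix.transpose_sum, tens_transpose]

theorem coproj_mulVec (φ : ℕ → Fin N → ℝ) (k : ℕ) (v : Fin N → ℝ) :
    coproj φ k *ᵥ v = v - ∑ s ∈ Finset.Icc 1 k, ip (φ s) v • φ s := by
  rw [coproj, Matrix.sub_mulVec, Matrix.one_mulVec, Matrix.sum_mulVec]
  simp only [tens_mulVec]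

theorem coproj_congr {φ φ' : ℕ → Fin N → ℝ} {k : ℕ} (hk : ∀ s, 1 ≤ s → s ≤ k → φ s = φ' s) :
    coproj φ k = coproj φ' k := by
  rw [coproj, coproj, Finset.sum_congr rfl fun s hs => ?_]
  have := Finset.mem_Icc.1 hs
  rw [hk s this.1 this.2]

namespace OrthoFamily

variable {φ : ℕ → Fin N → ℝ} {k : ℕ}

theorem sum_ip_smul (hφ : OrthoFamily φ k) {t : ℕ} (ht : t ∈ Finset.Icc 1 k) :
    ∑ s ∈ Finset.Icc 1 k, ip (φ s) (φ t) • φ s = φ t := by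
  rw [Finset.sum_eq_single_of_mem t ht fun s hs hst => by rw [hφ.1 s hs t ht hst, zero_smul]]
  rcases hφ.2 t ht with h | h
  · simp [h]
  · rw [h, one_smul]

theorem coproj_mulVec_self (hφ : OrthoFamily φ k) {t : ℕ} (ht : t ∈ Finset.Icc 1 k) :
    coproj φ k *ᵥ φ t = 0 := by
  rw [coproj_mulVec, hφ.sum_ip_smul ht, sub_self]

theorem coproj_mulVec_of_lt (hφ : OrthoFamily φ k) {t l : ℕ} (ht : t ∈ Finset.Icc 1 k)
    (hl : l < t) : coproj φ l *ᵥ φ t = φ t := by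
  rw [coproj_mulVec, Finset.sum_eq_zero, sub_zero]
  intro s hs
  have h1 := Finset.mem_Icc.1 hs
  have h2 := Finset.mem_Icc.1 ht
  rw [hφ.1 s (Finset.mem_Icc.2 ⟨h1.1, by omega⟩) t ht (by omega), zero_smul]

theorem coproj_mul_coproj (hφ : OrthoFamily φ k) {l : ℕ} (hl : l ≤ k) :
    coproj φ k * coproj φ l = coproj φ k := by
  conv_lhs => rw [coproj.eq_1 φ l]
  rw [mul_sub, mul_one, Finset.mul_sum, Finset.sum_eq_zero, sub_zero]
  intro s hs
  rw [mul_tens, hφ.coproj_mulVec_self (Finset.Icc_subset_Icc_right hl hs), tens_zero_left]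

theorem coproj_mul_coproj' (hφ : OrthoFamily φ k) {l : ℕ} (hl : l ≤ k) :
    coproj φ l * coproj φ k = coproj φ k := by
  have := congrArg Matrix.transpose (hφ.coproj_mul_coproj hl)
  rwa [Matrix.transpose_mul, coproj_transpose, coproj_transpose] at this

end OrthoFamily

/-! ### The iteration -/

/-- The vectors `φ^{(s)}`. -/
noncomputable def phi (β h : ℝ) (g : Matrix (Fin N) (Fin N) ℝ) (s : ℕ) : Fin N → ℝ := (iter β h g s).2

theorem phi_one (β h : ℝ) (g : Matrix (Fin N) (Fin N) ℝ) : phi β h g 1 = 1 := by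
  rw [phi, iter]

theorem phi_succ (β h : ℝ) (g : Matrix (Fin N) (Fin N) ℝ) {k : ℕ} (hk : 1 ≤ k) :
    phi β h g (k + 1) = (nrm (nextResidual β h (iter β h g) k))⁻¹ •
      nextResidual β h (iter β h g) k := by
  rw [phi, iter_succ β h g hk, next]

theorem ip_normalize (x : Fin N → ℝ) : (nrm x)⁻¹ • x = 0 ∨ ip ((nrm x)⁻¹ • x) ((nrm x)⁻¹ • x) = 1 := by
  rcases eq_or_ne (nrm x) 0 with h | h
  · left; simp [h]
  · right
    rw [ip_smul_left, ip_smul_right, ← nrm_sq]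
    field_simp

/-- This is Gram–Schmidt without exceptional events: a residual of norm zero is multiplied by `0⁻¹ =
0`, which is the zero alternative in `OrthoFamily`. For `N = 0` already the first vector is zero. -/
theorem orthoFamily_phi (β h : ℝ) (g : Matrix (Fin N) (Fin N) ℝ) (k : ℕ) :
    OrthoFamily (phi β h g) k := by
  induction k with
  | zero => exact ⟨fun s hs => by simp at hs, fun s hs => by simp at hs⟩
  | succ k ih =>
    rcases Nat.eq_zero_or_pos k with rfl | hk
    · refine ⟨fun s hs t ht hst => ?_, fun s hs => ?_⟩
      · simp at hs ht; omega
      · simp only [zero_add, Finset.Icc_self, Finset.mem_singleton] at hs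
        rw [hs, phi_one]
        rcases Nat.eq_zero_or_pos N with rfl | hN
        · left; exact Subsingleton.elim _ _
        · right
          have : (N : ℝ) ≠ 0 := by positivity
          simp [ip, this]
    · have key : ∀ t ∈ Finset.Icc 1 k, ip (phi β h g (k + 1)) (phi β h g t) = 0 := by
        intro t ht
        rw [phi_succ β h g hk, ip_smul_left, nextResidual, ip_sub_left, ip_sum_left]
        simp only [ip_smul_left]
        change _ * (ip _ (phi β h g t) - ∑ s ∈ Finset.Icc 1 k, ip _ (phi β h g s) *
          ip (phi β h g s) (phi β h g t)) = 0
        have := congrArg (ip (nextMag β h (iter β h g) k)) (ih.sum_ip_smul ht)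
        rw [ip_sum_right] at this
        simp only [ip_smul_right] at this
        rw [← this, ← Finset.sum_sub_distrib]
        refine mul_eq_zero_of_right _ (Finset.sum_eq_zero fun s _ => ?_)
        ring
      have hI : ∀ s ∈ Finset.Icc 1 (k + 1), s ∈ Finset.Icc 1 k ∨ s = k + 1 := by
        intro s hs
        simp only [Finset.mem_Icc] at hs ⊢
        omega
      refine ⟨fun s hs t ht hst => ?_, fun s hs => ?_⟩
      · rcases hI s hs with h1 | h1 <;> rcases hI t ht with h2 | h2
        · exact ih.1 s h1 t h2 hst
        · rw [h2, ip_comm]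
          exact key s h1
        · rw [h1]
          exact key t h2
        · omega
      · rcases hI s hs with h1 | h1
        · exact ih.2 s h1
        · rw [h1, phi_succ β h g hk]
          exact ip_normalize _

/-- `Q_k = 1 - ∑_{s ≤ k} φ^{(s)} ⊗ φ^{(s)}`. -/
noncomputable def Qmat (β h : ℝ) (g : Matrix (Fin N) (Fin N) ℝ) (k : ℕ) : Matrix (Fin N) (Fin N) ℝ :=
  coproj (phi β h g) k

/-- Expanding the two-sided product reproduces the terms of `rhoMat`. No normalization of `φ`
enters, so the vanishing directions need no separate treatment. -/
theorem sub_rhoMat (a : Pair N) :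
    a.1 - rhoMat a = (1 - tens a.2 a.2) * a.1 * (1 - tens a.2 a.2) := by
  rw [mul_sub, mul_one, mul_assoc, mul_tens, sub_mul, one_mul, sub_mul, one_mul, tens_mul, mul_tens,
    tens_mulVec, tens_smul_left, rhoMat, xi, eta]
  abel

/-- Each step compresses by `1 - φ ⊗ φ` on both sides, and by orthogonality these factors multiply
up to `Q_k`. -/
theorem iter_fst_eq (β h : ℝ) (g : Matrix (Fin N) (Fin N) ℝ) (k : ℕ) :
    (iter β h g (k + 1)).1 = Qmat β h g k * g * Qmat β h g k := by
  induction k with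
  | zero => simp [Qmat, coproj_zero, iter]
  | succ k ih =>
    have hφ := orthoFamily_phi β h g (k + 1)
    have hm : k + 1 ∈ Finset.Icc 1 (k + 1) := by simp
    have h1 : Qmat β h g (k + 1) = (1 - tens (phi β h g (k + 1)) (phi β h g (k + 1))) *
        Qmat β h g k := by
      rw [Qmat, Qmat, coproj_succ, sub_mul, one_mul, tens_mul, coproj_transpose,
        hφ.coproj_mulVec_of_lt hm (Nat.lt_succ_self k)]
    have h2 : Qmat β h g (k + 1) = Qmat β h g k *
        (1 - tens (phi β h g (k + 1)) (phi β h g (k + 1))) := by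
      rw [Qmat, Qmat, coproj_succ, mul_sub, mul_one, mul_tens,
        hφ.coproj_mulVec_of_lt hm (Nat.lt_succ_self k)]
    rw [iter_succ β h g (by omega), next]
    nth_rewrite 1 [h1]
    rw [h2]
    rw [show ∀ A B : Matrix (Fin N) (Fin N) ℝ, A * Qmat β h g k * g * (Qmat β h g k * B) =
      A * (Qmat β h g k * g * Qmat β h g k) * B by intros; noncomm_ring, ← ih]
    exact sub_rhoMat (iter β h g (k + 1))

end algebra

/-! ### Invariance of the iteration under resampling of the unrevealed part -/

section invariance

variable {N : ℕ}

theorem Qmat_transpose (β h : ℝ) (g : Matrix (Fin N) (Fin N) ℝ) (k : ℕ) :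
    (Qmat β h g k)ᵀ = Qmat β h g k := coproj_transpose _ _

theorem Qmat_mul_Qmat (β h : ℝ) (g : Matrix (Fin N) (Fin N) ℝ) {k l : ℕ} (hl : l ≤ k) :
    Qmat β h g k * Qmat β h g l = Qmat β h g k := (orthoFamily_phi β h g k).coproj_mul_coproj hl

theorem Qmat_mul_Qmat' (β h : ℝ) (g : Matrix (Fin N) (Fin N) ℝ) {k l : ℕ} (hl : l ≤ k) :
    Qmat β h g l * Qmat β h g k = Qmat β h g k := (orthoFamily_phi β h g k).coproj_mul_coproj' hl

theorem Qmat_mulVec_phi (β h : ℝ) (g : Matrix (Fin N) (Fin N) ℝ) {k s : ℕ} (hs : 1 ≤ s)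
    (hk : s ≤ k) : Qmat β h g k *ᵥ phi β h g s = 0 :=
  (orthoFamily_phi β h g k).coproj_mulVec_self (Finset.mem_Icc.2 ⟨hs, hk⟩)

theorem Qmat_mulVec_phi_succ (β h : ℝ) (g : Matrix (Fin N) (Fin N) ℝ) (k : ℕ) :
    Qmat β h g k *ᵥ phi β h g (k + 1) = phi β h g (k + 1) :=
  (orthoFamily_phi β h g (k + 1)).coproj_mulVec_of_lt (Finset.mem_Icc.2 ⟨by omega, le_rfl⟩)
    (Nat.lt_succ_self k)

theorem xi_iter_succ (β h : ℝ) (g : Matrix (Fin N) (Fin N) ℝ) (k : ℕ) :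
    xi (iter β h g (k + 1)) = Qmat β h g k *ᵥ (g *ᵥ phi β h g (k + 1)) := by
  rw [xi, iter_fst_eq, ← Matrix.mulVec_mulVec, ← Matrix.mulVec_mulVec]
  change Qmat β h g k *ᵥ (g *ᵥ (Qmat β h g k *ᵥ phi β h g (k + 1))) = _
  rw [Qmat_mulVec_phi_succ]

theorem eta_iter_succ (β h : ℝ) (g : Matrix (Fin N) (Fin N) ℝ) (k : ℕ) :
    eta (iter β h g (k + 1)) = Qmat β h g k *ᵥ (gᵀ *ᵥ phi β h g (k + 1)) := by
  rw [eta, iter_fst_eq, Matrix.transpose_mul, Matrix.transpose_mul, Qmat_transpose,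
    ← Matrix.mulVec_mulVec, ← Matrix.mulVec_mulVec]
  change Qmat β h g k *ᵥ (gᵀ *ᵥ (Qmat β h g k *ᵥ phi β h g (k + 1))) = _
  rw [Qmat_mulVec_phi_succ]

theorem nextResidual_congr (β h : ℝ) {a b : ℕ → Pair N} {k : ℕ} (hk : 1 ≤ k)
    (hz : ∀ s, 1 ≤ s → s ≤ k → zeta (a s) = zeta (b s))
    (hφ : ∀ s, 1 ≤ s → s ≤ k → (a s).2 = (b s).2) :
    nextResidual β h a k = nextResidual β h b k := by
  have e1 : nextMag β h a k = nextMag β h b k := by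
    funext i
    simp only [nextMag, nextField]
    rw [hz k hk le_rfl, Finset.sum_congr rfl fun s hs => ?_]
    have := Finset.mem_Icc.1 hs
    rw [hz s (by omega) (by omega)]
  simp only [nextResidual, e1]
  rw [Finset.sum_congr rfl fun s hs => ?_]
  have := Finset.mem_Icc.1 hs
  rw [hφ s (by omega) (by omega)]

/-- `Q_k` annihilates `φ^{(1)}, …, φ^{(k)}`, so a perturbation `Q_k d Q_k` is invisible in the
products of `g` and its transpose with these vectors. The directions are stable one index further
than `ξ` and `η`, because `φ^{(k+1)}` is computed from the products up to `k`. -/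
theorem iter_add_conj (β h : ℝ) (g d : Matrix (Fin N) (Fin N) ℝ) (k s : ℕ) (hs : 1 ≤ s) :
    (s ≤ k + 1 → phi β h (g + Qmat β h g k * d * Qmat β h g k) s = phi β h g s) ∧
    (s ≤ k → xi (iter β h (g + Qmat β h g k * d * Qmat β h g k) s) = xi (iter β h g s) ∧
      eta (iter β h (g + Qmat β h g k * d * Qmat β h g k) s) = eta (iter β h g s)) := by
  induction s using Nat.strong_induction_on with
  | _ s ih =>
  set g1 := g + Qmat β h g k * d * Qmat β h g k with hg1
  have hphi : s ≤ k + 1 → phi β h g1 s = phi β h g s := by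
    intro hsk
    rcases hs.eq_or_lt with rfl | hs1
    · rw [phi_one, phi_one]
    · obtain ⟨t, rfl⟩ : ∃ t, s = t + 1 := ⟨s - 1, by omega⟩
      rw [phi_succ _ _ _ (by omega), phi_succ _ _ _ (by omega)]
      rw [nextResidual_congr β h (a := iter β h g1) (b := iter β h g) (by omega)
        (fun r h1 h2 => ?_) fun r h1 h2 => (ih r (by omega) h1).1 (by omega)]
      have := (ih r (by omega) h1).2 (by omega)
      funext i
      rw [zeta, zeta, this.1, this.2]
  refine ⟨hphi, fun hsk => ?_⟩
  obtain ⟨t, rfl⟩ : ∃ t, s = t + 1 := ⟨s - 1, by omega⟩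
  have hQ : Qmat β h g1 t = Qmat β h g t :=
    coproj_congr fun r h1 h2 => (ih r (by omega) h1).1 (by omega)
  have hz : Qmat β h g k *ᵥ phi β h g (t + 1) = 0 := Qmat_mulVec_phi β h g hs hsk
  rw [xi_iter_succ, xi_iter_succ, eta_iter_succ, eta_iter_succ, hQ, hphi (by omega)]
  constructor
  · rw [hg1, Matrix.add_mulVec, ← Matrix.mulVec_mulVec, hz, Matrix.mulVec_zero, add_zero]
  · rw [hg1, Matrix.transpose_add, Matrix.add_mulVec, Matrix.transpose_mul, Matrix.transpose_mul,
      Qmat_transpose, ← Matrix.mulVec_mulVec, ← Matrix.mulVec_mulVec, hz, Matrix.mulVec_zero,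
      Matrix.mulVec_zero, add_zero]

/-- `g` with its unrevealed part replaced by that of `w`. -/
noncomputable def resample (β h : ℝ) (k : ℕ) (g w : Matrix (Fin N) (Fin N) ℝ) :
    Matrix (Fin N) (Fin N) ℝ :=
  g - Qmat β h g k * g * Qmat β h g k + Qmat β h g k * w * Qmat β h g k

theorem resample_eq (β h : ℝ) (k : ℕ) (g w : Matrix (Fin N) (Fin N) ℝ) :
    resample β h k g w = g + Qmat β h g k * (w - g) * Qmat β h g k := by
  rw [resample]
  noncomm_ring

theorem phi_resample (β h : ℝ) (g w : Matrix (Fin N) (Fin N) ℝ) {k s : ℕ} (hs : 1 ≤ s)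
    (hk : s ≤ k + 1) : phi β h (resample β h k g w) s = phi β h g s := by
  rw [resample_eq]
  exact (iter_add_conj β h g _ k s hs).1 hk

theorem xi_resample (β h : ℝ) (g w : Matrix (Fin N) (Fin N) ℝ) {k s : ℕ} (hs : 1 ≤ s)
    (hk : s ≤ k) : xi (iter β h (resample β h k g w) s) = xi (iter β h g s) := by
  rw [resample_eq]
  exact ((iter_add_conj β h g _ k s hs).2 hk).1

theorem eta_resample (β h : ℝ) (g w : Matrix (Fin N) (Fin N) ℝ) {k s : ℕ} (hs : 1 ≤ s)
    (hk : s ≤ k) : eta (iter β h (resample β h k g w) s) = eta (iter β h g s) := by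
  rw [resample_eq]
  exact ((iter_add_conj β h g _ k s hs).2 hk).2

theorem Qmat_resample (β h : ℝ) (g w : Matrix (Fin N) (Fin N) ℝ) {k l : ℕ} (hl : l ≤ k + 1) :
    Qmat β h (resample β h k g w) l = Qmat β h g l :=
  coproj_congr fun _ h1 h2 => phi_resample β h g w h1 (h2.trans hl)

/-- The recursion for `g^{(k)}` telescopes. The right side is a function of the revealed vectors and
the directions only. -/
theorem sub_conj_eq_sum (β h : ℝ) (g : Matrix (Fin N) (Fin N) ℝ) (k : ℕ) :
    g - Qmat β h g k * g * Qmat β h g k = ∑ m ∈ Finset.Icc 1 k, rhoMat (iter β h g m) := by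
  rw [← iter_fst_eq]
  induction k with
  | zero => simp [iter]
  | succ k ih =>
    rw [Finset.sum_Icc_succ_top (by omega), ← ih, iter_succ β h g (by omega), next]
    simp only
    abel

end invariance

/-! ### Gaussian measures on vectors and matrices -/

instance matrixMeasurableSpace {N : ℕ} : MeasurableSpace (Matrix (Fin N) (Fin N) ℝ) :=
  MeasurableSpace.pi

section gaussian

/-- The standard Gaussian distribution on `ℝ^ι`. -/
noncomputable abbrev stdPi (ι : Type*) [Fintype ι] : Measure (ι → ℝ) :=
  Measure.pi fun _ => stdGauss

theorem integral_exp_stdPi {ι : Type*} [Fintype ι] (a : ι → ℝ) :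
    ∫ x : ι → ℝ, Complex.exp ((∑ i, a i * x i : ℝ) * Complex.I) ∂(stdPi ι) =
      Complex.exp ((-(∑ i, a i ^ 2) / 2 : ℝ)) := by
  refine integral_exp_sum_of_iIndepFun (X := fun i (x : ι → ℝ) => x i) (fun i => measurable_pi_apply i)
    (fun i => ?_) ?_ a
  · exact (measurePreserving_eval (fun _ => stdGauss) i).map_eq
  · exact iIndepFun_pi (X := fun _ => id) fun i => aemeasurable_id

theorem eq_stdPi_of_char {ι : Type*} [Fintype ι] {ν : Measure (ι → ℝ)} [IsProbabilityMeasure ν]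
    (hν : ∀ a : ι → ℝ, ∫ x : ι → ℝ, Complex.exp ((∑ i, a i * x i : ℝ) * Complex.I) ∂ν =
      Complex.exp ((-(∑ i, a i ^ 2) / 2 : ℝ))) : ν = stdPi ι := by
  classical
  refine Measure.ext_of_charFunDual (funext fun L => ?_)
  obtain ⟨a, ha⟩ : ∃ a : ι → ℝ, ∀ x, L x = ∑ i, a i * x i := by
    refine ⟨fun i => L (Pi.single i 1), fun x => ?_⟩
    conv_lhs => rw [pi_eq_sum_univ' x, map_sum]
    refine Finset.sum_congr rfl fun i _ => ?_
    rw [map_smul, smul_eq_mul, mul_comm]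
  rw [charFunDual_apply, charFunDual_apply]
  simp only [ha]
  rw [hν, integral_exp_stdPi]

variable {N : ℕ}

/-- The matrix with entries `x (i, j) / √N`. -/
noncomputable def scaleMatrix (x : Fin N × Fin N → ℝ) : Matrix (Fin N) (Fin N) ℝ :=
  Matrix.of fun i j => x (i, j) / √N

/-- The law of a matrix with independent centered Gaussian entries of variance `1 / N`. -/
noncomputable def gaussMatrix (N : ℕ) : Measure (Matrix (Fin N) (Fin N) ℝ) :=
  (stdPi (Fin N × Fin N)).map scaleMatrix

theorem measurable_matrix_iff {Ω : Type*} [MeasurableSpace Ω]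
    {f : Ω → Matrix (Fin N) (Fin N) ℝ} : Measurable f ↔ ∀ i j, Measurable fun ω => f ω i j :=
  ⟨fun hf i j => (measurable_pi_apply j).comp ((measurable_pi_apply i).comp hf),
    fun hf => measurable_pi_lambda _ fun i => measurable_pi_lambda _ fun j => hf i j⟩

theorem measurable_entry (i j : Fin N) : Measurable fun g : Matrix (Fin N) (Fin N) ℝ => g i j :=
  measurable_matrix_iff.1 measurable_id i j

theorem measurable_scaleMatrix : Measurable (scaleMatrix (N := N)) :=
  measurable_matrix_iff.2 fun i j => (measurable_pi_apply (i, j)).div_const _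

instance : IsProbabilityMeasure (gaussMatrix N) :=
  Measure.isProbabilityMeasure_map measurable_scaleMatrix.aemeasurable

/-- The pairing `∑_{i,j} T_{ij} g_{ij}`. -/
noncomputable def mdot (T g : Matrix (Fin N) (Fin N) ℝ) : ℝ := ∑ i, ∑ j, T i j * g i j

theorem mdot_eq_trace (T g : Matrix (Fin N) (Fin N) ℝ) : mdot T g = (Tᵀ * g).trace := by
  simp only [mdot, Matrix.trace, Matrix.diag, Matrix.mul_apply, Matrix.transpose_apply]
  exact Finset.sum_comm

@[fun_prop]
theorem measurable_mdot (T : Matrix (Fin N) (Fin N) ℝ) : Measurable (mdot T) := by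
  exact Finset.measurable_sum _ fun i _ => Finset.measurable_sum _ fun j _ =>
    (measurable_entry i j).const_mul _

theorem integral_exp_gaussMatrix (T : Matrix (Fin N) (Fin N) ℝ) :
    ∫ g, Complex.exp ((mdot T g : ℝ) * Complex.I) ∂(gaussMatrix N) =
      Complex.exp ((-(mdot T T / N) / 2 : ℝ)) := by
  rw [gaussMatrix, integral_map measurable_scaleMatrix.aemeasurable
    (by fun_prop : Measurable _).aestronglyMeasurable]
  have := integral_exp_stdPi fun p : Fin N × Fin N => T p.1 p.2 / √N
  simp only [Fintype.sum_prod_type] at this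
  have e1 : ∀ x, mdot T (scaleMatrix x) = ∑ i, ∑ j, T i j / √N * x (i, j) := fun x =>
    Finset.sum_congr rfl fun i _ => Finset.sum_congr rfl fun j _ => by
      rw [scaleMatrix, Matrix.of_apply]; ring
  have e2 : mdot T T / N = ∑ i, ∑ j, (T i j / √N) ^ 2 := by
    simp only [mdot, Finset.sum_div]
    refine Finset.sum_congr rfl fun i _ => Finset.sum_congr rfl fun j _ => ?_
    rw [div_pow, Real.sq_sqrt (by positivity)]
    ring
  simp only [e1, e2, this]

theorem eq_gaussMatrix_of_char (hN : 0 < N) {ν : Measure (Matrix (Fin N) (Fin N) ℝ)}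
    [IsProbabilityMeasure ν]
    (hν : ∀ T : Matrix (Fin N) (Fin N) ℝ, ∫ g, Complex.exp ((mdot T g : ℝ) * Complex.I) ∂ν =
      Complex.exp ((-(mdot T T / N) / 2 : ℝ))) : ν = gaussMatrix N := by
  have hN' : (0 : ℝ) < √N := Real.sqrt_pos.2 (by positivity)
  -- `U` is a right inverse of `scaleMatrix` for `N > 0`; it reduces the claim to the standard
  -- Gaussian law on vectors.
  let U : Matrix (Fin N) (Fin N) ℝ → (Fin N × Fin N → ℝ) := fun g p => √N * g p.1 p.2
  have hU : Measurable U := measurable_pi_lambda _ fun p => by fun_prop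
  have hp := Measure.isProbabilityMeasure_map (μ := ν) hU.aemeasurable
  have key : ν.map U = stdPi (Fin N × Fin N) := by
    refine eq_stdPi_of_char fun a => ?_
    rw [integral_map hU.aemeasurable (by fun_prop : Measurable _).aestronglyMeasurable]
    have := hν (Matrix.of fun i j => √N * a (i, j))
    have e1 : ∀ g, ∑ p, a p * U g p = mdot (Matrix.of fun i j => √N * a (i, j)) g := fun g => by
      simp only [mdot, U, Matrix.of_apply, Fintype.sum_prod_type]
      refine Finset.sum_congr rfl fun i _ => Finset.sum_congr rfl fun j _ => ?_
      ring
    have e2 : mdot (Matrix.of fun i j => √N * a (i, j)) (Matrix.of fun i j => √N * a (i, j)) / N =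
        ∑ p, a p ^ 2 := by
      simp only [mdot, Matrix.of_apply, Fintype.sum_prod_type, Finset.sum_div]
      refine Finset.sum_congr rfl fun i _ => Finset.sum_congr rfl fun j _ => ?_
      have h1 : (√N : ℝ) * √N = N := Real.mul_self_sqrt (by positivity)
      have h2 : (N : ℝ) ≠ 0 := by positivity
      rw [div_eq_iff h2]
      linear_combination a (i, j) ^ 2 * h1
    simp only [e1, this, e2]
  rw [gaussMatrix, ← key, Measure.map_map measurable_scaleMatrix hU]
  have : (scaleMatrix ∘ U : Matrix (Fin N) (Fin N) ℝ → _) = id := by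
    funext g
    ext i j
    simp only [Function.comp, scaleMatrix, U, Matrix.of_apply, id]
    field_simp
  rw [this, Measure.map_id]

theorem mdot_conj {Q : Matrix (Fin N) (Fin N) ℝ} (hQt : Qᵀ = Q) (T g : Matrix (Fin N) (Fin N) ℝ) :
    mdot T (Q * g * Q) = mdot (Q * T * Q) g := by
  rw [mdot_eq_trace, mdot_eq_trace, Matrix.transpose_mul, Matrix.transpose_mul, hQt,
    ← mul_assoc, Matrix.trace_mul_comm]
  simp only [mul_assoc]

theorem mdot_add_right (T g g' : Matrix (Fin N) (Fin N) ℝ) :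
    mdot T (g + g') = mdot T g + mdot T g' := by
  simp only [mdot_eq_trace, mul_add, Matrix.trace_add]

theorem mdot_sub_left (T T' g : Matrix (Fin N) (Fin N) ℝ) :
    mdot (T - T') g = mdot T g - mdot T' g := by
  simp only [mdot_eq_trace, Matrix.transpose_sub, sub_mul, Matrix.trace_sub]

theorem mdot_sub_right (T g g' : Matrix (Fin N) (Fin N) ℝ) :
    mdot T (g - g') = mdot T g - mdot T g' := by
  simp only [mdot_eq_trace, mul_sub, Matrix.trace_sub]

theorem mdot_comm (T g : Matrix (Fin N) (Fin N) ℝ) : mdot T g = mdot g T := by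
  simp only [mdot, mul_comm]

theorem measurable_mul_mul {Ω : Type*} [MeasurableSpace Ω] {A B C : Ω → Matrix (Fin N) (Fin N) ℝ}
    (hA : Measurable A) (hB : Measurable B) (hC : Measurable C) :
    Measurable fun ω => A ω * B ω * C ω := by
  rw [measurable_matrix_iff] at *
  intro i j
  simp only [Matrix.mul_apply]
  fun_prop

theorem measurable_matrix_add {Ω : Type*} [MeasurableSpace Ω]
    {A B : Ω → Matrix (Fin N) (Fin N) ℝ} (hA : Measurable A) (hB : Measurable B) :
    Measurable fun ω => A ω + B ω := by
  rw [measurable_matrix_iff] at *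
  intro i j
  simp only [Matrix.add_apply]
  fun_prop

theorem measurable_matrix_sub {Ω : Type*} [MeasurableSpace Ω]
    {A B : Ω → Matrix (Fin N) (Fin N) ℝ} (hA : Measurable A) (hB : Measurable B) :
    Measurable fun ω => A ω - B ω := by
  rw [measurable_matrix_iff] at *
  intro i j
  simp only [Matrix.sub_apply]
  fun_prop

/-- For a fixed symmetric projection, `T - Q T Q` and `Q T Q` are orthogonal for `mdot`. The
characteristic function factorizes over the two independent matrices and the variances add up to
that of `T`. -/
theorem map_resample_const (hN : 0 < N) {Q : Matrix (Fin N) (Fin N) ℝ} (hQt : Qᵀ = Q)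
    (hQ : Q * Q = Q) :
    ((gaussMatrix N).prod (gaussMatrix N)).map (fun p => p.1 - Q * p.1 * Q + Q * p.2 * Q) =
      gaussMatrix N := by
  have hm : Measurable fun p : Matrix (Fin N) (Fin N) ℝ × Matrix (Fin N) (Fin N) ℝ =>
      p.1 - Q * p.1 * Q + Q * p.2 * Q :=
    measurable_matrix_add (measurable_matrix_sub measurable_fst
      (measurable_mul_mul measurable_const measurable_fst measurable_const))
      (measurable_mul_mul measurable_const measurable_snd measurable_const)
  have := Measure.isProbabilityMeasure_map (μ := (gaussMatrix N).prod (gaussMatrix N))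
    hm.aemeasurable
  refine eq_gaussMatrix_of_char hN fun T => ?_
  rw [integral_map hm.aemeasurable (by fun_prop : Measurable _).aestronglyMeasurable]
  have e : ∀ p : Matrix (Fin N) (Fin N) ℝ × Matrix (Fin N) (Fin N) ℝ,
      Complex.exp ((mdot T (p.1 - Q * p.1 * Q + Q * p.2 * Q) : ℝ) * Complex.I) =
      Complex.exp ((mdot (T - Q * T * Q) p.1 : ℝ) * Complex.I) *
        Complex.exp ((mdot (Q * T * Q) p.2 : ℝ) * Complex.I) := fun p => by
    rw [← Complex.exp_add, mdot_add_right, mdot_sub_right, mdot_conj hQt, mdot_conj hQt,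
      mdot_sub_left]
    congr 1
    push_cast
    ring
  simp only [e]
  rw [integral_prod_mul (f := fun g => Complex.exp ((mdot (T - Q * T * Q) g : ℝ) * Complex.I))
    (g := fun g => Complex.exp ((mdot (Q * T * Q) g : ℝ) * Complex.I)),
    integral_exp_gaussMatrix, integral_exp_gaussMatrix, ← Complex.exp_add, ← Complex.ofReal_add]
  congr 2
  have h1 : mdot (Q * T * Q) (Q * T * Q) = mdot T (Q * T * Q) := by
    rw [← mdot_conj hQt]
    congr 1
    rw [show Q * (Q * T * Q) * Q = (Q * Q) * T * (Q * Q) by noncomm_ring, hQ]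
  rw [mdot_sub_left, mdot_sub_right, mdot_sub_right, h1, mdot_comm (Q * T * Q) T]
  ring

end gaussian

/-! ### Resampling preserves the law of the Gaussian matrix -/

section resampling

variable {N : ℕ}

theorem measurable_phi (β h : ℝ) (s : ℕ) :
    Measurable fun g : Matrix (Fin N) (Fin N) ℝ => phi β h g s :=
  measurable_pi_lambda _ fun i => (measurable_iter β h (g := id) measurable_entry s).2 i

theorem measurable_xi_iter (β h : ℝ) (s : ℕ) :
    Measurable fun g : Matrix (Fin N) (Fin N) ℝ => xi (iter β h g s) :=
  measurable_pi_lambda _ fun i => measurable_xi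
    (measurable_iter β h (g := id) measurable_entry s).1
    (measurable_iter β h (g := id) measurable_entry s).2 i

theorem measurable_eta_iter (β h : ℝ) (s : ℕ) :
    Measurable fun g : Matrix (Fin N) (Fin N) ℝ => eta (iter β h g s) :=
  measurable_pi_lambda _ fun i => measurable_eta
    (measurable_iter β h (g := id) measurable_entry s).1
    (measurable_iter β h (g := id) measurable_entry s).2 i

theorem measurable_tens {Ω : Type*} [MeasurableSpace Ω] {a b : Ω → Fin N → ℝ} (ha : Measurable a)
    (hb : Measurable b) : Measurable fun ω => tens (a ω) (b ω) := by
  rw [measurable_matrix_iff]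
  intro i j
  simp only [tens, Matrix.of_apply]
  fun_prop

theorem measurable_matrix_sum {Ω ι : Type*} [MeasurableSpace Ω] (s : Finset ι)
    {A : ι → Ω → Matrix (Fin N) (Fin N) ℝ} (hA : ∀ i ∈ s, Measurable (A i)) :
    Measurable fun ω => ∑ i ∈ s, A i ω := by
  rw [measurable_matrix_iff]
  intro i j
  simp only [Matrix.sum_apply]
  exact Finset.measurable_sum _ fun k hk => measurable_matrix_iff.1 (hA k hk) i j

theorem measurable_Qmat (β h : ℝ) (k : ℕ) :
    Measurable fun g : Matrix (Fin N) (Fin N) ℝ => Qmat β h g k :=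
  measurable_matrix_sub measurable_const (measurable_matrix_sum _ fun s _ =>
    measurable_tens (measurable_phi β h s) (measurable_phi β h s))

theorem measurable_resample (β h : ℝ) (k : ℕ) :
    Measurable fun p : Matrix (Fin N) (Fin N) ℝ × Matrix (Fin N) (Fin N) ℝ =>
      resample β h k p.1 p.2 := by
  have hQ : Measurable fun p : Matrix (Fin N) (Fin N) ℝ × Matrix (Fin N) (Fin N) ℝ =>
      Qmat β h p.1 k := (measurable_Qmat β h k).comp measurable_fst
  exact measurable_matrix_add (measurable_matrix_sub measurable_fst
    (measurable_mul_mul hQ measurable_fst hQ)) (measurable_mul_mul hQ measurable_snd hQ)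

/-- Resampling at level `k` does not move `Q_{k+1}`, and `Q_{k+1} Q_k = Q_{k+1}`. Two successive
resamplings are therefore one at level `k`, whose new input differs from `b` only inside the range
of `Q_{k+1}`. -/
theorem resample_succ_resample (β h : ℝ) (k : ℕ) (a b w : Matrix (Fin N) (Fin N) ℝ) :
    resample β h (k + 1) (resample β h k a b) w = resample β h k a
      (b - Qmat β h a (k + 1) * b * Qmat β h a (k + 1) +
        Qmat β h a (k + 1) * w * Qmat β h a (k + 1)) := by
  have h1 := Qmat_mul_Qmat β h a (Nat.le_succ k)
  have h2 := Qmat_mul_Qmat' β h a (Nat.le_succ k)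
  rw [resample, Qmat_resample β h a b le_rfl, resample, resample]
  simp only [Nat.succ_eq_add_one] at h1 h2
  set Q := Qmat β h a k
  set R := Qmat β h a (k + 1)
  have e1 : ∀ c, R * (Q * c * Q) * R = R * c * R := fun c => by
    rw [show R * (Q * c * Q) * R = (R * Q) * c * (Q * R) by noncomm_ring, h1, h2]
  have e2 : ∀ c, Q * (R * c * R) * Q = R * c * R := fun c => by
    rw [show Q * (R * c * R) * Q = (Q * R) * c * (R * Q) by noncomm_ring, h1, h2]
  have e3 : R * (a - Q * a * Q + Q * b * Q) * R = R * b * R := by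
    rw [mul_add, mul_sub, add_mul, sub_mul, e1, e1]
    abel
  have e4 : Q * (b - R * b * R + R * w * R) * Q = Q * b * Q - R * b * R + R * w * R := by
    rw [mul_add, mul_sub, add_mul, sub_mul, e2, e2]
  rw [e3, e4]
  abel

/-- `Q_k` depends on `g`, so `map_resample_const` does not apply directly. In the induction `g` is
replaced by the resampling at level `k` of `a` by an independent `b`; then `Q_{k+1}` is a function
of `a` alone, and conditionally on `a` the constant case applies to `b` and `w`. -/
theorem measurePreserving_resample (hN : 0 < N) (β h : ℝ) (k : ℕ) :
    MeasurePreserving (fun p : Matrix (Fin N) (Fin N) ℝ × Matrix (Fin N) (Fin N) ℝ =>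
      resample β h k p.1 p.2) ((gaussMatrix N).prod (gaussMatrix N)) (gaussMatrix N) := by
  induction k with
  | zero =>
    have e : (fun p : Matrix (Fin N) (Fin N) ℝ × Matrix (Fin N) (Fin N) ℝ =>
        resample β h 0 p.1 p.2) = Prod.snd := by
      funext p
      simp [resample, Qmat, coproj_zero]
    rw [e]
    exact measurePreserving_snd
  | succ k ih =>
    refine ⟨measurable_resample β h (k + 1), ?_⟩
    have h1 := ih.prod (MeasurePreserving.id (gaussMatrix N))
    have h2 : MeasurePreserving
        (fun p : Matrix (Fin N) (Fin N) ℝ × (Matrix (Fin N) (Fin N) ℝ × Matrix (Fin N) (Fin N) ℝ) =>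
          (p.1, p.2.1 - Qmat β h p.1 (k + 1) * p.2.1 * Qmat β h p.1 (k + 1) +
            Qmat β h p.1 (k + 1) * p.2.2 * Qmat β h p.1 (k + 1)))
        ((gaussMatrix N).prod ((gaussMatrix N).prod (gaussMatrix N)))
        ((gaussMatrix N).prod (gaussMatrix N)) := by
      refine (MeasurePreserving.id (gaussMatrix N)).skew_product
        (g := fun (a : Matrix (Fin N) (Fin N) ℝ)
          (q : Matrix (Fin N) (Fin N) ℝ × Matrix (Fin N) (Fin N) ℝ) =>
          q.1 - Qmat β h a (k + 1) * q.1 * Qmat β h a (k + 1) +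
            Qmat β h a (k + 1) * q.2 * Qmat β h a (k + 1)) ?_ (Eventually.of_forall fun a => ?_)
      · have hQ : Measurable fun p : Matrix (Fin N) (Fin N) ℝ ×
            (Matrix (Fin N) (Fin N) ℝ × Matrix (Fin N) (Fin N) ℝ) => Qmat β h p.1 (k + 1) :=
          (measurable_Qmat β h (k + 1)).comp measurable_fst
        exact measurable_matrix_add (measurable_matrix_sub (measurable_fst.comp measurable_snd)
          (measurable_mul_mul hQ (measurable_fst.comp measurable_snd) hQ))
          (measurable_mul_mul hQ (measurable_snd.comp measurable_snd) hQ)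
      · exact map_resample_const hN (Qmat_transpose _ _ _ _) (Qmat_mul_Qmat _ _ _ le_rfl)
    have h3 := ih.comp (h2.comp (measurePreserving_prodAssoc (gaussMatrix N) (gaussMatrix N)
      (gaussMatrix N)))
    rw [← h1.map_eq, Measure.map_map (measurable_resample β h (k + 1)) h1.measurable]
    refine Eq.trans ?_ h3.map_eq
    congr 1
    funext p
    exact resample_succ_resample β h k p.1.1 p.1.2 p.2

/-! ### Exploring the matrix in a given direction -/

/-- Index set of the random numbers used in one step of the exploration. -/
abbrev StepIndex (N : ℕ) := (Fin N × Fin N) ⊕ (Fin N ⊕ Fin N)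

/-- The vector `y` of a step. -/
def yPart (r : StepIndex N → ℝ) : Fin N → ℝ := fun i => r (Sum.inr (Sum.inl i))

/-- The vector `y'` of a step. -/
def yPart' (r : StepIndex N → ℝ) : Fin N → ℝ := fun i => r (Sum.inr (Sum.inr i))

/-- `(y + y') / √2`. -/
noncomputable def xPart (r : StepIndex N → ℝ) : Fin N → ℝ := (√2)⁻¹ • (yPart r + yPart' r)

/-- `(y - y') / √2`. -/
noncomputable def xPart' (r : StepIndex N → ℝ) : Fin N → ℝ := (√2)⁻¹ • (yPart r - yPart' r)

/-- A matrix whose products with the unit vector `φ` are explicit. -/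
noncomputable def exploreMatrix (φ : Fin N → ℝ) (r : StepIndex N → ℝ) :
    Matrix (Fin N) (Fin N) ℝ :=
  (1 - tens φ φ) * scaleMatrix (fun p => r (Sum.inl p)) * (1 - tens φ φ) + tens (xPart r) φ +
    tens φ ((1 - tens φ φ) *ᵥ xPart' r)

theorem one_sub_tens_mulVec (φ v : Fin N → ℝ) : (1 - tens φ φ) *ᵥ v = v - ip φ v • φ := by
  rw [Matrix.sub_mulVec, Matrix.one_mulVec, tens_mulVec]

theorem one_sub_tens_transpose (φ : Fin N → ℝ) : (1 - tens φ φ)ᵀ = 1 - tens φ φ := by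
  rw [Matrix.transpose_sub, Matrix.transpose_one, tens_transpose]

theorem exploreMatrix_mulVec {φ : Fin N → ℝ} (hφ : ip φ φ = 1) (r : StepIndex N → ℝ) :
    exploreMatrix φ r *ᵥ φ = xPart r := by
  have h0 : (1 - tens φ φ) *ᵥ φ = 0 := by rw [one_sub_tens_mulVec, hφ, one_smul, sub_self]
  rw [exploreMatrix, Matrix.add_mulVec, Matrix.add_mulVec, ← Matrix.mulVec_mulVec, h0,
    Matrix.mulVec_zero, zero_add, tens_mulVec, tens_mulVec, hφ, one_smul, ip_mulVec,
    one_sub_tens_transpose, h0, ip_zero_right, zero_smul, add_zero]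

theorem exploreMatrix_transpose_mulVec {φ : Fin N → ℝ} (hφ : ip φ φ = 1) (r : StepIndex N → ℝ) :
    (exploreMatrix φ r)ᵀ *ᵥ φ = xPart' r + ip φ (xPart r - xPart' r) • φ := by
  have h0 : (1 - tens φ φ) *ᵥ φ = 0 := by rw [one_sub_tens_mulVec, hφ, one_smul, sub_self]
  rw [exploreMatrix, Matrix.transpose_add, Matrix.transpose_add, Matrix.transpose_mul,
    Matrix.transpose_mul, one_sub_tens_transpose, Matrix.add_mulVec, Matrix.add_mulVec,
    ← Matrix.mulVec_mulVec, ← Matrix.mulVec_mulVec, h0, Matrix.mulVec_zero, Matrix.mulVec_zero,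
    zero_add, tens_transpose, tens_transpose, tens_mulVec, tens_mulVec, hφ, one_smul,
    one_sub_tens_mulVec, ip_sub_right, ip_comm (xPart r), sub_smul]
  abel

theorem measurable_yPart : Measurable (yPart (N := N)) :=
  measurable_pi_lambda _ fun _ => measurable_pi_apply _

theorem measurable_yPart' : Measurable (yPart' (N := N)) :=
  measurable_pi_lambda _ fun _ => measurable_pi_apply _

theorem measurable_xPart : Measurable (xPart (N := N)) :=
  (measurable_yPart.add measurable_yPart').const_smul (√2)⁻¹

theorem measurable_xPart' : Measurable (xPart' (N := N)) :=
  (measurable_yPart.sub measurable_yPart').const_smul (√2)⁻¹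

theorem measurable_exploreMatrix {Ω : Type*} [MeasurableSpace Ω] {φ : Ω → Fin N → ℝ}
    {r : Ω → StepIndex N → ℝ} (hφ : Measurable φ) (hr : Measurable r) :
    Measurable fun ω => exploreMatrix (φ ω) (r ω) := by
  have h1 : Measurable fun ω => 1 - tens (φ ω) (φ ω) :=
    measurable_matrix_sub measurable_const (measurable_tens hφ hφ)
  have h2 : Measurable fun ω => scaleMatrix (fun q => r ω (Sum.inl q)) :=
    measurable_scaleMatrix.comp (measurable_pi_lambda _ fun q => (measurable_pi_apply _).comp hr)
  refine measurable_matrix_add (measurable_matrix_add (measurable_mul_mul h1 h2 h1)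
    (measurable_tens (measurable_xPart.comp hr) hφ)) (measurable_tens hφ ?_)
  refine measurable_pi_lambda _ fun i => ?_
  simp only [Matrix.mulVec, dotProduct]
  exact Finset.measurable_sum _ fun j _ => (measurable_matrix_iff.1 h1 i j).mul
    ((measurable_pi_apply j).comp (measurable_xPart'.comp hr))

theorem mdot_tens_right (T : Matrix (Fin N) (Fin N) ℝ) (a b : Fin N → ℝ) :
    mdot T (tens a b) = ip a (T *ᵥ b) := by
  simp only [mdot, tens, Matrix.of_apply, ip, Matrix.mulVec, dotProduct, Finset.mul_sum]
  refine Finset.sum_congr rfl fun i _ => Finset.sum_congr rfl fun j _ => ?_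
  ring

/-- Pythagoras for the splitting of a matrix into its compression, its action on `φ`, and the part
of its transposed action orthogonal to `φ`. The last projection prevents the `φ`–`φ` entry from
being counted twice. -/
theorem mdot_self_decomp {φ : Fin N → ℝ} (hφ : ip φ φ = 1) (T : Matrix (Fin N) (Fin N) ℝ) :
    mdot T T = mdot ((1 - tens φ φ) * T * (1 - tens φ φ)) ((1 - tens φ φ) * T * (1 - tens φ φ)) +
      ip (T *ᵥ φ) (T *ᵥ φ) +
      ip ((1 - tens φ φ) *ᵥ (Tᵀ *ᵥ φ)) ((1 - tens φ φ) *ᵥ (Tᵀ *ᵥ φ)) := by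
  have hQt := one_sub_tens_transpose φ
  have hQQ : (1 - tens φ φ) * (1 - tens φ φ) = 1 - tens φ φ := by
    rw [mul_sub, mul_one, mul_tens, one_sub_tens_mulVec, hφ, one_smul, sub_self, tens_zero_left,
      sub_zero]
  set a := T *ᵥ φ with ha
  set b := Tᵀ *ᵥ φ with hb
  have e0 : mdot ((1 - tens φ φ) * T * (1 - tens φ φ)) ((1 - tens φ φ) * T * (1 - tens φ φ)) =
      mdot T ((1 - tens φ φ) * T * (1 - tens φ φ)) := by
    rw [← mdot_conj hQt]
    congr 1
    rw [show ∀ Q : Matrix (Fin N) (Fin N) ℝ, Q * (Q * T * Q) * Q = (Q * Q) * T * (Q * Q) by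
      intro Q; noncomm_ring, hQQ]
  have e1 : (1 - tens φ φ) * T * (1 - tens φ φ) =
      T - tens φ b - tens a φ + ip φ a • tens φ φ := by
    rw [mul_sub, mul_one, mul_assoc, mul_tens, sub_mul, one_mul, sub_mul, one_mul, tens_mul,
      mul_tens, tens_mulVec, tens_smul_left]
    abel
  have e2 : ip φ b = ip φ a := by
    rw [hb, ha, ← ip_mulVec, ip_comm]
  have e3 : ip φ (T *ᵥ b) = ip b b := by
    rw [ip_comm, ip_mulVec]
  have e4 : ip (b - ip φ b • φ) (b - ip φ b • φ) = ip b b - ip φ b ^ 2 := by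
    simp only [ip_sub_left, ip_sub_right, ip_smul_left, ip_smul_right, hφ, ip_comm b φ]
    ring
  rw [e0, e1, mdot_add_right, mdot_sub_right, mdot_sub_right, ← tens_smul_left, mdot_tens_right,
    mdot_tens_right, mdot_tens_right, e3, ← ha, ip_smul_left, one_sub_tens_mulVec, e4, e2]
  ring

theorem ip_self_add_div (a b : Fin N → ℝ) :
    ∑ i, (N : ℝ)⁻¹ ^ 2 * (a i ^ 2 + b i ^ 2) = (ip a a + ip b b) / N := by
  rw [ip, ip, ← mul_add, ← Finset.sum_add_distrib, Finset.mul_sum, Finset.sum_div]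
  refine Finset.sum_congr rfl fun i _ => ?_
  ring

/-- Every linear functional of the matrix is a linear form in `r`; its squared coefficients sum to
`mdot T T / N` by `mdot_self_decomp`, since passing from `(y, y')` to `(x, x')` is a rotation. -/
theorem map_exploreMatrix (hN : 0 < N) {φ : Fin N → ℝ} (hφ : ip φ φ = 1) :
    (stdPi (StepIndex N)).map (fun r => exploreMatrix φ r) = gaussMatrix N := by
  have hm : Measurable fun r : StepIndex N → ℝ => exploreMatrix φ r :=
    measurable_exploreMatrix measurable_const measurable_id
  have := Measure.isProbabilityMeasure_map (μ := stdPi (StepIndex N)) hm.aemeasurable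
  refine eq_gaussMatrix_of_char hN fun T => ?_
  have hc : Measurable fun g : Matrix (Fin N) (Fin N) ℝ =>
      Complex.exp ((mdot T g : ℝ) * Complex.I) := by fun_prop
  rw [integral_map hm.aemeasurable hc.aestronglyMeasurable]
  set U := (1 - tens φ φ) * T * (1 - tens φ φ) with hU
  set a := T *ᵥ φ with ha
  set b := (1 - tens φ φ) *ᵥ (Tᵀ *ᵥ φ) with hb
  let c : StepIndex N → ℝ := Sum.elim (fun p => U p.1 p.2 / √N)
    (Sum.elim (fun i => (N : ℝ)⁻¹ * (√2)⁻¹ * (a i + b i)) fun i => (N : ℝ)⁻¹ * (√2)⁻¹ * (a i - b i))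
  have h2 : (√2)⁻¹ ^ 2 = (1 / 2 : ℝ) := by rw [inv_pow, Real.sq_sqrt zero_le_two]; norm_num
  have e1 : ∀ r, mdot T (exploreMatrix φ r) = ∑ s, c s * r s := fun r => by
    have h3 : mdot T (tens φ ((1 - tens φ φ) *ᵥ xPart' r)) = ip (xPart' r) b := by
      rw [mdot_tens_right, ip_comm, ip_mulVec, ip_mulVec, one_sub_tens_transpose]
    rw [exploreMatrix, mdot_add_right, mdot_add_right, mdot_conj (one_sub_tens_transpose φ),
      mdot_tens_right, h3, ← hU, ← ha]
    simp only [c, Fintype.sum_sum_type, Sum.elim_inl, Sum.elim_inr, Fintype.sum_prod_type, mdot,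
      ip, xPart, xPart', yPart, yPart', scaleMatrix, Matrix.of_apply, Finset.mul_sum, Pi.smul_apply,
      Pi.add_apply, Pi.sub_apply, smul_eq_mul]
    rw [add_assoc, ← Finset.sum_add_distrib, ← Finset.sum_add_distrib]
    rw [← Finset.sum_add_distrib, ← Finset.sum_add_distrib]
    refine Finset.sum_congr rfl fun i _ => ?_
    have h4 : ∑ j, U i j * (r (Sum.inl (i, j)) / √N) = ∑ j, U i j / √N * r (Sum.inl (i, j)) :=
      Finset.sum_congr rfl fun j _ => by ring
    rw [h4]
    ring
  have e2 : ∑ s, c s ^ 2 = mdot T T / N := by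
    rw [mdot_self_decomp hφ T, ← hU, ← ha, ← hb]
    simp only [c, Fintype.sum_sum_type, Sum.elim_inl, Sum.elim_inr, Fintype.sum_prod_type]
    rw [add_assoc, add_div, ← ip_self_add_div]
    congr 1
    · simp only [mdot, Finset.sum_div]
      refine Finset.sum_congr rfl fun i _ => Finset.sum_congr rfl fun j _ => ?_
      rw [div_pow, Real.sq_sqrt (by positivity)]
      ring
    · rw [← Finset.sum_add_distrib]
      refine Finset.sum_congr rfl fun i _ => ?_
      simp only [mul_pow, h2]
      ring
  simp only [e1, integral_exp_stdPi, e2]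

end resampling

/-! ### The conditional expectation of the partition function -/

section annealed

variable {N : ℕ}

/-- The configuration `σ` as a vector. -/
def spinVec (σ : Fin N → Bool) : Fin N → ℝ := fun i => spin (σ i)

theorem spin_mul_self (b : Bool) : spin b * spin b = 1 := by
  cases b <;> simp [spin]

theorem ip_spinVec_self (hN : 0 < N) (σ : Fin N → Bool) : ip (spinVec σ) (spinVec σ) = 1 := by
  have : (N : ℝ) ≠ 0 := by positivity
  simp [ip, spinVec, spin_mul_self, this]

theorem hamiltonian_eq (hN : 0 < N) (β h : ℝ) (g : Matrix (Fin N) (Fin N) ℝ) (σ : Fin N → Bool) :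
    hamiltonian β h g σ =
      N * (β / √2 * ip (spinVec σ) (g *ᵥ spinVec σ) + h * ip (spinVec σ) 1) := by
  have hN' : (N : ℝ) ≠ 0 := by positivity
  have e1 : ∑ i, ∑ j, g i j * spin (σ i) * spin (σ j) = N * ip (spinVec σ) (g *ᵥ spinVec σ) := by
    simp only [ip, Matrix.mulVec, dotProduct, spinVec, Finset.mul_sum]
    refine Finset.sum_congr rfl fun i _ => Finset.sum_congr rfl fun j _ => ?_
    field_simp
  have e2 : ∑ i, spin (σ i) = N * ip (spinVec σ) 1 := by
    simp only [ip, spinVec, Pi.one_apply, mul_one]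
    field_simp
  rw [hamiltonian, e1, e2]
  ring

/-- The exponent in the conditional expectation of the partition function, divided by `N`. -/
noncomputable def exponent (β h : ℝ) (g : Matrix (Fin N) (Fin N) ℝ) (k : ℕ) (s : Fin N → ℝ) : ℝ :=
  h * ip s 1 + β * ∑ m ∈ Finset.Icc 1 k, ip s (zeta (iter β h g m)) * ip s (phi β h g m) -
    β / √2 * ∑ m ∈ Finset.Icc 1 k, ip (phi β h g m) (xi (iter β h g m)) * ip s (phi β h g m) ^ 2 +
    β ^ 2 / 4 * (1 - ∑ m ∈ Finset.Icc 1 k, ip s (phi β h g m) ^ 2) ^ 2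

/-- An explicit form of `E(Z_N | 𝒢_k)`. -/
noncomputable def annealed (β h : ℝ) (g : Matrix (Fin N) (Fin N) ℝ) (k : ℕ) : ℝ :=
  (2 ^ N)⁻¹ * ∑ σ : Fin N → Bool, Real.exp (N * exponent β h g k (spinVec σ))

theorem map_mdot (hN : 0 < N) (T : Matrix (Fin N) (Fin N) ℝ) :
    (gaussMatrix N).map (mdot T) = gaussianReal 0 (mdot T T / N).toNNReal := by
  have := Measure.isProbabilityMeasure_map (μ := gaussMatrix N) (measurable_mdot T).aemeasurable
  have hT : 0 ≤ mdot T T / N := div_nonneg (Finset.sum_nonneg fun i _ =>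
    Finset.sum_nonneg fun j _ => mul_self_nonneg _) (by positivity)
  refine Measure.ext_of_charFun (funext fun t => ?_)
  rw [charFun_gaussianReal, charFun_apply_real, integral_map (measurable_mdot T).aemeasurable
    (by fun_prop : Continuous _).aestronglyMeasurable]
  have h1 := integral_exp_gaussMatrix (t • T)
  have e : ∀ g, mdot (t • T) g = t * mdot T g := fun g => by
    simp only [mdot, Matrix.smul_apply, smul_eq_mul, Finset.mul_sum, mul_assoc]
  simp only [e, mdot_comm T (t • T)] at h1
  push_cast at h1 ⊢
  rw [h1]
  congr 1
  rw [Real.coe_toNNReal _ hT]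
  push_cast
  ring

theorem integrable_exp_mdot (hN : 0 < N) (c : ℝ) (T : Matrix (Fin N) (Fin N) ℝ) :
    Integrable (fun g => Real.exp (c * mdot T g)) (gaussMatrix N) := by
  have h1 := integrable_exp_mul_gaussianReal (μ := 0) (v := (mdot T T / N).toNNReal) c
  rw [← map_mdot hN T] at h1
  exact h1.comp_measurable (measurable_mdot T)

theorem integral_exp_mdot (hN : 0 < N) (c : ℝ) (T : Matrix (Fin N) (Fin N) ℝ) :
    ∫ g, Real.exp (c * mdot T g) ∂(gaussMatrix N) = Real.exp (c ^ 2 * (mdot T T / N) / 2) := by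
  have hT : 0 ≤ mdot T T / N := div_nonneg (Finset.sum_nonneg fun i _ =>
    Finset.sum_nonneg fun j _ => mul_self_nonneg _) (by positivity)
  have h1 := mgf_gaussianReal (map_mdot hN T) c
  rw [mgf] at h1
  rw [h1, Real.coe_toNNReal _ hT]
  congr 1
  ring

theorem ip_rhoMat (β h : ℝ) (g : Matrix (Fin N) (Fin N) ℝ) (m : ℕ) (s : Fin N → ℝ) :
    β / √2 * ip s (rhoMat (iter β h g m) *ᵥ s) =
      β * (ip s (zeta (iter β h g m)) * ip s (phi β h g m)) -
      β / √2 * (ip (phi β h g m) (xi (iter β h g m)) * ip s (phi β h g m) ^ 2) := by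
  have e : zeta (iter β h g m) = (√2)⁻¹ • (xi (iter β h g m) + eta (iter β h g m)) := by
    funext i
    simp [zeta, div_eq_inv_mul]
  rw [rhoMat, Matrix.sub_mulVec, Matrix.add_mulVec, Matrix.smul_mulVec, tens_mulVec, tens_mulVec,
    tens_mulVec, ip_sub_right, ip_add_right, ip_smul_right, ip_smul_right, ip_smul_right,
    ip_smul_right, e, ip_smul_right, ip_add_right]
  change β / √2 * (ip (phi β h g m) s * _ + _ * ip s (phi β h g m) - _ *
    (ip (phi β h g m) s * ip s (phi β h g m))) = _
  rw [ip_comm (phi β h g m) s, ip_comm _ s]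
  change β / √2 * (_ + _ - ip (phi β h g m) _ * _) = _
  ring

theorem ip_Qmat_mulVec_self (β h : ℝ) (g : Matrix (Fin N) (Fin N) ℝ) (k : ℕ) (s : Fin N → ℝ) :
    ip (Qmat β h g k *ᵥ s) (Qmat β h g k *ᵥ s) =
      ip s s - ∑ m ∈ Finset.Icc 1 k, ip s (phi β h g m) ^ 2 := by
  rw [ip_mulVec, Qmat_transpose, Matrix.mulVec_mulVec, Qmat_mul_Qmat _ _ _ le_rfl, Qmat,
    coproj_mulVec, ip_sub_right, ip_sum_right]
  congr 1
  refine Finset.sum_congr rfl fun m _ => ?_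
  rw [ip_smul_right, ip_comm, sq]

/-- The revealed part telescopes into `rhoMat` terms and yields all of `exponent` except the last
summand; that summand is subtracted here and reappears as the variance of the Gaussian form in `w`.
-/
theorem hamiltonian_resample (hN : 0 < N) (β h : ℝ) (g w : Matrix (Fin N) (Fin N) ℝ) (k : ℕ)
    (σ : Fin N → Bool) :
    hamiltonian β h (resample β h k g w) σ = N * (exponent β h g k (spinVec σ) -
      β ^ 2 / 4 * (1 - ∑ m ∈ Finset.Icc 1 k, ip (spinVec σ) (phi β h g m) ^ 2) ^ 2) +
      β * N / √2 * mdot (tens (Qmat β h g k *ᵥ spinVec σ) (Qmat β h g k *ᵥ spinVec σ)) w := by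
  have e1 : ip (spinVec σ) ((g - Qmat β h g k * g * Qmat β h g k) *ᵥ spinVec σ) =
      ∑ m ∈ Finset.Icc 1 k, ip (spinVec σ) (rhoMat (iter β h g m) *ᵥ spinVec σ) := by
    rw [sub_conj_eq_sum, Matrix.sum_mulVec, ip_sum_right]
  have e2 : ip (spinVec σ) ((Qmat β h g k * w * Qmat β h g k) *ᵥ spinVec σ) =
      mdot (tens (Qmat β h g k *ᵥ spinVec σ) (Qmat β h g k *ᵥ spinVec σ)) w := by
    rw [mdot_comm, mdot_tens_right, ip_mulVec, Qmat_transpose, ← Matrix.mulVec_mulVec,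
      ← Matrix.mulVec_mulVec]
  have e3 : β / √2 * ∑ m ∈ Finset.Icc 1 k, ip (spinVec σ) (rhoMat (iter β h g m) *ᵥ spinVec σ) =
      β * ∑ m ∈ Finset.Icc 1 k, ip (spinVec σ) (zeta (iter β h g m)) *
        ip (spinVec σ) (phi β h g m) -
      β / √2 * ∑ m ∈ Finset.Icc 1 k, ip (phi β h g m) (xi (iter β h g m)) *
        ip (spinVec σ) (phi β h g m) ^ 2 := by
    rw [Finset.mul_sum]
    simp only [ip_rhoMat]
    rw [Finset.sum_sub_distrib, ← Finset.mul_sum, ← Finset.mul_sum]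
  rw [hamiltonian_eq hN, resample, Matrix.add_mulVec, ip_add_right, e1, e2, exponent]
  linear_combination (N : ℝ) * e3

theorem integrable_partitionFunction_resample (hN : 0 < N) (β h : ℝ)
    (g : Matrix (Fin N) (Fin N) ℝ) (k : ℕ) :
    Integrable (fun w => partitionFunction β h (resample β h k g w)) (gaussMatrix N) := by
  refine (integrable_finsetSum _ fun σ _ => ?_).const_mul _
  simp only [hamiltonian_resample hN, Real.exp_add]
  exact (integrable_exp_mdot hN _ _).const_mul _

theorem integral_partitionFunction_resample (hN : 0 < N) (β h : ℝ)
    (g : Matrix (Fin N) (Fin N) ℝ) (k : ℕ) :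
    ∫ w, partitionFunction β h (resample β h k g w) ∂(gaussMatrix N) = annealed β h g k := by
  simp only [partitionFunction, annealed]
  rw [integral_const_mul, integral_finsetSum]
  · congr 1
    refine Finset.sum_congr rfl fun σ _ => ?_
    simp only [hamiltonian_resample hN, Real.exp_add]
    rw [integral_const_mul, integral_exp_mdot hN, ← Real.exp_add]
    congr 1
    -- The form in `w` contributes `(β N / √2)² ‖Q_k σ‖⁴ / (2 N) = N β² ‖Q_k σ‖⁴ / 4`, and `‖Q_k σ‖²
    -- = 1 - ∑ ⟨σ, φ^{(m)}⟩²`.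
    have hN' : (N : ℝ) ≠ 0 := by positivity
    rw [mdot_tens_right, tens_mulVec, ip_smul_right, ip_Qmat_mulVec_self, ip_spinVec_self hN,
      div_pow, Real.sq_sqrt zero_le_two]
    field_simp
    ring
  · intro σ _
    simp only [hamiltonian_resample hN, Real.exp_add]
    exact (integrable_exp_mdot hN _ _).const_mul _

/-- The σ-algebra on `Ω` is arbitrary so that it can be `𝒢_k` itself: the directions up to index `k
+ 1` are functions of the revealed vectors. -/
theorem measurable_phi_of_measurable (β h : ℝ) {Ω : Type*} [MeasurableSpace Ω]
    {g : Ω → Matrix (Fin N) (Fin N) ℝ} {k : ℕ}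
    (hxi : ∀ s, 1 ≤ s → s ≤ k → Measurable fun ω => xi (iter β h (g ω) s))
    (heta : ∀ s, 1 ≤ s → s ≤ k → Measurable fun ω => eta (iter β h (g ω) s)) (s : ℕ) (hs : 1 ≤ s)
    (hsk : s ≤ k + 1) (i : Fin N) : Measurable fun ω => phi β h (g ω) s i := by
  induction s using Nat.strong_induction_on generalizing i with
  | _ s ih =>
  rcases hs.eq_or_lt with rfl | hs1
  · simp only [phi_one]
    exact measurable_const
  obtain ⟨t, rfl⟩ : ∃ t, s = t + 1 := ⟨s - 1, by omega⟩
  have ht : 1 ≤ t := by omega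
  have hz : ∀ r, 1 ≤ r → r ≤ t → ∀ i, Measurable fun ω => zeta (iter β h (g ω) r) i := by
    intro r h1 h2 i
    exact (((measurable_pi_apply i).comp (hxi r h1 (by omega))).add
      ((measurable_pi_apply i).comp (heta r h1 (by omega)))).div_const _
  have hm : ∀ i, Measurable fun ω => nextMag β h (iter β h (g ω)) t i := by
    intro i
    refine continuous_tanh.measurable.comp ?_
    refine (measurable_const.add (measurable_const.mul
      (Finset.measurable_sum _ fun r hr => ?_))).add (measurable_const.mul (hz t ht le_rfl i))
    have := Finset.mem_Icc.1 hr
    exact measurable_const.mul (hz r (by omega) (by omega) i)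
  have hr : ∀ i, Measurable fun ω => nextResidual β h (iter β h (g ω)) t i := by
    intro i
    simp only [nextResidual, Pi.sub_apply, Finset.sum_apply, Pi.smul_apply, smul_eq_mul]
    refine (hm i).sub (Finset.measurable_sum _ fun r hr => ?_)
    have := Finset.mem_Icc.1 hr
    have h2 := ih r (by omega) (by omega) (by omega)
    exact (measurable_ip hm h2).mul (h2 i)
  simp only [phi_succ β h _ ht, nrm, Pi.smul_apply, smul_eq_mul]
  exact (measurable_ip hr hr).sqrt.inv.mul (hr i)

theorem measurable_annealed_of_measurable (β h : ℝ) {Ω : Type*} [MeasurableSpace Ω]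
    {g : Ω → Matrix (Fin N) (Fin N) ℝ} {k : ℕ}
    (hxi : ∀ s, 1 ≤ s → s ≤ k → Measurable fun ω => xi (iter β h (g ω) s))
    (heta : ∀ s, 1 ≤ s → s ≤ k → Measurable fun ω => eta (iter β h (g ω) s)) :
    Measurable fun ω => annealed β h (g ω) k := by
  have hphi := measurable_phi_of_measurable β h hxi heta
  refine measurable_const.mul (Finset.measurable_sum _ fun σ _ => Real.measurable_exp.comp
    (measurable_const.mul ?_))
  have hX : ∀ m ∈ Finset.Icc 1 k, Measurable fun ω => ip (spinVec σ) (phi β h (g ω) m) := by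
    intro m hm
    have := Finset.mem_Icc.1 hm
    exact measurable_ip (fun i => measurable_const) (hphi m this.1 (by omega))
  refine ((measurable_const.add (measurable_const.mul (Finset.measurable_sum _ fun m hm => ?_))).sub
    (measurable_const.mul (Finset.measurable_sum _ fun m hm => ?_))).add
    (measurable_const.mul ((measurable_const.sub (Finset.measurable_sum _ fun m hm => ?_)).pow_const 2))
  · have := Finset.mem_Icc.1 hm
    have hz : ∀ i, Measurable fun ω => zeta (iter β h (g ω) m) i := fun i =>
      (((measurable_pi_apply i).comp (hxi m this.1 this.2)).add
        ((measurable_pi_apply i).comp (heta m this.1 this.2))).div_const _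
    have h1 : Measurable fun ω => ip (spinVec σ) (zeta (iter β h (g ω) m)) :=
      measurable_ip (x := fun _ => spinVec σ) (fun i => measurable_const) hz
    exact h1.mul (hX m hm)
  · have := Finset.mem_Icc.1 hm
    exact (measurable_ip (hphi m this.1 (by omega)) fun i =>
      (measurable_pi_apply i).comp (hxi m this.1 this.2)).mul ((hX m hm).pow_const 2)
  · exact (hX m hm).pow_const 2

/-- The vectors `ξ^{(m)}, η^{(m)}`, `1 ≤ m ≤ k`. -/
noncomputable def revealed (β h : ℝ) (k : ℕ) (g : Matrix (Fin N) (Fin N) ℝ) :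
    Finset.Icc 1 k → (Fin N → ℝ) × (Fin N → ℝ) :=
  fun m => (xi (iter β h g m), eta (iter β h g m))

theorem measurable_revealed (β h : ℝ) (k : ℕ) : Measurable (revealed (N := N) β h k) :=
  measurable_pi_lambda _ fun m => (measurable_xi_iter β h m).prodMk (measurable_eta_iter β h m)

theorem revealed_resample (β h : ℝ) (k : ℕ) (g w : Matrix (Fin N) (Fin N) ℝ) :
    revealed β h k (resample β h k g w) = revealed β h k g := by
  funext m
  have := Finset.mem_Icc.1 m.2
  rw [revealed, revealed, xi_resample β h g w this.1 this.2, eta_resample β h g w this.1 this.2]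

theorem sigmaField_le_comap_revealed (β h : ℝ) {Ω : Type*} (g : Ω → Matrix (Fin N) (Fin N) ℝ)
    (k : ℕ) : sigmaField β h g k ≤
      MeasurableSpace.comap (fun ω => revealed β h k (g ω)) inferInstance := by
  refine iSup₂_le fun s hs => sup_le ?_ ?_
  · refine Measurable.comap_le ?_
    have h1 : Measurable fun f : Finset.Icc 1 k → (Fin N → ℝ) × (Fin N → ℝ) => (f ⟨s, hs⟩).1 := by
      fun_prop
    exact h1.comp (comap_measurable _)
  · refine Measurable.comap_le ?_
    have h1 : Measurable fun f : Finset.Icc 1 k → (Fin N → ℝ) × (Fin N → ℝ) => (f ⟨s, hs⟩).2 := by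
      fun_prop
    exact h1.comp (comap_measurable _)

theorem measurable_partitionFunction (β h : ℝ) :
    Measurable fun g : Matrix (Fin N) (Fin N) ℝ => partitionFunction β h g := by
  refine measurable_const.mul (Finset.measurable_sum _ fun σ _ => Real.measurable_exp.comp ?_)
  refine (measurable_const.mul (Finset.measurable_sum _ fun i _ =>
    Finset.measurable_sum _ fun j _ => ?_)).add measurable_const
  exact ((measurable_entry i j).mul_const _).mul_const _

/-- Every event of `𝒢_k` is a preimage under `revealed`, which resampling leaves fixed while
preserving the law of `g`. On such an event the matrix may be replaced by its resampling, and the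
inner integral over `w` is `annealed`. -/
theorem condExp_partitionFunction (hN : 0 < N) (β h : ℝ) {Ω : Type*} [MeasurableSpace Ω]
    {P : Measure Ω} [IsProbabilityMeasure P] {g : Ω → Matrix (Fin N) (Fin N) ℝ}
    (hg : Measurable g) (hlaw : P.map g = gaussMatrix N)
    (hint : Integrable (fun ω => partitionFunction β h (g ω)) P) (k : ℕ) :
    P[fun ω => partitionFunction β h (g ω) | sigmaField β h g k] =ᵐ[P]
      fun ω => annealed β h (g ω) k := by
  have hm := sigmaField_le β h (measurable_matrix_iff.1 hg) k
  have hxi : ∀ s, 1 ≤ s → s ≤ k →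
      Measurable[sigmaField β h g k] fun ω => xi (iter β h (g ω) s) := fun s h1 h2 =>
    Measurable.mono (comap_measurable _) (le_trans le_sup_left
      (le_iSup₂_of_le s (Finset.mem_Icc.2 ⟨h1, h2⟩) le_rfl)) le_rfl
  have heta : ∀ s, 1 ≤ s → s ≤ k →
      Measurable[sigmaField β h g k] fun ω => eta (iter β h (g ω) s) := fun s h1 h2 =>
    Measurable.mono (comap_measurable _) (le_trans le_sup_right
      (le_iSup₂_of_le s (Finset.mem_Icc.2 ⟨h1, h2⟩) le_rfl)) le_rfl
  have hA : Measurable[sigmaField β h g k] fun ω => annealed β h (g ω) k :=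
    @measurable_annealed_of_measurable N β h Ω (sigmaField β h g k) g k hxi heta
  have hAm : Measurable fun x : Matrix (Fin N) (Fin N) ℝ => annealed β h x k :=
    measurable_annealed_of_measurable (g := id) β h (fun s _ _ => measurable_xi_iter β h s)
      fun s _ _ => measurable_eta_iter β h s
  have hZm := measurable_partitionFunction (N := N) β h
  have hZ : Integrable (fun x => partitionFunction β h x) (gaussMatrix N) := by
    rw [← hlaw]
    exact (integrable_map_measure hZm.aestronglyMeasurable hg.aemeasurable).2 hint
  have hR := measurePreserving_resample hN β h k
  have hZ2 : Integrable (fun p : Matrix (Fin N) (Fin N) ℝ × Matrix (Fin N) (Fin N) ℝ =>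
      partitionFunction β h (resample β h k p.1 p.2)) ((gaussMatrix N).prod (gaussMatrix N)) :=
    hR.integrable_comp_of_integrable hZ
  have hAint : Integrable (fun x => annealed β h x k) (gaussMatrix N) := by
    have := hZ2.integral_prod_left
    simpa only [integral_partitionFunction_resample hN] using this
  refine (ae_eq_condExp_of_forall_setIntegral_eq hm hint ?_ ?_
    hA.stronglyMeasurable.aestronglyMeasurable).symm
  · intro s _ _
    refine Integrable.integrableOn ?_
    rw [← hlaw] at hAint
    exact hAint.comp_measurable hg
  · intro s hs _
    obtain ⟨B, hB, rfl⟩ := sigmaField_le_comap_revealed β h g k s hs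
    have hD := measurable_revealed (N := N) β h k
    have hBm : MeasurableSet (revealed (N := N) β h k ⁻¹' B) := hD hB
    have e1 : ∀ F : Matrix (Fin N) (Fin N) ℝ → ℝ, Measurable F →
        ∫ ω in (fun ω => revealed β h k (g ω)) ⁻¹' B, F (g ω) ∂P =
        ∫ x, (revealed β h k ⁻¹' B).indicator F x ∂(gaussMatrix N) := by
      intro F hF
      rw [← hlaw, integral_map hg.aemeasurable (hF.indicator hBm).aestronglyMeasurable]
      exact (integral_indicator (hg hBm)).symm
    rw [e1 _ hAm, e1 _ hZm]
    -- Only the integral of the partition function is lifted to pairs `(x, w)`; the indicator of the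
    -- event then depends on `x` alone.
    conv_rhs => rw [← hR.map_eq]
    rw [integral_map hR.measurable.aemeasurable (hZm.indicator hBm).aestronglyMeasurable,
      integral_prod]
    · refine integral_congr_ae (Eventually.of_forall fun x => ?_)
      beta_reduce
      by_cases hx : revealed β h k x ∈ B
      · have hx' : ∀ w, resample β h k x w ∈ revealed β h k ⁻¹' B := fun w => by
          rw [Set.mem_preimage, revealed_resample]; exact hx
        simp only [Set.indicator_of_mem (show x ∈ revealed β h k ⁻¹' B from hx),
          Set.indicator_of_mem (hx' _), integral_partitionFunction_resample hN]
      · have hx' : ∀ w, resample β h k x w ∉ revealed β h k ⁻¹' B := fun w => by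
          rw [Set.mem_preimage, revealed_resample]; exact hx
        simp only [Set.indicator_of_notMem (show x ∉ revealed β h k ⁻¹' B from hx),
          Set.indicator_of_notMem (hx' _), integral_zero]
    · exact hR.integrable_comp_of_integrable (hZ.indicator hBm)

end annealed

/-! ### A probability space on which the recursion is explored step by step -/

section explore

variable {N : ℕ}

/-- The sequences of independent standard Gaussian variables that drive the exploration. -/
abbrev BaseSpace (N : ℕ) := ℕ × StepIndex N → ℝ

/-- The law of the driving sequence. -/
noncomputable abbrev baseMeasure (N : ℕ) : Measure (BaseSpace N) :=
  Measure.infinitePi fun _ => stdGauss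

/-- The random numbers used in step `m`. -/
def noise (m : ℕ) (ω : BaseSpace N) : StepIndex N → ℝ := fun s => ω (m, s)

theorem measurable_noise (m : ℕ) : Measurable (noise (N := N) m) :=
  measurable_pi_lambda _ fun s => measurable_pi_apply (m, s)

theorem iIndepFun_coord :
    iIndepFun (fun (p : ℕ × StepIndex N) (ω : BaseSpace N) => ω p) (baseMeasure N) :=
  iIndepFun_infinitePi (X := fun _ x => x) fun _ => measurable_id

theorem map_coord (p : ℕ × StepIndex N) :
    (baseMeasure N).map (fun ω => ω p) = stdGauss :=
  (measurePreserving_eval_infinitePi (fun _ : ℕ × StepIndex N => stdGauss) p).map_eq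

theorem map_noise (m : ℕ) : (baseMeasure N).map (noise m) = stdPi (StepIndex N) := by
  have := Measure.map_infinitePi_infinitePi_of_inj (P := fun _ : ℕ × StepIndex N => stdGauss)
    (f := fun s : StepIndex N => (m, s)) (Prod.mk_right_injective m)
  exact this.trans (Measure.infinitePi_eq_pi _)

/-- `φ^{(s)}`, replaced by the unit vector `1` if it vanishes. -/
noncomputable def unitPhi (β h : ℝ) (g : Matrix (Fin N) (Fin N) ℝ) (s : ℕ) : Fin N → ℝ :=
  if ip (phi β h g s) (phi β h g s) = 1 then phi β h g s else 1

theorem ip_one_one (hN : 0 < N) : ip (1 : Fin N → ℝ) 1 = 1 := by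
  have : (N : ℝ) ≠ 0 := by positivity
  simp [ip, this]

theorem ip_unitPhi (hN : 0 < N) (β h : ℝ) (g : Matrix (Fin N) (Fin N) ℝ) (s : ℕ) :
    ip (unitPhi β h g s) (unitPhi β h g s) = 1 := by
  rw [unitPhi]
  split_ifs with h1
  · exact h1
  · exact ip_one_one hN

theorem measurable_unitPhi (β h : ℝ) (s : ℕ) :
    Measurable fun g : Matrix (Fin N) (Fin N) ℝ => unitPhi β h g s := by
  have h1 := measurable_phi (N := N) β h s
  refine Measurable.ite (measurableSet_eq_fun ?_ measurable_const) h1 measurable_const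
  exact measurable_ip (fun i => (measurable_pi_apply i).comp h1)
    fun i => (measurable_pi_apply i).comp h1

/-- One step of the exploration. -/
noncomputable def exploreStep (β h : ℝ) (j : ℕ) (g : Matrix (Fin N) (Fin N) ℝ)
    (r : StepIndex N → ℝ) : Matrix (Fin N) (Fin N) ℝ :=
  resample β h j g (exploreMatrix (unitPhi β h g (j + 1)) r)

theorem measurable_exploreStep (β h : ℝ) (j : ℕ) :
    Measurable fun p : Matrix (Fin N) (Fin N) ℝ × (StepIndex N → ℝ) =>
      exploreStep β h j p.1 p.2 := by
  refine (measurable_resample β h j).comp (measurable_fst.prodMk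
    (measurable_exploreMatrix ((measurable_unitPhi β h (j + 1)).comp measurable_fst)
      measurable_snd))

/-- Given `g`, the matrix explored along a unit vector determined by `g` has the Gaussian law, so
together with `g` it forms two independent copies, to which resampling applies. `unitPhi` makes this
valid without excluding any event. -/
theorem measurePreserving_exploreStep (hN : 0 < N) (β h : ℝ) (j : ℕ) :
    MeasurePreserving (fun p : Matrix (Fin N) (Fin N) ℝ × (StepIndex N → ℝ) =>
      exploreStep β h j p.1 p.2) ((gaussMatrix N).prod (stdPi (StepIndex N))) (gaussMatrix N) := by
  have h1 := (MeasurePreserving.id (gaussMatrix N)).skew_product (μc := stdPi (StepIndex N))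
    (μd := gaussMatrix N) (g := fun (g : Matrix (Fin N) (Fin N) ℝ) (r : StepIndex N → ℝ) =>
      exploreMatrix (unitPhi β h g (j + 1)) r)
    (measurable_exploreMatrix ((measurable_unitPhi β h (j + 1)).comp measurable_fst)
      measurable_snd)
    (Eventually.of_forall fun g => map_exploreMatrix hN (ip_unitPhi hN β h g _))
  exact (measurePreserving_resample hN β h j).comp h1

/-- The matrix known after `j` steps of the exploration. -/
noncomputable def explored (β h : ℝ) : ℕ → BaseSpace N → Matrix (Fin N) (Fin N) ℝ
  | 0, ω => scaleMatrix fun p => ω (0, Sum.inl p)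
  | j + 1, ω => exploreStep β h j (explored β h j ω) (noise (j + 1) ω)

theorem measurable_explored (β h : ℝ) (j : ℕ) : Measurable (explored (N := N) β h j) := by
  induction j with
  | zero =>
    exact measurable_scaleMatrix.comp (measurable_pi_lambda _ fun p => measurable_pi_apply _)
  | succ j ih =>
    exact (measurable_exploreStep β h j).comp (ih.prodMk (measurable_noise (j + 1)))

theorem explored_congr (β h : ℝ) {j : ℕ} {ω ω' : BaseSpace N}
    (hω : ∀ m ≤ j, ∀ s, ω (m, s) = ω' (m, s)) : explored β h j ω = explored β h j ω' := by
  induction j with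
  | zero =>
    simp only [explored]
    congr 1
    funext p
    exact hω 0 le_rfl _
  | succ j ih =>
    simp only [explored]
    rw [ih fun m hm => hω m (by omega), show noise (j + 1) ω = noise (j + 1) ω' from
      funext fun s => hω _ le_rfl s]

theorem indepFun_explored_noise (β h : ℝ) (j : ℕ) :
    IndepFun (explored (N := N) β h j) (noise (j + 1)) (baseMeasure N) := by
  classical
  let S : Finset (ℕ × StepIndex N) := Finset.range (j + 1) ×ˢ Finset.univ
  let T : Finset (ℕ × StepIndex N) := {j + 1} ×ˢ Finset.univ
  have hST : Disjoint S T := by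
    rw [Finset.disjoint_left]
    rintro ⟨m, s⟩ h1 h2
    simp only [S, T, Finset.mem_product, Finset.mem_range, Finset.mem_singleton] at h1 h2
    omega
  have h1 := iIndepFun_coord.indepFun_finset S T hST fun p => measurable_pi_apply p
  -- The explored matrix reads only the coordinates of steps `0, …, j`. Filling the others with `0`
  -- presents it as a function of finitely many coordinates, disjoint from those of step `j + 1`.
  let ext : (S → ℝ) → BaseSpace N := fun f p => if hp : p ∈ S then f ⟨p, hp⟩ else 0
  have hext : Measurable ext := by
    refine measurable_pi_lambda _ fun p => ?_
    by_cases hp : p ∈ S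
    · simpa only [ext, hp, dite_true] using measurable_pi_apply _
    · simpa only [ext, hp, dite_false] using measurable_const
  have hT : ∀ s : StepIndex N, ((j + 1, s) : ℕ × StepIndex N) ∈ T := fun s => by
    simp [T]
  have h2 := h1.comp ((measurable_explored β h j).comp hext)
    (ψ := fun (f : T → ℝ) (s : StepIndex N) => f ⟨(j + 1, s), hT s⟩)
    (measurable_pi_lambda _ fun s => measurable_pi_apply _)
  convert h2 using 1
  swap
  · rfl
  funext ω
  refine explored_congr β h fun m hm s => ?_
  have : ((m, s) : ℕ × StepIndex N) ∈ S := by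
    simp only [S, Finset.mem_product, Finset.mem_range, Finset.mem_univ, and_true]
    omega
  simp only [ext, this, dite_true]

theorem map_explored (hN : 0 < N) (β h : ℝ) (j : ℕ) :
    (baseMeasure N).map (explored β h j) = gaussMatrix N ∧
    (baseMeasure N).map (fun ω => (explored β h j ω, noise (j + 1) ω)) =
      (gaussMatrix N).prod (stdPi (StepIndex N)) := by
  have key : ∀ j, (baseMeasure N).map (explored β h j) = gaussMatrix N →
      (baseMeasure N).map (fun ω => (explored β h j ω, noise (j + 1) ω)) =
        (gaussMatrix N).prod (stdPi (StepIndex N)) := by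
    intro j hj
    rw [(indepFun_iff_map_prod_eq_prod_map_map (measurable_explored β h j).aemeasurable
      (measurable_noise _).aemeasurable).1 (indepFun_explored_noise β h j), hj, map_noise]
  suffices h1 : (baseMeasure N).map (explored β h j) = gaussMatrix N from ⟨h1, key j h1⟩
  induction j with
  | zero =>
    have h2 := Measure.map_infinitePi_infinitePi_of_inj (P := fun _ : ℕ × StepIndex N => stdGauss)
      (f := fun p : Fin N × Fin N => ((0, Sum.inl p) : ℕ × StepIndex N))
      (fun p p' hp => by simpa using hp)
    have h3 : (Measure.infinitePi fun _ : Fin N × Fin N => stdGauss) = stdPi (Fin N × Fin N) :=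
      Measure.infinitePi_eq_pi _
    rw [h3] at h2
    rw [gaussMatrix, ← h2, Measure.map_map measurable_scaleMatrix
      (measurable_pi_lambda _ fun p => measurable_pi_apply _)]
    rfl
  | succ j ih =>
    have h2 := (measurePreserving_exploreStep hN β h j).map_eq
    rw [← key j ih, Measure.map_map (measurable_exploreStep β h j)
      ((measurable_explored β h j).prodMk (measurable_noise _))] at h2
    exact h2

/-- All steps after the first `j` resample at levels at least `j`, which cannot affect directions up
to `j + 1`. In particular `φ^{(j+1)}` is known before the noise `j + 1` is used. -/
theorem phi_explored (β h : ℝ) (ω : BaseSpace N) {s j K : ℕ} (hs : 1 ≤ s) (hj : s ≤ j + 1)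
    (hK : j ≤ K) : phi β h (explored β h K ω) s = phi β h (explored β h j ω) s := by
  induction K, hK using Nat.le_induction with
  | base => rfl
  | succ K hK ih => rw [explored, exploreStep, phi_resample β h _ _ hs (by omega), ih]

theorem xi_eta_explored (β h : ℝ) (ω : BaseSpace N) {s j K : ℕ} (hs : 1 ≤ s) (hj : s ≤ j)
    (hK : j ≤ K) : xi (iter β h (explored β h K ω) s) = xi (iter β h (explored β h j ω) s) ∧
      eta (iter β h (explored β h K ω) s) = eta (iter β h (explored β h j ω) s) := by
  induction K, hK using Nat.le_induction with
  | base => exact ⟨rfl, rfl⟩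
  | succ K hK ih =>
    rw [explored, exploreStep, xi_resample β h _ _ hs (by omega),
      eta_resample β h _ _ hs (by omega)]
    exact ih

theorem Qmat_explored (β h : ℝ) (ω : BaseSpace N) {l j K : ℕ} (hj : l ≤ j + 1)
    (hK : j ≤ K) : Qmat β h (explored β h K ω) l = Qmat β h (explored β h j ω) l :=
  coproj_congr fun _ h1 h2 => phi_explored β h ω h1 (by omega) hK

theorem Qmat_mul_resample_mul (β h : ℝ) (k : ℕ) (g w : Matrix (Fin N) (Fin N) ℝ) :
    Qmat β h g k * resample β h k g w * Qmat β h g k = Qmat β h g k * w * Qmat β h g k := by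
  have hQ := Qmat_mul_Qmat β h g (le_refl k)
  have e : ∀ x : Matrix (Fin N) (Fin N) ℝ, Qmat β h g k * (Qmat β h g k * x * Qmat β h g k) *
      Qmat β h g k = Qmat β h g k * x * Qmat β h g k := fun x => by
    rw [← Matrix.mul_assoc, ← Matrix.mul_assoc, hQ, Matrix.mul_assoc _ (Qmat β h g k), hQ]
  rw [resample, Matrix.mul_add, Matrix.mul_sub, Matrix.add_mul, Matrix.sub_mul, e, e, sub_self,
    zero_add]

/-! ### Explicit form of `ξ`, `η` and `ζ` in terms of the fresh noise. -/

section step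

variable {β h : ℝ} {ω : BaseSpace N} {K j : ℕ}

theorem xi_explored_of_unit (hK : j + 1 ≤ K)
    (hu : ip (phi β h (explored β h K ω) (j + 1)) (phi β h (explored β h K ω) (j + 1)) = 1) :
    xi (iter β h (explored β h K ω) (j + 1)) =
      Qmat β h (explored β h K ω) j *ᵥ xPart (noise (j + 1) ω) := by
  rw [(xi_eta_explored β h ω (by omega) le_rfl hK).1, Qmat_explored β h ω (by omega)
    (show j ≤ K by omega)]
  rw [phi_explored β h ω (by omega) le_rfl (show j ≤ K by omega)] at hu
  have hQφ := Qmat_mulVec_phi_succ β h (explored β h j ω) j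
  rw [xi_iter_succ, explored, exploreStep, Qmat_resample β h _ _ (by omega),
    phi_resample β h _ _ (by omega) le_rfl, Matrix.mulVec_mulVec]
  conv_lhs => rw [← hQφ]
  rw [Matrix.mulVec_mulVec, Qmat_mul_resample_mul, ← Matrix.mulVec_mulVec, hQφ,
    ← Matrix.mulVec_mulVec, unitPhi, if_pos hu, exploreMatrix_mulVec hu]

theorem eta_explored_of_unit (hK : j + 1 ≤ K)
    (hu : ip (phi β h (explored β h K ω) (j + 1)) (phi β h (explored β h K ω) (j + 1)) = 1) :
    eta (iter β h (explored β h K ω) (j + 1)) =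
      Qmat β h (explored β h K ω) j *ᵥ xPart' (noise (j + 1) ω) +
        ip (phi β h (explored β h K ω) (j + 1))
          (xPart (noise (j + 1) ω) - xPart' (noise (j + 1) ω)) •
          phi β h (explored β h K ω) (j + 1) := by
  rw [(xi_eta_explored β h ω (by omega) le_rfl hK).2, Qmat_explored β h ω (by omega)
    (show j ≤ K by omega)]
  rw [phi_explored β h ω (by omega) le_rfl (show j ≤ K by omega)] at hu ⊢
  have hQφ := Qmat_mulVec_phi_succ β h (explored β h j ω) j
  have ht : ∀ w, Qmat β h (explored β h j ω) j * (resample β h j (explored β h j ω) w)ᵀ *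
      Qmat β h (explored β h j ω) j =
      Qmat β h (explored β h j ω) j * wᵀ * Qmat β h (explored β h j ω) j := by
    intro w
    have := congrArg Matrix.transpose (Qmat_mul_resample_mul β h j (explored β h j ω) w)
    simpa only [Matrix.transpose_mul, Qmat_transpose, Matrix.mul_assoc] using this
  rw [eta_iter_succ, explored, exploreStep, Qmat_resample β h _ _ (by omega),
    phi_resample β h _ _ (by omega) le_rfl, Matrix.mulVec_mulVec]
  conv_lhs => rw [← hQφ]
  rw [Matrix.mulVec_mulVec, ht, ← Matrix.mulVec_mulVec, hQφ, ← Matrix.mulVec_mulVec, unitPhi,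
    if_pos hu, exploreMatrix_transpose_mulVec hu, Matrix.mulVec_add, Matrix.mulVec_smul, hQφ]

/-- Since `x + x' = √2 y` and `x - x' = √2 y'`, the symmetrization isolates `y`: the result is `Q_j
y` plus a correction along `φ^{(j+1)}` that involves only `y'`. -/
theorem zeta_explored_of_unit (hK : j + 1 ≤ K)
    (hu : ip (phi β h (explored β h K ω) (j + 1)) (phi β h (explored β h K ω) (j + 1)) = 1) :
    zeta (iter β h (explored β h K ω) (j + 1)) =
      yPart (noise (j + 1) ω) -
        ∑ s ∈ Finset.Icc 1 j, ip (phi β h (explored β h K ω) s) (yPart (noise (j + 1) ω)) •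
          phi β h (explored β h K ω) s +
        ip (phi β h (explored β h K ω) (j + 1)) (yPart' (noise (j + 1) ω)) •
          phi β h (explored β h K ω) (j + 1) := by
  have h2 : (√2 : ℝ) ≠ 0 := by positivity
  have h22 : (√2 : ℝ) * √2 = 2 := Real.mul_self_sqrt zero_le_two
  have e : zeta (iter β h (explored β h K ω) (j + 1)) = (√2)⁻¹ •
      (xi (iter β h (explored β h K ω) (j + 1)) + eta (iter β h (explored β h K ω) (j + 1))) := by
    funext i
    simp [zeta, div_eq_inv_mul]
  have e1 : xPart (noise (j + 1) ω) + xPart' (noise (j + 1) ω) =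
      √2 • yPart (noise (j + 1) ω) := by
    funext i
    simp only [xPart, xPart', Pi.add_apply, Pi.smul_apply, Pi.sub_apply, smul_eq_mul]
    field_simp
    linear_combination (-yPart (noise (j + 1) ω) i) * h22
  have e2 : xPart (noise (j + 1) ω) - xPart' (noise (j + 1) ω) =
      √2 • yPart' (noise (j + 1) ω) := by
    funext i
    simp only [xPart, xPart', Pi.add_apply, Pi.smul_apply, Pi.sub_apply, smul_eq_mul]
    field_simp
    linear_combination (-yPart' (noise (j + 1) ω) i) * h22
  rw [e, xi_explored_of_unit hK hu, eta_explored_of_unit hK hu, ← add_assoc, ← Matrix.mulVec_add,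
    e1, e2, Matrix.mulVec_smul, ip_smul_right, smul_add, smul_smul, smul_smul, ← mul_assoc,
    inv_mul_cancel₀ h2, one_smul, one_mul, Qmat, coproj_mulVec]

end step

/-! ### Projections of fresh noise are small -/

theorem isGaussPair_stdPi {ι : Type*} [Fintype ι] (a b : ι → ℝ) :
    IsGaussPair (stdPi ι) (fun r => ∑ s, a s * r s) (fun r => ∑ s, b s * r s)
      (∑ s, a s ^ 2) (∑ s, a s * b s) (∑ s, b s ^ 2) :=
  IsGaussPair.of_iIndepFun (X := fun s (r : ι → ℝ) => r s) (fun s => measurable_pi_apply s)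
    (fun s => (measurePreserving_eval (fun _ : ι => stdGauss) s).map_eq)
    (iIndepFun_pi (X := fun _ x => x) fun _ => aemeasurable_id) a b

theorem measure_abs_sum_stdPi_ge_le {ι : Type*} [Fintype ι] (a : ι → ℝ) {ε : ℝ} (hε : 0 < ε) :
    stdPi ι {r | ε ≤ |∑ s, a s * r s|} ≤ ENNReal.ofReal ((∑ s, a s ^ 2) / ε ^ 2) := by
  have hP := isGaussPair_stdPi a a
  have hu : 0 ≤ ∑ s, a s ^ 2 := Finset.sum_nonneg fun _ _ => sq_nonneg _
  have hL : MemLp (fun r : ι → ℝ => ∑ s, a s * r s) 2 (stdPi ι) := by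
    exact_mod_cast hP.memLp_left hu 2
  have h0 : ∫ r : ι → ℝ, ∑ s, a s * r s ∂(stdPi ι) = 0 := by
    have := hP.integral_left hu measurable_id
    simp only [id] at this
    rw [this, integral_const_mul, integral_id_gaussianReal, mul_zero]
  have hv : variance (fun r : ι → ℝ => ∑ s, a s * r s) (stdPi ι) = ∑ s, a s ^ 2 := by
    rw [variance_of_integral_eq_zero hL.aestronglyMeasurable.aemeasurable h0]
    exact hP.integral_sq_left hu
  have := meas_ge_le_variance_div_sq hL hε
  simpa only [h0, hv, sub_zero] using this

/-- Conditionally on the explored matrix the fresh noise is standard Gaussian, and its inner product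
with a vector of norm at most one has variance at most `1 / N`; then Chebyshev. -/
theorem measure_abs_ip_explored_ge_le (hN : 0 < N) (β h : ℝ) {j s : ℕ} {ε : ℝ} (hε : 0 < ε)
    {L : (StepIndex N → ℝ) → Fin N → ℝ} (hL : L = yPart ∨ L = yPart') :
    baseMeasure N {ω | ε ≤ |ip (phi β h (explored β h j ω) s) (L (noise (j + 1) ω))|} ≤
      ENNReal.ofReal ((N : ℝ)⁻¹ / ε ^ 2) := by
  have hLm : Measurable L := by
    rcases hL with rfl | rfl
    · exact measurable_yPart
    · exact measurable_yPart'
  have hm : MeasurableSet {p : Matrix (Fin N) (Fin N) ℝ × (StepIndex N → ℝ) |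
      ε ≤ |ip (phi β h p.1 s) (L p.2)|} := by
    refine measurableSet_le measurable_const (Measurable.abs ?_)
    exact measurable_ip
      (fun i => (measurable_pi_apply i).comp ((measurable_phi β h s).comp measurable_fst))
      fun i => (measurable_pi_apply i).comp (hLm.comp measurable_snd)
  have h1 := Measure.map_apply (μ := baseMeasure N)
    ((measurable_explored β h j).prodMk (measurable_noise (j + 1))) hm
  rw [(map_explored hN β h j).2, Measure.prod_apply hm] at h1
  refine (le_of_eq h1.symm).trans ?_
  have hφ : ∀ g : Matrix (Fin N) (Fin N) ℝ, ip (phi β h g s) (phi β h g s) ≤ 1 := by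
    intro g
    match s with
    | 0 => simp [phi, iter, ip]
    | 1 => rw [phi_one, ip_one_one hN]
    | s + 2 =>
      rw [phi_succ β h g (by omega)]
      rcases ip_normalize (nextResidual β h (iter β h g) (s + 1)) with h2 | h2
      · rw [h2, ip_zero_left]; exact zero_le_one
      · exact h2.le
  have hN' : (N : ℝ) ≠ 0 := by positivity
  have h3 : ∀ g : Matrix (Fin N) (Fin N) ℝ, stdPi (StepIndex N) (Prod.mk g ⁻¹'
      {p : Matrix (Fin N) (Fin N) ℝ × (StepIndex N → ℝ) | ε ≤ |ip (phi β h p.1 s) (L p.2)|}) ≤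
      ENNReal.ofReal ((N : ℝ)⁻¹ / ε ^ 2) := by
    intro g
    have e : ∃ a : StepIndex N → ℝ, (∀ r, ip (phi β h g s) (L r) = ∑ t, a t * r t) ∧
        ∑ t, a t ^ 2 = (N : ℝ)⁻¹ * ip (phi β h g s) (phi β h g s) := by
      rcases hL with rfl | rfl
      · refine ⟨Sum.elim 0 (Sum.elim (fun i => (N : ℝ)⁻¹ * phi β h g s i) 0), fun r => ?_, ?_⟩
        · simp [ip, yPart, Finset.mul_sum, mul_assoc]
        · simp [ip, Finset.mul_sum, mul_pow]
          refine Finset.sum_congr rfl fun i _ => by ring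
      · refine ⟨Sum.elim 0 (Sum.elim 0 (fun i => (N : ℝ)⁻¹ * phi β h g s i)), fun r => ?_, ?_⟩
        · simp [ip, yPart', Finset.mul_sum, mul_assoc]
        · simp [ip, Finset.mul_sum, mul_pow]
          refine Finset.sum_congr rfl fun i _ => by ring
    obtain ⟨a, ha, ha'⟩ := e
    have h4 := measure_abs_sum_stdPi_ge_le a hε
    simp only [← ha] at h4
    refine h4.trans (ENNReal.ofReal_le_ofReal ?_)
    rw [ha']
    have h5 : 0 ≤ (N : ℝ)⁻¹ := by positivity
    gcongr
    exact mul_le_of_le_one_right h5 (hφ g)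
  calc ∫⁻ g, _ ∂(gaussMatrix N) ≤ ∫⁻ _, ENNReal.ofReal ((N : ℝ)⁻¹ / ε ^ 2) ∂(gaussMatrix N) :=
        lintegral_mono h3
    _ = _ := by simp

end explore

/-! ### Convergence in probability along the base spaces -/

/-- The disjoint union of the base spaces. -/
abbrev SampleSpace := Σ N : ℕ, BaseSpace N

/-- The filter of the sets whose probability tends to one. -/
noncomputable def whp : Filter SampleSpace where
  -- No measurability of `S` is required, since the filter axioms use only monotonicity and
  -- subadditivity. Convergence in probability to a constant becomes `Tendsto` along this filter,
  -- with the usual calculus of limits.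
  sets := {S | Tendsto (fun N => baseMeasure N {ω | (⟨N, ω⟩ : SampleSpace) ∉ S}) atTop (𝓝 0)}
  univ_sets := by simp
  sets_of_superset {S T} hS hST :=
    tendsto_of_tendsto_of_tendsto_of_le_of_le tendsto_const_nhds hS (fun _ => zero_le)
      fun N => measure_mono fun ω hω h => hω (hST h)
  inter_sets {S T} hS hT := by
    have h1 := Tendsto.add hS hT
    rw [add_zero] at h1
    refine tendsto_of_tendsto_of_tendsto_of_le_of_le tendsto_const_nhds h1 (fun _ => zero_le)
      fun N => (measure_mono fun ω hω => ?_).trans (measure_union_le _ _)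
    simp only [Set.mem_inter_iff, Set.mem_ofPred_eq, Set.mem_union] at hω ⊢
    tauto

theorem mem_whp {S : Set SampleSpace} : S ∈ whp ↔
    Tendsto (fun N => baseMeasure N {ω | (⟨N, ω⟩ : SampleSpace) ∉ S}) atTop (𝓝 0) := Iff.rfl

theorem tendsto_whp_of_le {X : SampleSpace → ℝ} {c : ℝ} {b : ℝ → ℕ → ℝ≥0∞}
    (hb : ∀ ε > 0, Tendsto (b ε) atTop (𝓝 0))
    (hX : ∀ ε > 0, ∀ N, 0 < N → baseMeasure N {ω | ε ≤ |X ⟨N, ω⟩ - c|} ≤ b ε N) :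
    Tendsto X whp (𝓝 c) := by
  rw [Metric.tendsto_nhds]
  intro ε hε
  refine tendsto_of_tendsto_of_tendsto_of_le_of_le' tendsto_const_nhds (hb ε hε)
    (Eventually.of_forall fun _ => zero_le) ?_
  filter_upwards [eventually_gt_atTop 0] with N hN
  refine le_trans (measure_mono fun ω hω => ?_) (hX ε hε N hN)
  simpa [Real.dist_eq] using hω

theorem eventually_whp_pos : ∀ᶠ p in whp, 0 < p.1 := by
  rw [Filter.Eventually, mem_whp]
  refine tendsto_const_nhds.congr' ?_
  filter_upwards [eventually_gt_atTop 0] with N hN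
  simp [hN]

theorem tendsto_whp_fst : Tendsto (fun p : SampleSpace => p.1) whp atTop := by
  rw [tendsto_atTop]
  intro b
  rw [Filter.Eventually, mem_whp]
  refine tendsto_const_nhds.congr' ?_
  filter_upwards [eventually_ge_atTop b] with N hN
  simp [hN]

theorem tendsto_const_div_atTop_ofReal (c : ℝ) :
    Tendsto (fun N : ℕ => ENNReal.ofReal (c * (N : ℝ)⁻¹)) atTop (𝓝 0) := by
  have h1 : Tendsto (fun N : ℕ => c * (N : ℝ)⁻¹) atTop (𝓝 0) := by
    simpa using (tendsto_inv_atTop_nhds_zero_nat (𝕜 := ℝ)).const_mul c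
  simpa using ENNReal.tendsto_ofReal h1

/-- By Cauchy–Schwarz, errors of vanishing normalized norm do not affect the limit. This carries
limits from the Gaussian approximations to the vectors of the iteration. -/
theorem tendsto_ip_whp {x y x' y' : ∀ p : SampleSpace, Fin p.1 → ℝ} {a b c : ℝ}
    (hx : Tendsto (fun p => nrm (x p - x' p)) whp (𝓝 0))
    (hy : Tendsto (fun p => nrm (y p - y' p)) whp (𝓝 0))
    (hx' : Tendsto (fun p => nrm (x' p)) whp (𝓝 a))
    (hy' : Tendsto (fun p => nrm (y' p)) whp (𝓝 b))
    (h : Tendsto (fun p => ip (x' p) (y' p)) whp (𝓝 c)) :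
    Tendsto (fun p => ip (x p) (y p)) whp (𝓝 c) := by
  have h1 : Tendsto (fun p => nrm (x p - x' p) * (nrm (y p - y' p) + nrm (y' p)) +
      nrm (x' p) * nrm (y p - y' p)) whp (𝓝 0) := by
    simpa using (hx.mul (hy.add hy')).add (hx'.mul hy)
  have h2 : Tendsto (fun p => ip (x p) (y p) - ip (x' p) (y' p)) whp (𝓝 0) := by
    refine squeeze_zero_norm (fun p => ?_) h1
    have e : ip (x p) (y p) - ip (x' p) (y' p) =
        ip (x p - x' p) (y p) + ip (x' p) (y p - y' p) := by
      rw [ip_sub_left, ip_sub_right]; ring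
    have e2 : nrm (y p) ≤ nrm (y p - y' p) + nrm (y' p) := by
      simpa using nrm_add_le (y p - y' p) (y' p)
    rw [Real.norm_eq_abs, e]
    refine (abs_add_le _ _).trans (add_le_add ((abs_ip_le _ _).trans ?_) (abs_ip_le _ _))
    exact mul_le_mul_of_nonneg_left e2 (nrm_nonneg _)
  simpa using h2.add h

/-! ### Law of large numbers -/

section lln

variable {N : ℕ}

/-- `∑_{m=1}^K a_m y_m`. -/
noncomputable def combo (a : ℕ → ℝ) (K : ℕ) (ω : BaseSpace N) : Fin N → ℝ := fun i =>
  ∑ m ∈ Finset.Icc 1 K, a m * yPart (noise m ω) i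

theorem isGaussPair_combo (a b : ℕ → ℝ) (K : ℕ) (i : Fin N) :
    IsGaussPair (baseMeasure N) (fun ω => combo a K ω i) (fun ω => combo b K ω i)
      (∑ m ∈ Finset.Icc 1 K, a m ^ 2) (∑ m ∈ Finset.Icc 1 K, a m * b m)
      (∑ m ∈ Finset.Icc 1 K, b m ^ 2) := by
  have hinj : Function.Injective fun m : Finset.Icc 1 K =>
      (((m : ℕ), Sum.inr (Sum.inl i)) : ℕ × StepIndex N) := fun m m' hm => by
    simpa using hm
  have h1 := IsGaussPair.of_iIndepFun (P := baseMeasure N)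
    (X := fun (m : Finset.Icc 1 K) (ω : BaseSpace N) => ω ((m : ℕ), Sum.inr (Sum.inl i)))
    (fun m => measurable_pi_apply _) (fun m => map_coord _) (iIndepFun_coord.precomp hinj)
    (fun m => a m) (fun m => b m)
  simp only [Finset.univ_eq_attach] at h1
  rw [Finset.sum_attach (Finset.Icc 1 K) fun m => a m ^ 2,
    Finset.sum_attach (Finset.Icc 1 K) fun m => a m * b m,
    Finset.sum_attach (Finset.Icc 1 K) fun m => b m ^ 2] at h1
  have e : ∀ (c : ℕ → ℝ) (ω : BaseSpace N), combo c K ω i =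
      ∑ m ∈ (Finset.Icc 1 K).attach, c m * ω ((m : ℕ), Sum.inr (Sum.inl i)) := fun c ω => by
    rw [Finset.sum_attach (Finset.Icc 1 K) fun m => c m * ω (m, Sum.inr (Sum.inl i))]
    rfl
  simpa only [e] using h1

theorem indepFun_combo (a b : ℕ → ℝ) (K : ℕ) {f : ℝ × ℝ → ℝ} (hf : Measurable f) {i j : Fin N}
    (hij : i ≠ j) : IndepFun (fun ω : BaseSpace N => f (combo a K ω i, combo b K ω i))
      (fun ω => f (combo a K ω j, combo b K ω j)) (baseMeasure N) := by
  classical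
  let S : Fin N → Finset (ℕ × StepIndex N) := fun i =>
    Finset.Icc 1 K ×ˢ {Sum.inr (Sum.inl i)}
  have hST : Disjoint (S i) (S j) := by
    rw [Finset.disjoint_left]
    rintro ⟨m, s⟩ h1 h2
    simp only [S, Finset.mem_product, Finset.mem_singleton] at h1 h2
    have := h1.2.symm.trans h2.2
    simp only [Sum.inr.injEq, Sum.inl.injEq] at this
    exact hij this
  have h1 := iIndepFun_coord.indepFun_finset (S i) (S j) hST fun p => measurable_pi_apply p
  have hmem : ∀ i, ∀ m ∈ Finset.Icc 1 K, ((m, Sum.inr (Sum.inl i)) : ℕ × StepIndex N) ∈ S i :=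
    fun i m hm => by simpa [S] using Finset.mem_Icc.1 hm
  let F : ∀ (i : Fin N) (c : ℕ → ℝ), (S i → ℝ) → ℝ := fun i c x =>
    ∑ m ∈ (Finset.Icc 1 K).attach, c m * x ⟨(m, Sum.inr (Sum.inl i)), hmem i m m.2⟩
  have hF : ∀ i c, Measurable (F i c) := fun i c =>
    Finset.measurable_sum _ fun m _ => (measurable_pi_apply _).const_mul _
  have hFe : ∀ i c (ω : BaseSpace N), combo c K ω i = F i c fun p => ω p := fun i c ω => by
    simp only [F]
    rw [Finset.sum_attach (Finset.Icc 1 K) fun m => c m * ω (m, Sum.inr (Sum.inl i))]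
    rfl
  have h2 := h1.comp (hf.comp ((hF i a).prodMk (hF i b))) (hf.comp ((hF j a).prodMk (hF j b)))
  simp only [hFe]
  exact h2

theorem memLp_two_of_quadratic {Ω : Type*} [MeasurableSpace Ω] {P : Measure Ω}
    [IsProbabilityMeasure P] {A B : Ω → ℝ} {u t v : ℝ} (hP : IsGaussPair P A B u t v)
    (hu : 0 ≤ u) (hv : 0 ≤ v) {f : ℝ × ℝ → ℝ} (hf : Measurable f) {C : ℝ}
    (hC : ∀ x y, |f (x, y)| ≤ C * (1 + x ^ 2 + y ^ 2)) :
    MemLp (fun ω => f (A ω, B ω)) 2 P := by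
  have h4 : ∀ {X : Ω → ℝ}, Measurable X → MemLp X 4 P → MemLp (fun ω => X ω ^ 2) 2 P := by
    intro X hXm hX
    have h1 : Integrable (fun ω => ‖X ω‖ ^ (4 : ℕ)) P := by
      exact_mod_cast hX.integrable_norm_pow (p := 4) (by norm_num)
    rw [memLp_two_iff_integrable_sq (hXm.pow_const 2).aestronglyMeasurable]
    refine h1.congr (Eventually.of_forall fun ω => ?_)
    simp only [Real.norm_eq_abs]
    rw [← pow_mul, Even.pow_abs (by decide)]
  have hA := h4 hP.meas_left (by exact_mod_cast hP.memLp_left hu 4)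
  have hB := h4 hP.meas_right (by exact_mod_cast hP.memLp_right hv 4)
  have hdom : MemLp (fun ω => C * (1 + A ω ^ 2 + B ω ^ 2)) 2 P :=
    (((memLp_const (1 : ℝ)).add hA).add hB).const_mul C
  refine hdom.mono (hf.comp (hP.meas_left.prodMk hP.meas_right)).aestronglyMeasurable
    (Eventually.of_forall fun ω => ?_)
  rw [Real.norm_eq_abs, Real.norm_eq_abs]
  exact (hC _ _).trans (le_abs_self _)

/-- Chebyshev for the coordinates, which are pairwise independent because they read disjoint noise.
Quadratic growth of `f` suffices, as Gaussian fourth moments are finite. -/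
theorem measure_abs_average_ge_le (a b : ℕ → ℝ) (K : ℕ) {Ω' : Type*} [MeasurableSpace Ω']
    {P' : Measure Ω'} [IsProbabilityMeasure P'] {A' B' : Ω' → ℝ}
    (hP' : IsGaussPair P' A' B' (∑ m ∈ Finset.Icc 1 K, a m ^ 2)
      (∑ m ∈ Finset.Icc 1 K, a m * b m) (∑ m ∈ Finset.Icc 1 K, b m ^ 2))
    {f : ℝ × ℝ → ℝ} (hf : Measurable f) {C : ℝ}
    (hC : ∀ x y, |f (x, y)| ≤ C * (1 + x ^ 2 + y ^ 2)) (hN : 0 < N) {ε : ℝ} (hε : 0 < ε) :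
    baseMeasure N {ω | ε ≤ |(N : ℝ)⁻¹ * ∑ i, f (combo a K ω i, combo b K ω i) -
        ∫ ω', f (A' ω', B' ω') ∂P'|} ≤
      ENNReal.ofReal ((∫ ω', f (A' ω', B' ω') ^ 2 ∂P') / ε ^ 2 * (N : ℝ)⁻¹) := by
  have hu : 0 ≤ ∑ m ∈ Finset.Icc 1 K, a m ^ 2 := Finset.sum_nonneg fun _ _ => sq_nonneg _
  have hv : 0 ≤ ∑ m ∈ Finset.Icc 1 K, b m ^ 2 := Finset.sum_nonneg fun _ _ => sq_nonneg _
  set Y : Fin N → BaseSpace N → ℝ := fun i ω => f (combo a K ω i, combo b K ω i)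
  have hYL : ∀ i, MemLp (Y i) 2 (baseMeasure N) := fun i =>
    memLp_two_of_quadratic (isGaussPair_combo a b K i) hu hv hf hC
  have hYi : ∀ i, Integrable (Y i) (baseMeasure N) := fun i => (hYL i).integrable one_le_two
  have hYE : ∀ i, ∫ ω, Y i ω ∂(baseMeasure N) = ∫ ω', f (A' ω', B' ω') ∂P' := fun i =>
    (isGaussPair_combo a b K i).integral_eq hP' hf
  have hYV : ∀ i, variance (Y i) (baseMeasure N) ≤ ∫ ω', f (A' ω', B' ω') ^ 2 ∂P' := fun i => by
    refine (variance_le_expectation_sq (hYL i).aestronglyMeasurable).trans (le_of_eq ?_)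
    exact (isGaussPair_combo a b K i).integral_eq hP' (hf.pow_const 2)
  have hN' : (0 : ℝ) < N := by exact_mod_cast hN
  have hSL : MemLp (∑ i, Y i) 2 (baseMeasure N) := memLp_finsetSum' _ fun i _ => hYL i
  have hSV : variance (∑ i, Y i) (baseMeasure N) ≤ N * ∫ ω', f (A' ω', B' ω') ^ 2 ∂P' := by
    rw [IndepFun.variance_sum (fun i _ => hYL i) fun i _ j _ hij => indepFun_combo a b K hf hij]
    refine (Finset.sum_le_sum fun i _ => hYV i).trans (le_of_eq ?_)
    simp
  have hSE : ∫ ω, (∑ i, Y i) ω ∂(baseMeasure N) = N * ∫ ω', f (A' ω', B' ω') ∂P' := by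
    simp only [Finset.sum_apply]
    rw [integral_finsetSum _ fun i _ => hYi i]
    simp [hYE]
  have h1 := meas_ge_le_variance_div_sq hSL (c := ε * N) (by positivity)
  rw [hSE] at h1
  refine le_trans (measure_mono fun ω hω => ?_) (h1.trans (ENNReal.ofReal_le_ofReal ?_))
  · simp only [Set.mem_ofPred_eq] at hω ⊢
    have e : (∑ i, Y i) ω - N * ∫ ω', f (A' ω', B' ω') ∂P' =
        ((N : ℝ)⁻¹ * ∑ i, f (combo a K ω i, combo b K ω i) - ∫ ω', f (A' ω', B' ω') ∂P') * N := by
      rw [Finset.sum_apply]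
      field_simp
      rfl
    rw [e, abs_mul, Nat.abs_cast]
    exact mul_le_mul_of_nonneg_right hω hN'.le
  · rw [mul_pow, div_le_iff₀ (by positivity)]
    refine hSV.trans (le_of_eq ?_)
    field_simp

theorem tendsto_average (a b : ℕ → ℝ) (K : ℕ) {Ω' : Type*} [MeasurableSpace Ω']
    {P' : Measure Ω'} [IsProbabilityMeasure P'] {A' B' : Ω' → ℝ}
    (hP' : IsGaussPair P' A' B' (∑ m ∈ Finset.Icc 1 K, a m ^ 2)
      (∑ m ∈ Finset.Icc 1 K, a m * b m) (∑ m ∈ Finset.Icc 1 K, b m ^ 2))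
    {f : ℝ × ℝ → ℝ} (hf : Measurable f) {C : ℝ}
    (hC : ∀ x y, |f (x, y)| ≤ C * (1 + x ^ 2 + y ^ 2)) :
    Tendsto (fun p : SampleSpace =>
      (p.1 : ℝ)⁻¹ * ∑ i, f (combo a K p.2 i, combo b K p.2 i)) whp
      (𝓝 (∫ ω', f (A' ω', B' ω') ∂P')) :=
  tendsto_whp_of_le (b := fun ε N => ENNReal.ofReal
      ((∫ ω', f (A' ω', B' ω') ^ 2 ∂P') / ε ^ 2 * (N : ℝ)⁻¹))
    (fun _ _ => tendsto_const_div_atTop_ofReal _)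
    fun _ hε _ hN => measure_abs_average_ge_le a b K hP' hf hC hN hε

end lln

/-! ### The effective fields -/

/-- The coefficient of `ζ^{(s)}` in `(h^{(k+1)} - h 1) / β`. -/
noncomputable def fieldCoeff (β h : ℝ) (k s : ℕ) : ℝ :=
  if s < k then gamma β h s else if s = k then √(overlap β h - GammaSq β h (k - 1)) else 0

theorem fieldCoeff_of_lt {β h : ℝ} {k s : ℕ} (hs : s < k) : fieldCoeff β h k s = gamma β h s :=
  if_pos hs

theorem fieldCoeff_self (β h : ℝ) (k : ℕ) :
    fieldCoeff β h k k = √(overlap β h - GammaSq β h (k - 1)) := by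
  rw [fieldCoeff, if_neg (lt_irrefl k), if_pos rfl]

theorem fieldCoeff_of_gt {β h : ℝ} {k s : ℕ} (hs : k < s) : fieldCoeff β h k s = 0 := by
  rw [fieldCoeff, if_neg (by omega), if_neg (by omega)]

theorem sum_fieldCoeff_mul (β h : ℝ) {k K : ℕ} (hk : 1 ≤ k) (hK : k ≤ K) (f : ℕ → ℝ) :
    ∑ s ∈ Finset.Icc 1 K, fieldCoeff β h k s * f s =
      ∑ s ∈ Finset.Icc 1 (k - 1), gamma β h s * f s +
        √(overlap β h - GammaSq β h (k - 1)) * f k := by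
  obtain ⟨l, rfl⟩ : ∃ l, k = l + 1 := ⟨k - 1, by omega⟩
  have h1 : ∑ s ∈ Finset.Icc 1 (l + 1), fieldCoeff β h (l + 1) s * f s =
      ∑ s ∈ Finset.Icc 1 K, fieldCoeff β h (l + 1) s * f s := by
    refine Finset.sum_subset (Finset.Icc_subset_Icc_right hK) fun s hs hs' => ?_
    rw [Finset.mem_Icc] at hs hs'
    rw [fieldCoeff_of_gt (by omega), zero_mul]
  rw [← h1, Finset.sum_Icc_succ_top (by omega), fieldCoeff_self]
  congr 1
  refine Finset.sum_congr rfl fun s hs => ?_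
  have := Finset.mem_Icc.1 hs
  rw [fieldCoeff_of_lt (by omega)]

theorem nextField_eq (β h : ℝ) {N : ℕ} (a : ℕ → Pair N) {k K : ℕ} (hk : 1 ≤ k) (hK : k ≤ K)
    (i : Fin N) : nextField β h a k i =
      h + β * ∑ s ∈ Finset.Icc 1 K, fieldCoeff β h k s * zeta (a s) i := by
  rw [sum_fieldCoeff_mul β h hk hK fun s => zeta (a s) i, nextField]
  ring

section sums

variable {β h : ℝ} (hβ : 0 < β) (hβ1 : β < 1) (hh : 0 < h)

include hβ hβ1 hh

/-- The last coefficient completes `Γ_{k-1}²` to `q`, so all effective fields have the same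
asymptotic variance `β² q`. -/
theorem sum_fieldCoeff_sq {k K : ℕ} (hk : 1 ≤ k) (hK : k ≤ K) :
    ∑ s ∈ Finset.Icc 1 K, fieldCoeff β h k s ^ 2 = overlap β h := by
  have h1 : ∀ s ∈ Finset.Icc 1 (k - 1), gamma β h s * fieldCoeff β h k s = gamma β h s ^ 2 := by
    intro s hs
    have := Finset.mem_Icc.1 hs
    rw [fieldCoeff_of_lt (by omega), sq]
  simp only [sq (fieldCoeff β h k _)]
  rw [sum_fieldCoeff_mul β h hk hK, fieldCoeff_self, Finset.sum_congr rfl h1,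
    Real.mul_self_sqrt (sub_nonneg.2 (GammaSq_lt_overlap hβ hβ1 hh _).le), ← GammaSq]
  ring

/-- The covariance is `Γ_{j-1}² + γ_j √(q - Γ_{j-1}²)`, and `γ_j` is defined precisely so that this
equals `ρ_j`, whatever the later index `k`. -/
theorem sum_fieldCoeff_mul_fieldCoeff {j k K : ℕ} (hj : 1 ≤ j) (hjk : j < k) (hK : j ≤ K) :
    ∑ s ∈ Finset.Icc 1 K, fieldCoeff β h j s * fieldCoeff β h k s = rho β h j := by
  obtain ⟨l, rfl⟩ : ∃ l, j = l + 1 := ⟨j - 1, by omega⟩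
  have h1 : ∀ s ∈ Finset.Icc 1 l, gamma β h s * fieldCoeff β h k s = gamma β h s ^ 2 := by
    intro s hs
    have := Finset.mem_Icc.1 hs
    rw [fieldCoeff_of_lt (by omega), sq]
  rw [sum_fieldCoeff_mul β h hj hK, fieldCoeff_of_lt hjk, Nat.add_sub_cancel,
    Finset.sum_congr rfl h1, ← GammaSq, mul_comm, gamma_mul_sqrt hβ hβ1 hh]
  ring

theorem abs_fieldCoeff_le {k m : ℕ} (hk : 1 ≤ k) (hm : 1 ≤ m) (hmk : m ≤ k) :
    fieldCoeff β h k m ^ 2 ≤ overlap β h := by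
  rw [← sum_fieldCoeff_sq hβ hβ1 hh hk le_rfl]
  exact Finset.single_le_sum (f := fun s => fieldCoeff β h k s ^ 2) (fun _ _ => sq_nonneg _)
    (Finset.mem_Icc.2 ⟨hm, hmk⟩)

end sums

/-! ### Gaussian integrals of one- and two-dimensional marginals -/

theorem isGaussPair_fst_snd :
    IsGaussPair (stdGauss.prod stdGauss) Prod.fst Prod.snd 1 0 1 where
  meas_left := measurable_fst
  meas_right := measurable_snd
  char_eq := fun a b => by
    have e : ∀ z : ℝ × ℝ, Complex.exp ((a * z.1 + b * z.2 : ℝ) * Complex.I) =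
        Complex.exp ((a * z.1 : ℝ) * Complex.I) * Complex.exp ((b * z.2 : ℝ) * Complex.I) :=
      fun z => by
        rw [← Complex.exp_add]
        congr 1
        push_cast
        ring
    simp only [e]
    rw [integral_prod_mul (f := fun x : ℝ => Complex.exp ((a * x : ℝ) * Complex.I))
      (g := fun x : ℝ => Complex.exp ((b * x : ℝ) * Complex.I)), integral_exp_stdGauss,
      integral_exp_stdGauss, ← Complex.exp_add, ← Complex.ofReal_add]
    congr 2
    ring

theorem isGaussPair_of_cov {q t : ℝ} (hq : 0 < q) (ht : t ^ 2 ≤ q) :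
    IsGaussPair (stdGauss.prod stdGauss) (fun z => √q * z.1)
      (fun z => t / √q * z.1 + √(1 - t ^ 2 / q) * z.2) q t 1 := by
  have h1 := isGaussPair_fst_snd.comb (√q) 0 (t / √q) (√(1 - t ^ 2 / q))
  have hs : √q ^ 2 = q := Real.sq_sqrt hq.le
  have hs0 : √q ≠ 0 := (Real.sqrt_pos.2 hq).ne'
  have hc : √(1 - t ^ 2 / q) ^ 2 = 1 - t ^ 2 / q :=
    Real.sq_sqrt (sub_nonneg.2 ((div_le_one hq).2 ht))
  have e1 : √q ^ 2 * 1 + 2 * √q * 0 * 0 + 0 ^ 2 * 1 = q := by rw [hs]; ring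
  have e2 : √q * (t / √q) * 1 + (√q * √(1 - t ^ 2 / q) + 0 * (t / √q)) * 0 +
      0 * √(1 - t ^ 2 / q) * 1 = t := by field_simp; ring
  have e3 : (t / √q) ^ 2 * 1 + 2 * (t / √q) * √(1 - t ^ 2 / q) * 0 +
      √(1 - t ^ 2 / q) ^ 2 * 1 = 1 := by rw [hc, div_pow, hs]; ring
  rw [e1, e2, e3] at h1
  simpa using h1

/-- Split `B` into its regression on `A` and an independent centered part. The latter contributes
nothing, and Gaussian integration by parts gives `β t E (1 - tanh²)`, with `E tanh² = q`. -/
theorem integral_Th_mul {β h t : ℝ} (hh : 0 < h) {Ω : Type*} [MeasurableSpace Ω]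
    {P : Measure Ω} [IsProbabilityMeasure P] {A B : Ω → ℝ}
    (hP : IsGaussPair P A B (overlap β h) t 1)
    (ht : t ^ 2 ≤ overlap β h) :
    ∫ ω, Th β h (A ω) * B ω ∂P = β * t * (1 - overlap β h) := by
  have hq := overlap_pos (β := β) hh
  have hs0 : √(overlap β h) ≠ 0 := (Real.sqrt_pos.2 hq).ne'
  rw [hP.integral_eq (isGaussPair_of_cov hq ht) (f := fun z => Th β h z.1 * z.2)
    (((measurable_Th β h).comp measurable_fst).mul measurable_snd)]
  set q := overlap β h
  set f : ℝ → ℝ := fun x => Real.tanh (h + β * √q * x) with hf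
  have hfm : Measurable f := continuous_tanh.measurable.comp (by fun_prop)
  have hfb : ∀ x, |f x| ≤ 1 := fun x => abs_tanh_le_one _
  have hfi : Integrable f stdGauss := integrable_of_bounded hfm.aestronglyMeasurable hfb
  have hid : Integrable (fun x : ℝ => x) stdGauss :=
    (integrable_abs_stdGauss.mono' aestronglyMeasurable_id (Eventually.of_forall fun x => le_rfl))
  have hxf : Integrable (fun x => x * f x) stdGauss := by
    refine integrable_abs_stdGauss.mono' (measurable_id.mul hfm).aestronglyMeasurable
      (Eventually.of_forall fun x => ?_)
    rw [Real.norm_eq_abs, abs_mul]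
    exact mul_le_of_le_one_right (abs_nonneg x) (hfb x)
  have e : ∀ z : ℝ × ℝ, Th β h (√q * z.1) * (t / √q * z.1 + √(1 - t ^ 2 / q) * z.2) =
      t / √q * (z.1 * f z.1) * 1 + √(1 - t ^ 2 / q) * f z.1 * z.2 := fun z => by
    simp only [Th, hf, ← mul_assoc]
    ring
  have hI1 : Integrable (fun z : ℝ × ℝ => t / √q * (z.1 * f z.1) * 1)
      (stdGauss.prod stdGauss) :=
    Integrable.mul_prod (f := fun x => t / √q * (x * f x)) (g := fun _ : ℝ => (1 : ℝ))
      (hxf.const_mul _) (integrable_const _)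
  have hI2 : Integrable (fun z : ℝ × ℝ => √(1 - t ^ 2 / q) * f z.1 * z.2)
      (stdGauss.prod stdGauss) :=
    Integrable.mul_prod (f := fun x => √(1 - t ^ 2 / q) * f x) (g := fun x : ℝ => x)
      (hfi.const_mul _) hid
  simp only [e]
  rw [integral_add hI1 hI2,
    integral_prod_mul (f := fun x => t / √q * (x * f x)) (g := fun _ : ℝ => (1 : ℝ)),
    integral_prod_mul (f := fun x => √(1 - t ^ 2 / q) * f x) (g := fun x : ℝ => x),
    integral_id_gaussianReal, mul_zero, add_zero, integral_const_mul, integral_id_mul_tanh,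
    integral_sub (integrable_const _)
      (integrable_of_bounded (hfm.pow_const 2).aestronglyMeasurable (C := 1) fun x => by
        rw [abs_of_nonneg (sq_nonneg _)]; exact tanh_sq_le_one _)]
  have : ∫ x, Real.tanh (h + β * √q * x) ^ 2 ∂stdGauss = q := (overlap_spec β h).2.symm
  rw [this]
  simp only [integral_const, probReal_univ, smul_eq_mul, mul_one]
  field_simp

/-! ### Vectors -/

section vectors

variable {N : ℕ}

theorem nrm_le_of_abs_le {x y : Fin N → ℝ} {c : ℝ} (hc : 0 ≤ c) (h : ∀ i, |x i| ≤ c * |y i|) :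
    nrm x ≤ c * nrm y := by
  have h1 : ip x x ≤ c ^ 2 * ip y y := by
    simp only [ip]
    rw [mul_left_comm, Finset.mul_sum _ _ (c ^ 2)]
    refine mul_le_mul_of_nonneg_left (Finset.sum_le_sum fun i _ => ?_)
      (inv_nonneg.2 (Nat.cast_nonneg N))
    rw [← abs_mul_abs_self, ← abs_mul_abs_self (y i)]
    calc |x i| * |x i| ≤ (c * |y i|) * (c * |y i|) := by gcongr <;> exact h i
      _ = _ := by ring
  rw [nrm, nrm, ← Real.sqrt_sq hc, ← Real.sqrt_mul (sq_nonneg c)]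
  exact Real.sqrt_le_sqrt h1

theorem nrm_le_one_of_abs_le {x : Fin N → ℝ} (h : ∀ i, |x i| ≤ 1) : nrm x ≤ 1 := by
  have h1 : nrm x ≤ 1 * nrm (1 : Fin N → ℝ) := nrm_le_of_abs_le zero_le_one fun i => by
    simpa using h i
  refine h1.trans ?_
  rw [one_mul, nrm, Real.sqrt_le_one, ip]
  rcases Nat.eq_zero_or_pos N with rfl | hN
  · simp
  · have : (N : ℝ) ≠ 0 := by positivity
    simp [this]

theorem average_abs_sub_le (x y : Fin N → ℝ) :
    (N : ℝ)⁻¹ * ∑ i, |x i - y i| ≤ nrm (x - y) := by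
  have h1 := abs_ip_le (fun i => |x i - y i|) 1
  have h2 : nrm (fun i => |x i - y i|) ≤ 1 * nrm (x - y) :=
    nrm_le_of_abs_le zero_le_one fun i => by simp
  have h3 : nrm (1 : Fin N → ℝ) ≤ 1 := nrm_le_one_of_abs_le fun i => by simp
  have h4 : ip (fun i => |x i - y i|) 1 = (N : ℝ)⁻¹ * ∑ i, |x i - y i| := by simp [ip]
  rw [h4] at h1
  refine ((le_abs_self _).trans h1).trans ?_
  rw [one_mul] at h2
  calc _ ≤ nrm (x - y) * 1 := mul_le_mul h2 h3 (nrm_nonneg _) (nrm_nonneg _)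
    _ = _ := mul_one _

theorem nextResidual_eq_mulVec (β h : ℝ) (g : Matrix (Fin N) (Fin N) ℝ) (k : ℕ) :
    nextResidual β h (iter β h g) k = Qmat β h g k *ᵥ nextMag β h (iter β h g) k := by
  rw [Qmat, coproj_mulVec, nextResidual]
  simp only [ip_comm (nextMag β h (iter β h g) k)]
  rfl

theorem ip_nextResidual_self (β h : ℝ) (g : Matrix (Fin N) (Fin N) ℝ) (k : ℕ) :
    ip (nextResidual β h (iter β h g) k) (nextResidual β h (iter β h g) k) =
      ip (nextMag β h (iter β h g) k) (nextMag β h (iter β h g) k) -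
        ∑ s ∈ Finset.Icc 1 k, ip (nextMag β h (iter β h g) k) (phi β h g s) ^ 2 := by
  rw [nextResidual_eq_mulVec, ip_Qmat_mulVec_self]

theorem ip_phi_succ (β h : ℝ) (g : Matrix (Fin N) (Fin N) ℝ) {k : ℕ} (hk : 1 ≤ k)
    (x : Fin N → ℝ) :
    ip x (phi β h g (k + 1)) = (nrm (nextResidual β h (iter β h g) k))⁻¹ *
      (ip x (nextMag β h (iter β h g) k) - ∑ s ∈ Finset.Icc 1 k,
        ip (nextMag β h (iter β h g) k) (phi β h g s) * ip x (phi β h g s)) := by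
  rw [phi_succ β h g hk, ip_smul_right, nextResidual, ip_sub_right, ip_sum_right]
  simp only [ip_smul_right]
  rfl

theorem nrm_phi_le_one (β h : ℝ) (g : Matrix (Fin N) (Fin N) ℝ) {s : ℕ} (hs : 1 ≤ s) :
    nrm (phi β h g s) ≤ 1 := by
  rcases (orthoFamily_phi β h g s).2 s (Finset.mem_Icc.2 ⟨hs, le_rfl⟩) with h1 | h1
  · rw [h1, nrm_zero]; exact zero_le_one
  · rw [nrm, h1, Real.sqrt_one]

theorem nextMag_le_one (β h : ℝ) (a : ℕ → Pair N) (k : ℕ) : nrm (nextMag β h a k) ≤ 1 :=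
  nrm_le_one_of_abs_le fun _ => abs_tanh_le_one _

theorem ip_phi_xi_explored {β h : ℝ} {ω : BaseSpace N} {K j : ℕ} (hK : j + 1 ≤ K)
    (hu : ip (phi β h (explored β h K ω) (j + 1)) (phi β h (explored β h K ω) (j + 1)) = 1) :
    ip (phi β h (explored β h K ω) (j + 1)) (xi (iter β h (explored β h K ω) (j + 1))) =
      (√2)⁻¹ * (ip (phi β h (explored β h K ω) (j + 1)) (yPart (noise (j + 1) ω)) +
        ip (phi β h (explored β h K ω) (j + 1)) (yPart' (noise (j + 1) ω))) := by
  have := ip_mulVec (Qmat β h (explored β h K ω) j) (phi β h (explored β h K ω) (j + 1))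
    (xPart (noise (j + 1) ω))
  rw [Qmat_transpose, Qmat_mulVec_phi_succ] at this
  rw [xi_explored_of_unit hK hu, ← this, xPart, ip_smul_right, ip_add_right]

end vectors

/-! ### State evolution -/

section stateEvolution

/-- The matrix explored in `K` steps, as a random variable on the disjoint union of the base
spaces. -/
noncomputable abbrev matrixAt (β h : ℝ) (K : ℕ) (p : SampleSpace) :
    Matrix (Fin p.1) (Fin p.1) ℝ := explored β h K p.2

/-- The direction `φ^{(m)}` is a unit vector and `ζ^{(m)}` is close to the fresh Gaussian vector
`y_m`, with high probability. -/
def Controlled (β h : ℝ) (K m : ℕ) : Prop :=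
  (∀ᶠ p in whp, ip (phi β h (matrixAt β h K p) m) (phi β h (matrixAt β h K p) m) = 1) ∧
    Tendsto (fun p => nrm (zeta (iter β h (matrixAt β h K p) m) - yPart (noise m p.2))) whp (𝓝 0)

variable {β h : ℝ} {K : ℕ}

theorem tendsto_ip_yPart {s j : ℕ} (hs : 1 ≤ s) (hsj : s ≤ j + 1) (hj : j ≤ K) :
    Tendsto (fun p => ip (phi β h (matrixAt β h K p) s) (yPart (noise (j + 1) p.2))) whp (𝓝 0) := by
  refine tendsto_whp_of_le (b := fun ε N => ENNReal.ofReal ((ε ^ 2)⁻¹ * (N : ℝ)⁻¹))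
    (fun _ _ => tendsto_const_div_atTop_ofReal _) fun ε hε N hN => ?_
  simp only [sub_zero, phi_explored β h _ hs hsj hj]
  rw [mul_comm, ← div_eq_mul_inv]
  exact measure_abs_ip_explored_ge_le hN β h hε (Or.inl rfl)

theorem tendsto_ip_yPart' {s j : ℕ} (hs : 1 ≤ s) (hsj : s ≤ j + 1) (hj : j ≤ K) :
    Tendsto (fun p => ip (phi β h (matrixAt β h K p) s) (yPart' (noise (j + 1) p.2))) whp (𝓝 0) := by
  refine tendsto_whp_of_le (b := fun ε N => ENNReal.ofReal ((ε ^ 2)⁻¹ * (N : ℝ)⁻¹))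
    (fun _ _ => tendsto_const_div_atTop_ofReal _) fun ε hε N hN => ?_
  simp only [sub_zero, phi_explored β h _ hs hsj hj]
  rw [mul_comm, ← div_eq_mul_inv]
  exact measure_abs_ip_explored_ge_le hN β h hε (Or.inr rfl)

theorem tendsto_ip_phi_xi {m : ℕ} (hm : 1 ≤ m) (hK : m ≤ K) (hc : Controlled β h K m) :
    Tendsto (fun p => ip (phi β h (matrixAt β h K p) m) (xi (iter β h (matrixAt β h K p) m))) whp
      (𝓝 0) := by
  obtain ⟨j, rfl⟩ : ∃ j, m = j + 1 := ⟨m - 1, by omega⟩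
  have h1 := ((tendsto_ip_yPart (β := β) (h := h) hm le_rfl (show j ≤ K by omega)).add
    (tendsto_ip_yPart' (β := β) (h := h) hm le_rfl (show j ≤ K by omega))).const_mul (√2)⁻¹
  rw [add_zero, mul_zero] at h1
  refine h1.congr' ?_
  filter_upwards [hc.1] with p hp
  exact (ip_phi_xi_explored hK hp).symm

/-- By the explicit formula, `ζ^{(j+1)} - y_{j+1}` is a combination of `j + 1` vectors of norm at
most one, with coefficients that are inner products of known directions with fresh noise. -/
theorem tendsto_nrm_zeta_sub {j : ℕ} (hK : j + 1 ≤ K)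
    (hu : ∀ᶠ p in whp, ip (phi β h (matrixAt β h K p) (j + 1))
      (phi β h (matrixAt β h K p) (j + 1)) = 1) : Controlled β h K (j + 1) := by
  refine ⟨hu, ?_⟩
  have h1 : Tendsto (fun p : SampleSpace =>
      ∑ s ∈ Finset.Icc 1 j, |ip (phi β h (matrixAt β h K p) s) (yPart (noise (j + 1) p.2))| +
      |ip (phi β h (matrixAt β h K p) (j + 1)) (yPart' (noise (j + 1) p.2))|) whp (𝓝 0) := by
    have h2 : Tendsto (fun p : SampleSpace => ∑ s ∈ Finset.Icc 1 j,
        |ip (phi β h (matrixAt β h K p) s) (yPart (noise (j + 1) p.2))|) whp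
        (𝓝 (∑ s ∈ Finset.Icc 1 j, |(0 : ℝ)|)) := tendsto_finsetSum _ fun s hs => by
      have := Finset.mem_Icc.1 hs
      exact (tendsto_ip_yPart this.1 (by omega) (by omega)).abs
    simpa using h2.add (tendsto_ip_yPart' (β := β) (h := h) (s := j + 1) (by omega) le_rfl
      (show j ≤ K by omega)).abs
  refine squeeze_zero' (Eventually.of_forall fun p => nrm_nonneg _) ?_ h1
  filter_upwards [hu] with p hp
  rw [zeta_explored_of_unit hK hp, add_sub_right_comm, sub_right_comm, sub_self, zero_sub]
  refine (nrm_add_le _ _).trans (add_le_add ?_ ?_)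
  · rw [← neg_one_smul ℝ, nrm_smul, abs_neg, abs_one, one_mul]
    refine (nrm_sum_le _ _).trans (Finset.sum_le_sum fun s hs => ?_)
    rw [nrm_smul]
    exact mul_le_of_le_one_right (abs_nonneg _) (nrm_phi_le_one β h _ (Finset.mem_Icc.1 hs).1)
  · rw [nrm_smul]
    exact mul_le_of_le_one_right (abs_nonneg _) (nrm_phi_le_one β h _ (by omega))

/-! ### Gaussian approximation of combinations of the vectors `ζ`. -/

theorem sum_single_mul (m : ℕ) (f : ℕ → ℝ) (hm : m ∈ Finset.Icc 1 K) :
    ∑ s ∈ Finset.Icc 1 K, (Pi.single m 1 : ℕ → ℝ) s * f s = f m := by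
  rw [Finset.sum_eq_single m]
  · simp
  · intro s _ hs
    simp [Pi.single_eq_of_ne hs]
  · exact fun h => absurd hm h

theorem combo_single {m : ℕ} (hm : m ∈ Finset.Icc 1 K) {N : ℕ} (ω : BaseSpace N) :
    combo (Pi.single m 1) K ω = yPart (noise m ω) :=
  funext fun i => sum_single_mul m (fun s => yPart (noise s ω) i) hm

theorem tendsto_average' (a b : ℕ → ℝ) {u t v : ℝ}
    (hu : ∑ m ∈ Finset.Icc 1 K, a m ^ 2 = u) (ht : ∑ m ∈ Finset.Icc 1 K, a m * b m = t)
    (hv : ∑ m ∈ Finset.Icc 1 K, b m ^ 2 = v) {Ω' : Type*} [MeasurableSpace Ω']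
    {P' : Measure Ω'} [IsProbabilityMeasure P'] {A' B' : Ω' → ℝ}
    (hP' : IsGaussPair P' A' B' u t v) {f : ℝ × ℝ → ℝ} (hf : Measurable f) {C : ℝ}
    (hC : ∀ x y, |f (x, y)| ≤ C * (1 + x ^ 2 + y ^ 2)) :
    Tendsto (fun p : SampleSpace =>
      (p.1 : ℝ)⁻¹ * ∑ i, f (combo a K p.2 i, combo b K p.2 i)) whp
      (𝓝 (∫ ω', f (A' ω', B' ω') ∂P')) := by
  subst hu ht hv
  exact tendsto_average a b K hP' hf hC

/-- `∑_s a_s ζ^{(s)}`. -/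
noncomputable def zetaCombo (β h : ℝ) (a : ℕ → ℝ) (K : ℕ) (p : SampleSpace) : Fin p.1 → ℝ :=
  fun i => ∑ s ∈ Finset.Icc 1 K, a s * zeta (iter β h (matrixAt β h K p) s) i

theorem tendsto_nrm_zetaCombo_sub (a : ℕ → ℝ)
    (hc : ∀ m, 1 ≤ m → m ≤ K → Controlled β h K m ∨ a m = 0) :
    Tendsto (fun p => nrm (zetaCombo β h a K p - combo a K p.2)) whp (𝓝 0) := by
  have h1 : Tendsto (fun p : SampleSpace => ∑ s ∈ Finset.Icc 1 K,
      |a s| * nrm (zeta (iter β h (matrixAt β h K p) s) - yPart (noise s p.2))) whp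
      (𝓝 (∑ s ∈ Finset.Icc 1 K, (0 : ℝ))) := tendsto_finsetSum _ fun s hs => by
    have := Finset.mem_Icc.1 hs
    rcases hc s this.1 this.2 with h2 | h2
    · simpa using h2.2.const_mul |a s|
    · simp only [h2, abs_zero, zero_mul]
      exact tendsto_const_nhds
  rw [Finset.sum_const_zero] at h1
  refine squeeze_zero (fun p => nrm_nonneg _) (fun p => ?_) h1
  have e : zetaCombo β h a K p - combo a K p.2 = ∑ s ∈ Finset.Icc 1 K,
      a s • (zeta (iter β h (matrixAt β h K p) s) - yPart (noise s p.2)) := by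
    funext i
    simp only [zetaCombo, combo, Pi.sub_apply, Finset.sum_apply, Pi.smul_apply, smul_eq_mul]
    rw [← Finset.sum_sub_distrib]
    exact Finset.sum_congr rfl fun s _ => by ring
  rw [e]
  refine (nrm_sum_le _ _).trans (le_of_eq (Finset.sum_congr rfl fun s _ => nrm_smul _ _))

theorem tendsto_nrm_yPart {m : ℕ} (hm : m ∈ Finset.Icc 1 K) :
    Tendsto (fun p : SampleSpace => nrm (yPart (noise m p.2))) whp (𝓝 1) := by
  have hs := sum_single_mul m (Pi.single m 1 : ℕ → ℝ) hm
  rw [Pi.single_eq_same] at hs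
  have h1 := tendsto_average' (K := K) (Pi.single m 1) (Pi.single m 1)
    (by simpa only [sq] using hs) hs (by simpa only [sq] using hs)
    (IsGaussPair.scaled zero_le_one) (f := fun z => z.1 * z.1)
    (measurable_fst.mul measurable_fst) (C := 1) fun x y => by
      rw [abs_mul_self]; nlinarith [sq_nonneg x, sq_nonneg y]
  simp only [combo_single hm] at h1
  have h2 : ∫ x, √1 * x * (√1 * x) ∂stdGauss = 1 := by
    simp only [Real.sqrt_one, one_mul, ← sq]
    exact integral_sq_stdGauss
  rw [h2] at h1
  have h3 := h1.sqrt
  rw [Real.sqrt_one] at h3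
  exact h3

/-- Distinct steps use independent noise. The resulting asymptotic orthonormality feeds the
sub-Gaussian bound of the Laplace method. -/
theorem tendsto_ip_zeta {m n : ℕ} (hm : m ∈ Finset.Icc 1 K) (hn : n ∈ Finset.Icc 1 K)
    (hcm : Controlled β h K m) (hcn : Controlled β h K n) :
    Tendsto (fun p => ip (zeta (iter β h (matrixAt β h K p) m))
      (zeta (iter β h (matrixAt β h K p) n))) whp (𝓝 (if m = n then 1 else 0)) := by
  refine tendsto_ip_whp hcm.2 hcn.2 (tendsto_nrm_yPart hm) (tendsto_nrm_yPart hn) ?_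
  have hs : ∀ {n}, n ∈ Finset.Icc 1 K → ∑ s ∈ Finset.Icc 1 K, (Pi.single n 1 : ℕ → ℝ) s ^ 2 = 1 := by
    intro n hn
    simpa [sq] using sum_single_mul n (Pi.single n 1 : ℕ → ℝ) hn
  have ht := sum_single_mul m (Pi.single n 1 : ℕ → ℝ) hm
  rw [Pi.single_apply] at ht
  have hcov : (if m = n then (1 : ℝ) else 0) ^ 2 ≤ 1 := by split_ifs <;> norm_num
  have h1 := tendsto_average' (K := K) (Pi.single m 1) (Pi.single n 1) (hs hm) ht (hs hn)
    (isGaussPair_of_cov one_pos hcov) (f := fun z => z.1 * z.2)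
    (measurable_fst.mul measurable_snd) (C := 1) fun x y => by
      rw [abs_le]; constructor <;> nlinarith [sq_nonneg (x + y), sq_nonneg (x - y)]
  simp only [combo_single hm, combo_single hn] at h1
  set t : ℝ := if m = n then 1 else 0
  have e : ∀ z : ℝ × ℝ, √1 * z.1 * (t / √1 * z.1 + √(1 - t ^ 2 / 1) * z.2) =
      t * z.1 ^ 2 * 1 + √(1 - t ^ 2) * (z.1 * z.2) := fun z => by
    simp only [Real.sqrt_one, div_one]; ring
  have hid : Integrable (fun x : ℝ => x) stdGauss :=
    (integrable_abs_stdGauss.mono' aestronglyMeasurable_id (Eventually.of_forall fun x => le_rfl))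
  have hI1 : Integrable (fun z : ℝ × ℝ => t * z.1 ^ 2 * 1) (stdGauss.prod stdGauss) :=
    Integrable.mul_prod (f := fun x : ℝ => t * x ^ 2) (g := fun _ : ℝ => (1 : ℝ))
      (integrable_sq_stdGauss.const_mul _) (integrable_const _)
  have hI2 : Integrable (fun z : ℝ × ℝ => √(1 - t ^ 2) * (z.1 * z.2)) (stdGauss.prod stdGauss) :=
    (Integrable.mul_prod (f := fun x : ℝ => x) (g := fun x : ℝ => x) hid hid).const_mul _
  have e2 : ∫ z : ℝ × ℝ, √1 * z.1 * (t / √1 * z.1 + √(1 - t ^ 2 / 1) * z.2)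
      ∂(stdGauss.prod stdGauss) = t := by
    simp only [e]
    rw [integral_add hI1 hI2, integral_const_mul,
      integral_prod_mul (f := fun x : ℝ => t * x ^ 2) (g := fun _ : ℝ => (1 : ℝ)),
      integral_prod_mul (f := fun x : ℝ => x) (g := fun x : ℝ => x), integral_id_gaussianReal,
      integral_const_mul, integral_sq_stdGauss]
    simp
  rw [e2] at h1
  exact h1

/-- `tanh` of the Gaussian approximation of the effective field. -/
noncomputable def approxMag (β h : ℝ) (K k : ℕ) (p : SampleSpace) : Fin p.1 → ℝ := fun i =>
  Th β h (combo (fieldCoeff β h k) K p.2 i)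

theorem nextMag_eq (p : SampleSpace) {k : ℕ} (hk : 1 ≤ k) (hK : k ≤ K) :
    nextMag β h (iter β h (matrixAt β h K p)) k =
      fun i => Th β h (zetaCombo β h (fieldCoeff β h k) K p i) := by
  funext i
  rw [nextMag, nextField_eq β h _ hk hK]
  rfl

theorem tendsto_nrm_field_sub {k : ℕ} (hc : ∀ m, 1 ≤ m → m ≤ k → Controlled β h K m) :
    Tendsto (fun p => nrm (zetaCombo β h (fieldCoeff β h k) K p -
      combo (fieldCoeff β h k) K p.2)) whp (𝓝 0) := by
  refine tendsto_nrm_zetaCombo_sub _ fun m h1 _ => ?_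
  rcases le_or_gt m k with h2 | h2
  · exact Or.inl (hc m h1 h2)
  · exact Or.inr (fieldCoeff_of_gt h2)

theorem tendsto_nrm_nextMag_sub {k : ℕ} (hk : 1 ≤ k) (hK : k ≤ K)
    (hc : ∀ m, 1 ≤ m → m ≤ k → Controlled β h K m) :
    Tendsto (fun p => nrm (nextMag β h (iter β h (matrixAt β h K p)) k - approxMag β h K k p))
      whp (𝓝 0) := by
  have h1 := (tendsto_nrm_field_sub hc).const_mul |β|
  rw [mul_zero] at h1
  refine squeeze_zero (fun p => nrm_nonneg _) (fun p => ?_) h1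
  rw [nextMag_eq p hk hK]
  exact nrm_le_of_abs_le (abs_nonneg β) fun i => abs_Th_sub_le _ _ _ _

/-! ### Limits of inner products with the magnetizations. -/

variable (hβ : 0 < β) (hβ1 : β < 1) (hh : 0 < h)

include hβ hβ1 hh

theorem tendsto_ip_approxMag_self {k : ℕ} (hk : 1 ≤ k) (hK : k ≤ K) :
    Tendsto (fun p => ip (approxMag β h K k p) (approxMag β h K k p)) whp
      (𝓝 (overlap β h)) := by
  have hs := sum_fieldCoeff_sq hβ hβ1 hh hk hK
  have hP := IsGaussPair.scaled (overlap_pos (β := β) hh).le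
  have h1 := tendsto_average' (fieldCoeff β h k) (fieldCoeff β h k) hs
    (by simpa only [sq] using hs) hs hP (f := fun z => Th β h z.1 ^ 2)
    (((measurable_Th β h).comp measurable_fst).pow_const 2) (C := 1) fun x y => by
      rw [abs_of_nonneg (sq_nonneg _)]
      have h2 : Th β h x ^ 2 ≤ 1 := tanh_sq_le_one (h + β * x)
      change Th β h x ^ 2 ≤ _
      nlinarith [sq_nonneg x, sq_nonneg y]
  rw [overlap_eq_integral β h hP] at h1
  simp only [sq] at h1
  exact h1

theorem tendsto_nrm_approxMag {k : ℕ} (hk : 1 ≤ k) (hK : k ≤ K) :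
    Tendsto (fun p => nrm (approxMag β h K k p)) whp (𝓝 √(overlap β h)) :=
  (tendsto_ip_approxMag_self hβ hβ1 hh hk hK).sqrt

theorem tendsto_ip_nextMag_self {k : ℕ} (hk : 1 ≤ k) (hK : k ≤ K)
    (hc : ∀ m, 1 ≤ m → m ≤ k → Controlled β h K m) :
    Tendsto (fun p => ip (nextMag β h (iter β h (matrixAt β h K p)) k)
      (nextMag β h (iter β h (matrixAt β h K p)) k)) whp (𝓝 (overlap β h)) :=
  tendsto_ip_whp (tendsto_nrm_nextMag_sub hk hK hc) (tendsto_nrm_nextMag_sub hk hK hc)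
    (tendsto_nrm_approxMag hβ hβ1 hh hk hK) (tendsto_nrm_approxMag hβ hβ1 hh hk hK)
    (tendsto_ip_approxMag_self hβ hβ1 hh hk hK)

/-- The two limiting fields divided by `β`, without the shift by `h`, have covariance `ρ_j`, so the
limit is `ψ(ρ_j) = ρ_{j+1}`. The larger index does not enter it. -/
theorem tendsto_ip_nextMag {j k : ℕ} (hj : 1 ≤ j) (hjk : j < k) (hK : k ≤ K)
    (hc : ∀ m, 1 ≤ m → m ≤ k → Controlled β h K m) :
    Tendsto (fun p => ip (nextMag β h (iter β h (matrixAt β h K p)) k)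
      (nextMag β h (iter β h (matrixAt β h K p)) j)) whp (𝓝 (rho β h (j + 1))) := by
  refine tendsto_ip_whp (tendsto_nrm_nextMag_sub (by omega) hK hc)
    (tendsto_nrm_nextMag_sub hj (by omega) fun m h1 h2 => hc m h1 (by omega))
    (tendsto_nrm_approxMag hβ hβ1 hh (by omega) hK)
    (tendsto_nrm_approxMag hβ hβ1 hh hj (by omega)) ?_
  obtain ⟨l, rfl⟩ : ∃ l, j = l + 1 := ⟨j - 1, by omega⟩
  have hb := rho_bounds hβ hβ1 hh l
  have ht := sum_fieldCoeff_mul_fieldCoeff hβ hβ1 hh hj hjk (show l + 1 ≤ K by omega)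
  have hP := isGaussPair_psi hb.2.2.2 hb.2.1.le
  have h1 := tendsto_average' (K := K) (fieldCoeff β h k) (fieldCoeff β h (l + 1))
    (sum_fieldCoeff_sq hβ hβ1 hh (by omega) hK)
    (by simpa only [mul_comm] using ht) (sum_fieldCoeff_sq hβ hβ1 hh hj (by omega))
    hP (f := fun z => Th β h z.1 * Th β h z.2)
    (((measurable_Th β h).comp measurable_fst).mul ((measurable_Th β h).comp measurable_snd))
    (C := 1) fun x y => by
      rw [abs_mul]
      have := mul_le_mul (abs_Th_le_one β h x) (abs_Th_le_one β h y) (abs_nonneg _) zero_le_one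
      nlinarith [sq_nonneg x, sq_nonneg y]
  rw [← psi_eq hb.2.2.2 hb.2.1.le hP, ← rho_add_two] at h1
  exact h1

theorem tendsto_ip_nextMag_one {k : ℕ} (hk : 1 ≤ k) (hK : k ≤ K)
    (hc : ∀ m, 1 ≤ m → m ≤ k → Controlled β h K m) :
    Tendsto (fun p => ip (nextMag β h (iter β h (matrixAt β h K p)) k) 1) whp
      (𝓝 (gamma β h 1)) := by
  have hone : Tendsto (fun p : SampleSpace => nrm (1 : Fin p.1 → ℝ)) whp (𝓝 1) := by
    refine tendsto_const_nhds.congr' ?_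
    filter_upwards [eventually_whp_pos] with p hp
    rw [nrm, ip_one_one hp, Real.sqrt_one]
  refine tendsto_ip_whp (tendsto_nrm_nextMag_sub hk hK hc)
    (by simp only [sub_self, nrm_zero]; exact tendsto_const_nhds)
    (tendsto_nrm_approxMag hβ hβ1 hh hk hK) hone ?_
  have hs := sum_fieldCoeff_sq hβ hβ1 hh hk hK
  have hP := IsGaussPair.scaled (overlap_pos (β := β) hh).le
  have h1 := tendsto_average' (fieldCoeff β h k) (fieldCoeff β h k) hs
    (by simpa only [sq] using hs) hs hP (f := fun z => Th β h z.1 * 1)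
    (((measurable_Th β h).comp measurable_fst).mul_const 1) (C := 1) fun x y => by
      rw [mul_one]
      nlinarith [sq_nonneg x, sq_nonneg y, abs_Th_le_one β h x]
  have e : ∫ x, Th β h (√(overlap β h) * x) * 1 ∂stdGauss = gamma β h 1 := by
    rw [gamma_one, gammaOne]
    simp only [Th, mul_one, mul_assoc]
  rw [e] at h1
  exact h1

/-- In the limit `ζ^{(m)}` is a standard Gaussian with covariance `fieldCoeff β h k m` to the field,
and `integral_Th_mul` evaluates the mixed moment. -/
theorem tendsto_ip_nextMag_zeta {k m : ℕ} (hk : 1 ≤ k) (hK : k ≤ K) (hm : 1 ≤ m) (hmk : m ≤ k)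
    (hc : ∀ m, 1 ≤ m → m ≤ k → Controlled β h K m) :
    Tendsto (fun p => ip (nextMag β h (iter β h (matrixAt β h K p)) k)
      (zeta (iter β h (matrixAt β h K p) m))) whp
      (𝓝 (β * fieldCoeff β h k m * (1 - overlap β h))) := by
  have hmK : m ∈ Finset.Icc 1 K := Finset.mem_Icc.2 ⟨hm, by omega⟩
  refine tendsto_ip_whp (tendsto_nrm_nextMag_sub hk hK hc) (hc m hm hmk).2
    (tendsto_nrm_approxMag hβ hβ1 hh hk hK) (tendsto_nrm_yPart hmK) ?_
  have hcov := abs_fieldCoeff_le hβ hβ1 hh hk hm hmk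
  have hP := isGaussPair_of_cov (overlap_pos (β := β) hh) hcov
  have ht := sum_single_mul m (fieldCoeff β h k) hmK
  have hs := sum_single_mul m (Pi.single m 1 : ℕ → ℝ) hmK
  rw [Pi.single_eq_same] at hs
  have h1 := tendsto_average' (fieldCoeff β h k) (Pi.single m 1)
    (sum_fieldCoeff_sq hβ hβ1 hh hk hK) (by simpa only [mul_comm] using ht)
    (by simpa only [sq] using hs) hP (f := fun z => Th β h z.1 * z.2)
    (((measurable_Th β h).comp measurable_fst).mul measurable_snd) (C := 1) fun x y => by
      rw [abs_mul]
      have := mul_le_of_le_one_left (abs_nonneg y) (abs_Th_le_one β h x)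
      nlinarith [sq_nonneg x, sq_nonneg (|y| - 1), sq_abs y]
  rw [integral_Th_mul hh hP hcov] at h1
  simp only [combo_single hmK] at h1
  exact h1

theorem tendsto_average_log_cosh {k : ℕ} (hk : 1 ≤ k) (hK : k ≤ K)
    (hc : ∀ m, 1 ≤ m → m ≤ k → Controlled β h K m) :
    Tendsto (fun p : SampleSpace => (p.1 : ℝ)⁻¹ * ∑ i, Real.log (Real.cosh
      (nextField β h (iter β h (matrixAt β h K p)) k i))) whp
      (𝓝 (∫ x, Real.log (Real.cosh (h + β * √(overlap β h) * x)) ∂stdGauss)) := by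
  have hs := sum_fieldCoeff_sq hβ hβ1 hh hk hK
  have hP := IsGaussPair.scaled (overlap_pos (β := β) hh).le
  have h1 := tendsto_average' (fieldCoeff β h k) (fieldCoeff β h k) hs
    (by simpa only [sq] using hs) hs hP (f := fun z => Real.log (Real.cosh (h + β * z.1)))
    (continuous_log_cosh.measurable.comp (by fun_prop)) (C := h + β) fun x y => by
      refine (abs_log_cosh_le _).trans ((abs_add_le _ _).trans ?_)
      rw [abs_mul, abs_of_pos hh, abs_of_pos hβ]
      have h2 : |x| ≤ 1 + x ^ 2 := by nlinarith [sq_nonneg (|x| - 1), sq_abs x]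
      nlinarith [mul_le_mul_of_nonneg_left h2 hβ.le, mul_nonneg hh.le (sq_nonneg x),
        mul_nonneg hh.le (sq_nonneg y), mul_nonneg hβ.le (sq_nonneg y)]
  simp only [← mul_assoc] at h1
  have h2 : Tendsto (fun p : SampleSpace => (p.1 : ℝ)⁻¹ * ∑ i, Real.log (Real.cosh
      (nextField β h (iter β h (matrixAt β h K p)) k i)) - (p.1 : ℝ)⁻¹ * ∑ i, Real.log (Real.cosh
      (h + β * combo (fieldCoeff β h k) K p.2 i))) whp (𝓝 0) := by
    have h3 := (tendsto_nrm_field_sub hc).const_mul β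
    rw [mul_zero] at h3
    refine squeeze_zero_norm (fun p => ?_) h3
    have h4 := average_abs_sub_le (zetaCombo β h (fieldCoeff β h k) K p)
      (combo (fieldCoeff β h k) K p.2)
    refine le_trans ?_ (mul_le_mul_of_nonneg_left h4 hβ.le)
    have hN : (0 : ℝ) ≤ (p.1 : ℝ)⁻¹ := by positivity
    rw [Real.norm_eq_abs, ← mul_sub, ← Finset.sum_sub_distrib, abs_mul, abs_of_nonneg hN,
      mul_left_comm, Finset.mul_sum _ _ β]
    refine mul_le_mul_of_nonneg_left ((Finset.abs_sum_le_sum_abs _ _).trans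
      (Finset.sum_le_sum fun i _ => ?_)) hN
    refine (abs_log_cosh_sub_le _ _).trans (le_of_eq ?_)
    rw [nextField_eq β h _ hk hK, add_sub_add_left_eq_sub, ← mul_sub, abs_mul, abs_of_pos hβ]
    rfl
  simpa using h2.add h1

/-- The inner product with the normalized residual is a quotient of quantities already known: the
numerator tends to `ρ_{t+1} - Γ_t²` and the squared denominator to `q - Γ_t² > 0`, which is the
recursion for `γ`. -/
theorem tendsto_ip_nextMag_phi {k : ℕ} (hK : k ≤ K)
    (hc : ∀ m, 1 ≤ m → m ≤ k → Controlled β h K m) (s : ℕ) (hs : 1 ≤ s) :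
    ∀ l, s ≤ l → l ≤ k → Tendsto (fun p => ip (nextMag β h (iter β h (matrixAt β h K p)) l)
      (phi β h (matrixAt β h K p) s)) whp (𝓝 (gamma β h s)) := by
  induction s using Nat.strong_induction_on with
  | _ s ih =>
  intro l hsl hl
  rcases hs.eq_or_lt with rfl | hs1
  · simp only [phi_one]
    exact tendsto_ip_nextMag_one hβ hβ1 hh hsl (by omega) fun m h1 h2 => hc m h1 (by omega)
  obtain ⟨t, rfl⟩ : ∃ t, s = t + 1 := ⟨s - 1, by omega⟩
  have ht : 1 ≤ t := by omega
  have h1 : Tendsto (fun p => ip (nextResidual β h (iter β h (matrixAt β h K p)) t)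
      (nextResidual β h (iter β h (matrixAt β h K p)) t)) whp
      (𝓝 (overlap β h - GammaSq β h t)) := by
    simp only [ip_nextResidual_self]
    refine (tendsto_ip_nextMag_self hβ hβ1 hh ht (by omega)
      fun m h1 h2 => hc m h1 (by omega)).sub (tendsto_finsetSum _ fun r hr => ?_)
    have := Finset.mem_Icc.1 hr
    exact (ih r (by omega) this.1 t this.2 (by omega)).pow 2
  have h2 : Tendsto (fun p => ip (nextMag β h (iter β h (matrixAt β h K p)) l)
        (nextMag β h (iter β h (matrixAt β h K p)) t) - ∑ r ∈ Finset.Icc 1 t,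
        ip (nextMag β h (iter β h (matrixAt β h K p)) t) (phi β h (matrixAt β h K p) r) *
          ip (nextMag β h (iter β h (matrixAt β h K p)) l) (phi β h (matrixAt β h K p) r)) whp
      (𝓝 (rho β h (t + 1) - GammaSq β h t)) := by
    simp only [GammaSq, sq (gamma β h _)]
    refine (tendsto_ip_nextMag hβ hβ1 hh ht (by omega) (by omega)
      fun m h1 h2 => hc m h1 (by omega)).sub (tendsto_finsetSum _ fun r hr => ?_)
    have := Finset.mem_Icc.1 hr
    exact (ih r (by omega) this.1 t this.2 (by omega)).mul
      (ih r (by omega) this.1 l (by omega) hl)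
  have h3 := (h1.sqrt.inv₀ (Real.sqrt_pos.2 (sub_pos.2
    (GammaSq_lt_overlap hβ hβ1 hh t))).ne').mul h2
  rw [← div_eq_inv_mul, ← gamma_succ hh] at h3
  refine h3.congr fun p => ?_
  rw [ip_phi_succ β h _ ht]
  rfl

theorem tendsto_ip_nextResidual_self {k : ℕ} (hk : 1 ≤ k) (hK : k ≤ K)
    (hc : ∀ m, 1 ≤ m → m ≤ k → Controlled β h K m) :
    Tendsto (fun p => ip (nextResidual β h (iter β h (matrixAt β h K p)) k)
      (nextResidual β h (iter β h (matrixAt β h K p)) k)) whp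
      (𝓝 (overlap β h - GammaSq β h k)) := by
  simp only [ip_nextResidual_self]
  refine (tendsto_ip_nextMag_self hβ hβ1 hh hk hK hc).sub (tendsto_finsetSum _ fun r hr => ?_)
  have := Finset.mem_Icc.1 hr
  exact (tendsto_ip_nextMag_phi hβ hβ1 hh hK hc r this.1 k this.2 le_rfl).pow 2

/-- The induction closes here: control up to step `k` makes the squared norm of the next residual
tend to `q - Γ_k² > 0`, so the next direction is a unit vector with high probability, which gives
control of the next `ζ`. -/
theorem controlled (m : ℕ) (hm : 1 ≤ m) (hK : m ≤ K) : Controlled β h K m := by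
  induction m using Nat.strong_induction_on with
  | _ m ih =>
  obtain ⟨k, rfl⟩ : ∃ k, m = k + 1 := ⟨m - 1, by omega⟩
  refine tendsto_nrm_zeta_sub hK ?_
  rcases Nat.eq_zero_or_pos k with rfl | hk
  · filter_upwards [eventually_whp_pos] with p hp
    rw [zero_add, phi_one, ip_one_one hp]
  · have h1 := tendsto_ip_nextResidual_self hβ hβ1 hh hk (by omega)
      fun m h1 h2 => ih m (by omega) h1 (by omega)
    filter_upwards [h1.eventually_ne (sub_pos.2 (GammaSq_lt_overlap hβ hβ1 hh k)).ne'] with p hp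
    rw [phi_succ β h _ hk]
    have hn : nrm (nextResidual β h (iter β h (matrixAt β h K p)) k) ≠ 0 := fun h0 => hp (by
      rw [← nrm_sq, h0]; norm_num)
    rw [ip_smul_left, ip_smul_right, ← nrm_sq]
    field_simp

end stateEvolution

/-! ### The Laplace method for the annealed partition function -/

section gibbs

theorem integrable_and_integral_exp_sq : Integrable (fun x : ℝ => Real.exp (x ^ 2 / 4)) stdGauss ∧
    ∫ x, Real.exp (x ^ 2 / 4) ∂stdGauss = √2 := by
  have e : ∀ x : ℝ, gaussianPDFReal 0 1 x * Real.exp (x ^ 2 / 4) =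
      (√(2 * Real.pi))⁻¹ * Real.exp (-(1 / 4) * x ^ 2) := fun x => by
    rw [gaussianPDFReal, mul_assoc, ← Real.exp_add]
    congr 2
    · simp
    · simp only [NNReal.coe_one]; ring
  constructor
  · rw [stdGauss, gaussianReal_of_var_ne_zero _ one_ne_zero, gaussianPDF_def,
      integrable_withDensity_iff_integrable_smul' (measurable_gaussianPDFReal 0 1).ennreal_ofReal
        (Eventually.of_forall fun x => ENNReal.ofReal_lt_top)]
    simp only [ENNReal.toReal_ofReal (gaussianPDFReal_nonneg 0 1 _), smul_eq_mul, e]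
    exact (integrable_exp_neg_mul_sq (by norm_num)).const_mul _
  · rw [integral_gaussianReal_eq_integral_smul one_ne_zero]
    simp only [smul_eq_mul, e]
    rw [integral_const_mul, integral_gaussian, ← Real.sqrt_inv, ← Real.sqrt_mul (by positivity)]
    congr 1
    have := Real.pi_ne_zero
    field_simp
    norm_num

theorem integral_exp_sum_stdPi {ι : Type*} [Fintype ι] (z : ι → ℝ) :
    Integrable (fun g : ι → ℝ => Real.exp (∑ j, g j * z j)) (stdPi ι) ∧
    ∫ g : ι → ℝ, Real.exp (∑ j, g j * z j) ∂(stdPi ι) = Real.exp ((∑ j, z j ^ 2) / 2) := by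
  have h1 : ∀ j, ∫ x, Real.exp (x * z j) ∂stdGauss = Real.exp (z j ^ 2 / 2) := fun j => by
    have := mgf_gaussianReal (μ := 0) (v := 1) (X := id) (p := stdGauss) Measure.map_id (z j)
    simp only [mgf, id, zero_mul, NNReal.coe_one, one_mul, zero_add] at this
    simpa only [mul_comm] using this
  constructor
  · simp only [Real.exp_sum]
    refine Integrable.fintype_prod (f := fun j x => Real.exp (x * z j)) fun j => ?_
    simpa only [mul_comm] using integrable_exp_mul_gaussianReal (μ := 0) (v := 1) (z j)
  · simp only [Real.exp_sum]
    rw [integral_fintype_prod_eq_prod (f := fun j x => Real.exp (x * z j)), Finset.sum_div,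
      Real.exp_sum]
    exact Finset.prod_congr rfl fun j _ => h1 j

theorem integral_exp_sum_sq_stdPi {ι : Type*} [Fintype ι] :
    Integrable (fun g : ι → ℝ => Real.exp ((∑ j, g j ^ 2) / 4)) (stdPi ι) ∧
    ∫ g : ι → ℝ, Real.exp ((∑ j, g j ^ 2) / 4) ∂(stdPi ι) = √2 ^ Fintype.card ι := by
  constructor
  · simp only [Finset.sum_div, Real.exp_sum]
    exact Integrable.fintype_prod (f := fun _ x => Real.exp (x ^ 2 / 4))
      fun j => integrable_and_integral_exp_sq.1
  · simp only [Finset.sum_div, Real.exp_sum]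
    rw [integral_fintype_prod_eq_prod (f := fun _ x => Real.exp (x ^ 2 / 4))]
    simp [integrable_and_integral_exp_sq.2]

/-- Sub-Gaussian linear functionals have exponentially integrable squares. -/
theorem sum_mul_exp_half_sq_le {S ι : Type*} [Fintype S] [Fintype ι] {w : S → ℝ}
    {z : S → ι → ℝ}
    (h : ∀ t : ι → ℝ, ∑ σ, w σ * Real.exp (∑ j, t j * z σ j) ≤ Real.exp ((∑ j, t j ^ 2) / 4)) :
    ∑ σ, w σ * Real.exp ((∑ j, z σ j ^ 2) / 2) ≤ √2 ^ Fintype.card ι := by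
  have hi := fun σ => (integral_exp_sum_stdPi (z σ)).1.const_mul (w σ)
  -- The exponential of half a squared norm is linearized as a Gaussian average of `exp (g · z)`.
  -- After the sum over `σ` and the hypothesis, only `E exp (g² / 4) = √2` per coordinate remains.
  have e : ∑ σ, w σ * Real.exp ((∑ j, z σ j ^ 2) / 2) =
      ∫ g : ι → ℝ, ∑ σ, w σ * Real.exp (∑ j, g j * z σ j) ∂(stdPi ι) := by
    rw [integral_finsetSum _ fun σ _ => hi σ]
    refine Finset.sum_congr rfl fun σ _ => ?_
    rw [integral_const_mul, (integral_exp_sum_stdPi (z σ)).2]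
  rw [e, ← integral_exp_sum_sq_stdPi.2]
  exact integral_mono (integrable_finsetSum _ fun σ _ => hi σ) integral_exp_sum_sq_stdPi.1 h

/-- Jensen's inequality, obtained by averaging the tangent bound `exp f ≥ exp μ (1 + f - μ)` at the
mean `μ`. -/
theorem sum_mul_le_log_sum_exp {S : Type*} [Fintype S] {w f : S → ℝ} (hw : ∀ σ, 0 ≤ w σ)
    (hw1 : ∑ σ, w σ = 1) :
    0 < ∑ σ, w σ * Real.exp (f σ) ∧ ∑ σ, w σ * f σ ≤ Real.log (∑ σ, w σ * Real.exp (f σ)) := by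
  set μ := ∑ σ, w σ * f σ
  have h1 : Real.exp μ ≤ ∑ σ, w σ * Real.exp (f σ) := by
    calc Real.exp μ = ∑ σ, w σ * (Real.exp μ * (f σ - μ + 1)) := by
          have : ∀ σ, w σ * (Real.exp μ * (f σ - μ + 1)) =
              Real.exp μ * (w σ * f σ) + Real.exp μ * (1 - μ) * w σ := fun σ => by ring
          simp only [this]
          rw [Finset.sum_add_distrib, ← Finset.mul_sum, ← Finset.mul_sum, hw1]
          change _ = Real.exp μ * μ + _
          ring
      _ ≤ _ := by
          refine Finset.sum_le_sum fun σ _ => mul_le_mul_of_nonneg_left ?_ (hw σ)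
          calc Real.exp μ * (f σ - μ + 1) ≤ Real.exp μ * Real.exp (f σ - μ) :=
                mul_le_mul_of_nonneg_left (Real.add_one_le_exp _) (Real.exp_pos _).le
            _ = Real.exp (f σ) := by rw [← Real.exp_add]; ring_nf
  have h2 := (Real.exp_pos μ).trans_le h1
  exact ⟨h2, (Real.le_log_iff_exp_le h2).2 h1⟩

variable {N : ℕ}

/-- The product measure on spins with fields `H`. -/
noncomputable def gibbs (H : Fin N → ℝ) (σ : Fin N → Bool) : ℝ :=
  ∏ i, Real.exp (H i * spin (σ i)) / (2 * Real.cosh (H i))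

theorem gibbs_nonneg (H : Fin N → ℝ) (σ : Fin N → Bool) : 0 ≤ gibbs H σ :=
  Finset.prod_nonneg fun _ _ => div_nonneg (Real.exp_pos _).le
    (mul_nonneg zero_le_two (Real.cosh_pos _).le)

theorem sum_gibbs_mul_exp (H τ : Fin N → ℝ) :
    ∑ σ, gibbs H σ * Real.exp (∑ i, τ i * spin (σ i)) =
      ∏ i, Real.cosh (H i + τ i) / Real.cosh (H i) := by
  have h1 : ∀ σ : Fin N → Bool, gibbs H σ * Real.exp (∑ i, τ i * spin (σ i)) =
      ∏ i, Real.exp (H i * spin (σ i)) / (2 * Real.cosh (H i)) * Real.exp (τ i * spin (σ i)) := by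
    intro σ
    rw [gibbs, Real.exp_sum, ← Finset.prod_mul_distrib]
  simp only [h1]
  rw [← Fintype.prod_sum fun i b =>
    Real.exp (H i * spin b) / (2 * Real.cosh (H i)) * Real.exp (τ i * spin b)]
  refine Finset.prod_congr rfl fun i _ => ?_
  have := (Real.cosh_pos (H i)).ne'
  rw [Fintype.sum_bool, div_mul_eq_mul_div, div_mul_eq_mul_div, ← Real.exp_add, ← Real.exp_add,
    Real.cosh_eq (H i + τ i)]
  simp only [spin, if_true, Bool.false_eq_true, if_false]
  field_simp
  ring_nf

theorem sum_gibbs (H : Fin N → ℝ) : ∑ σ, gibbs H σ = 1 := by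
  have h1 := sum_gibbs_mul_exp H 0
  have h2 : ∀ i, Real.cosh (H i) ≠ 0 := fun i => (Real.cosh_pos _).ne'
  simpa [h2] using h1

theorem sum_gibbs_mul_spin (H : Fin N → ℝ) (j : Fin N) :
    ∑ σ, gibbs H σ * spin (σ j) = Real.tanh (H j) := by
  have h1 : ∀ σ : Fin N → Bool, gibbs H σ * spin (σ j) =
      ∏ i, Real.exp (H i * spin (σ i)) / (2 * Real.cosh (H i)) *
        (if i = j then spin (σ i) else 1) := by
    intro σ
    rw [gibbs, Finset.prod_mul_distrib, Finset.prod_ite_eq' Finset.univ j]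
    simp
  simp only [h1]
  rw [← Fintype.prod_sum fun i b =>
    Real.exp (H i * spin b) / (2 * Real.cosh (H i)) * (if i = j then spin b else 1),
    Finset.prod_eq_single j]
  · have := (Real.cosh_pos (H j)).ne'
    rw [Fintype.sum_bool, Real.tanh_eq_sinh_div_cosh, Real.sinh_eq]
    simp only [spin, if_true, Bool.false_eq_true, if_false]
    field_simp
    ring_nf
  · intro i _ hij
    have := (Real.cosh_pos (H i)).ne'
    have h2 : Real.exp (H i) + Real.exp (-H i) = 2 * Real.cosh (H i) := by
      rw [Real.cosh_eq]; ring
    rw [Fintype.sum_bool]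
    simp only [hij, if_false, spin, if_true, Bool.false_eq_true, mul_one]
    rw [← add_div, mul_neg, mul_one, h2]
    field_simp
  · exact fun h => absurd (Finset.mem_univ j) h

theorem sum_gibbs_mul_exp_le (H τ : Fin N → ℝ) :
    ∑ σ, gibbs H σ * Real.exp (∑ i, τ i * (spin (σ i) - Real.tanh (H i))) ≤
      Real.exp ((∑ i, τ i ^ 2) / 2) := by
  have h1 : ∀ σ : Fin N → Bool, gibbs H σ *
      Real.exp (∑ i, τ i * (spin (σ i) - Real.tanh (H i))) =
      gibbs H σ * Real.exp (∑ i, τ i * spin (σ i)) *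
        ∏ i, Real.exp (-(τ i * Real.tanh (H i))) := by
    intro σ
    rw [mul_assoc, ← Real.exp_sum, ← Real.exp_add, ← Finset.sum_add_distrib]
    congr 2
    exact Finset.sum_congr rfl fun i _ => by ring
  simp only [h1]
  rw [← Finset.sum_mul, sum_gibbs_mul_exp, ← Finset.prod_mul_distrib, Finset.sum_div,
    Real.exp_sum]
  refine Finset.prod_le_prod (fun i _ => mul_nonneg (div_nonneg (Real.cosh_pos _).le
    (Real.cosh_pos _).le) (Real.exp_pos _).le) fun i _ => ?_
  have h2 := log_cosh_add_le (H i) (τ i)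
  have h3 := Real.exp_le_exp.2 h2
  rw [Real.exp_log (Real.cosh_pos _), Real.exp_add, Real.exp_add,
    Real.exp_log (Real.cosh_pos _)] at h3
  have h4 := Real.exp_pos (τ i * Real.tanh (H i))
  rw [Real.exp_neg, ← div_eq_mul_inv, div_div, div_le_iff₀ (mul_pos (Real.cosh_pos _) h4)]
  linarith

theorem sum_gibbs_mul_sub (H v : Fin N → ℝ) :
    ∑ σ, gibbs H σ * ip (spinVec σ - fun i => Real.tanh (H i)) v = 0 := by
  have h1 : ∀ σ : Fin N → Bool, gibbs H σ * ip (spinVec σ - fun i => Real.tanh (H i)) v =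
      ∑ i, (N : ℝ)⁻¹ * v i * (gibbs H σ * spin (σ i) - Real.tanh (H i) * gibbs H σ) := by
    intro σ
    rw [ip, Finset.mul_sum, Finset.mul_sum]
    refine Finset.sum_congr rfl fun i _ => ?_
    simp only [spinVec, Pi.sub_apply]
    ring
  simp only [h1]
  rw [Finset.sum_comm]
  refine Finset.sum_eq_zero fun i _ => ?_
  rw [← Finset.mul_sum, Finset.sum_sub_distrib, sum_gibbs_mul_spin, ← Finset.mul_sum, sum_gibbs,
    mul_one, sub_self, mul_zero]

/-- The scaling `√(N / 8)` is chosen so that the bound `4 ∑ t²` on the norm turns the sub-Gaussian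
exponent into exactly `∑ t² / 4`, as `sum_mul_exp_half_sq_le` requires; half of its square is `N /
16`. -/
theorem sum_gibbs_mul_exp_sq_le (hN : 0 < N) (H : Fin N → ℝ) {ι : Type*} [Fintype ι]
    (v : ι → Fin N → ℝ) (hv : ∀ t : ι → ℝ, nrm (∑ j, t j • v j) ^ 2 ≤ 4 * ∑ j, t j ^ 2) :
    ∑ σ, gibbs H σ * Real.exp (N / 16 * ∑ j, ip (spinVec σ - fun i => Real.tanh (H i)) (v j) ^ 2) ≤
      √2 ^ Fintype.card ι := by
  have hN' : (0 : ℝ) < N := by exact_mod_cast hN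
  have hs : √(N / 8 : ℝ) ^ 2 = N / 8 := Real.sq_sqrt (by positivity)
  have h1 := sum_mul_exp_half_sq_le (w := gibbs H)
    (z := fun σ j => √(N / 8 : ℝ) * ip (spinVec σ - fun i => Real.tanh (H i)) (v j)) fun t => by
      have e : ∀ σ : Fin N → Bool,
          ∑ j, t j * (√(N / 8 : ℝ) * ip (spinVec σ - fun i => Real.tanh (H i)) (v j)) =
          ∑ i, (√(N / 8 : ℝ) * (N : ℝ)⁻¹ * (∑ j, t j • v j) i) *
            (spin (σ i) - Real.tanh (H i)) := by
        intro σ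
        have e1 : ∑ j, t j * (√(N / 8 : ℝ) * ip (spinVec σ - fun i => Real.tanh (H i)) (v j)) =
            √(N / 8 : ℝ) * ip (spinVec σ - fun i => Real.tanh (H i)) (∑ j, t j • v j) := by
          rw [ip_sum_right, Finset.mul_sum]
          refine Finset.sum_congr rfl fun j _ => ?_
          rw [ip_smul_right]
          ring
        rw [e1, ip, Finset.mul_sum, Finset.mul_sum]
        refine Finset.sum_congr rfl fun i _ => ?_
        simp only [spinVec, Pi.sub_apply]
        ring
      simp only [e]
      refine (sum_gibbs_mul_exp_le H _).trans (Real.exp_le_exp.2 ?_)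
      have e2 : ∑ i, (√(N / 8 : ℝ) * (N : ℝ)⁻¹ * (∑ j, t j • v j) i) ^ 2 =
          nrm (∑ j, t j • v j) ^ 2 / 8 := by
        rw [nrm_sq, ip, Finset.mul_sum, Finset.sum_div]
        refine Finset.sum_congr rfl fun i _ => ?_
        rw [mul_pow, mul_pow, hs]
        field_simp
      rw [e2]
      linarith [hv t]
  refine le_trans (le_of_eq ?_) h1
  refine Finset.sum_congr rfl fun σ _ => ?_
  congr 2
  rw [Finset.mul_sum, Finset.sum_div]
  refine Finset.sum_congr rfl fun j _ => ?_
  rw [mul_pow, hs]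
  ring

end gibbs

/-! ### Expansion of the exponent and two-sided bounds on `log annealed`. -/

section laplace

/-- Young's inequality `|u x| ≤ 16 u² + x² / 64`. The weight `1 / 64` is small enough for the
squares to be absorbed into the exponent `1 / 16` available from the sub-Gaussian estimate. -/
theorem abs_sum_linear_le (I : Finset ℕ) (u v x y : ℕ → ℝ) :
    |∑ m ∈ I, (u m * x m + v m * y m)| ≤ 16 * (∑ m ∈ I, u m ^ 2 + ∑ m ∈ I, v m ^ 2) +
      (∑ m ∈ I, x m ^ 2 + ∑ m ∈ I, y m ^ 2) / 64 := by
  refine (Finset.abs_sum_le_sum_abs _ _).trans ?_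
  rw [← Finset.sum_add_distrib, ← Finset.sum_add_distrib, Finset.mul_sum, Finset.sum_div,
    ← Finset.sum_add_distrib]
  refine Finset.sum_le_sum fun m _ => ?_
  rw [abs_le]
  constructor
  · nlinarith [sq_nonneg (32 * u m + x m), sq_nonneg (32 * v m + y m)]
  · nlinarith [sq_nonneg (32 * u m - x m), sq_nonneg (32 * v m - y m)]

/-- Second-order expansion of the exponent around the centers `b, c`. -/
theorem abs_expansion_sub_le {β : ℝ} (hβ : 0 < β) (I : Finset ℕ) (X Y a b c δ : ℕ → ℝ)
    (hX : ∑ m ∈ I, X m ^ 2 ≤ 1) (hc : ∑ m ∈ I, c m ^ 2 ≤ 1) :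
    |(β * ∑ m ∈ I, Y m * X m - β / √2 * ∑ m ∈ I, δ m * X m ^ 2 +
        β ^ 2 / 4 * (1 - ∑ m ∈ I, X m ^ 2) ^ 2 - β * ∑ m ∈ I, a m * Y m) -
      (β * ∑ m ∈ I, b m * (c m - a m) + β ^ 2 / 4 * (1 - ∑ m ∈ I, c m ^ 2) ^ 2) -
      ∑ m ∈ I, ((β * b m - β ^ 2 * (1 - ∑ m ∈ I, c m ^ 2) * c m) * (X m - c m) +
        β * (c m - a m) * (Y m - b m))| ≤
      β * ∑ m ∈ I, |δ m| + (β / 2 + β ^ 2) *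
        (∑ m ∈ I, (X m - c m) ^ 2 + ∑ m ∈ I, (Y m - b m) ^ 2) := by
  set C := ∑ m ∈ I, c m ^ 2 with hC
  set Sxx := ∑ m ∈ I, (X m - c m) ^ 2 with hSxx
  set Syy := ∑ m ∈ I, (Y m - b m) ^ 2 with hSyy
  set Sxy := ∑ m ∈ I, (X m - c m) * (Y m - b m) with hSxy
  set Scx := ∑ m ∈ I, c m * (X m - c m) with hScx
  set T := ∑ m ∈ I, δ m * X m ^ 2 with hT
  have hSxx0 : 0 ≤ Sxx := Finset.sum_nonneg fun _ _ => sq_nonneg _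
  have hSyy0 : 0 ≤ Syy := Finset.sum_nonneg fun _ _ => sq_nonneg _
  have hC0 : 0 ≤ C := Finset.sum_nonneg fun _ _ => sq_nonneg _
  have eX : ∑ m ∈ I, X m ^ 2 = C + (2 * Scx + Sxx) := by
    rw [hC, hScx, hSxx, Finset.mul_sum, ← Finset.sum_add_distrib, ← Finset.sum_add_distrib]
    exact Finset.sum_congr rfl fun m _ => by ring
  have eL : ∑ m ∈ I, ((β * b m - β ^ 2 * (1 - C) * c m) * (X m - c m) +
        β * (c m - a m) * (Y m - b m)) = β * (∑ m ∈ I, Y m * X m - ∑ m ∈ I, a m * Y m -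
        ∑ m ∈ I, b m * (c m - a m) - Sxy) - β ^ 2 * (1 - C) * Scx := by
    rw [hSxy, hScx, ← Finset.sum_sub_distrib, ← Finset.sum_sub_distrib, ← Finset.sum_sub_distrib,
      Finset.mul_sum, Finset.mul_sum, ← Finset.sum_sub_distrib]
    exact Finset.sum_congr rfl fun m _ => by ring
  -- This quantity is `∑ X² - ∑ c² = ∑ (X - c)(X + c)`. Cauchy–Schwarz makes its square
  -- quadratically small, since `X` and `c` lie in the unit ball.
  have hw : (2 * Scx + Sxx) ^ 2 ≤ 4 * Sxx := by
    have e1 : 2 * Scx + Sxx = ∑ m ∈ I, (X m - c m) * (X m + c m) := by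
      rw [hScx, hSxx, Finset.mul_sum, ← Finset.sum_add_distrib]
      exact Finset.sum_congr rfl fun m _ => by ring
    have e2 : ∑ m ∈ I, (X m + c m) ^ 2 ≤ 4 := by
      calc ∑ m ∈ I, (X m + c m) ^ 2 ≤ ∑ m ∈ I, (2 * X m ^ 2 + 2 * c m ^ 2) :=
            Finset.sum_le_sum fun m _ => by nlinarith [sq_nonneg (X m - c m)]
        _ = 2 * ∑ m ∈ I, X m ^ 2 + 2 * C := by
            rw [Finset.sum_add_distrib, ← Finset.mul_sum, ← Finset.mul_sum]
        _ ≤ 4 := by linarith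
    rw [e1]
    refine (Finset.sum_mul_sq_le_sq_mul_sq I _ _).trans ?_
    nlinarith
  have hxy : |Sxy| ≤ (Sxx + Syy) / 2 := by
    refine (Finset.abs_sum_le_sum_abs _ _).trans ?_
    rw [← Finset.sum_add_distrib, Finset.sum_div]
    refine Finset.sum_le_sum fun m _ => ?_
    rw [abs_le]
    constructor
    · nlinarith [sq_nonneg (X m - c m + (Y m - b m))]
    · nlinarith [sq_nonneg (X m - c m - (Y m - b m))]
  have hTb : |T| ≤ ∑ m ∈ I, |δ m| := by
    refine (Finset.abs_sum_le_sum_abs _ _).trans (Finset.sum_le_sum fun m hm => ?_)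
    rw [abs_mul, abs_of_nonneg (sq_nonneg (X m))]
    exact mul_le_of_le_one_right (abs_nonneg _)
      ((Finset.single_le_sum (f := fun m => X m ^ 2) (fun _ _ => sq_nonneg _) hm).trans hX)
  have h2 : β / √2 ≤ β := div_le_self hβ.le (Real.one_le_sqrt.2 one_le_two)
  have hT2 : |β / √2 * T| ≤ β * ∑ m ∈ I, |δ m| := by
    rw [abs_mul, abs_of_nonneg (by positivity : 0 ≤ β / √2)]
    exact mul_le_mul h2 hTb (abs_nonneg _) hβ.le
  -- The value and the linear part at the center cancel exactly. Left over are the bilinear term,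
  -- the term with `δ`, and the second-order part of the square.
  have e : (β * ∑ m ∈ I, Y m * X m - β / √2 * T + β ^ 2 / 4 * (1 - ∑ m ∈ I, X m ^ 2) ^ 2 -
        β * ∑ m ∈ I, a m * Y m) - (β * ∑ m ∈ I, b m * (c m - a m) + β ^ 2 / 4 * (1 - C) ^ 2) -
      ∑ m ∈ I, ((β * b m - β ^ 2 * (1 - C) * c m) * (X m - c m) +
        β * (c m - a m) * (Y m - b m)) =
      β * Sxy - β / √2 * T + β ^ 2 / 4 * ((2 * Scx + Sxx) ^ 2 - 2 * (1 - C) * Sxx) := by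
    rw [eL, eX]
    ring
  rw [e]
  have h3 : |(2 * Scx + Sxx) ^ 2 - 2 * (1 - C) * Sxx| ≤ 4 * Sxx := by
    rw [abs_le]
    have h10 := mul_nonneg hC0 hSxx0
    have h11 := mul_nonneg (sub_nonneg.2 hc) hSxx0
    have h12 := sq_nonneg (2 * Scx + Sxx)
    constructor <;> linarith
  have h4 : |β * Sxy| ≤ β * ((Sxx + Syy) / 2) := by
    rw [abs_mul, abs_of_pos hβ]
    exact mul_le_mul_of_nonneg_left hxy hβ.le
  have h5 : |β ^ 2 / 4 * ((2 * Scx + Sxx) ^ 2 - 2 * (1 - C) * Sxx)| ≤ β ^ 2 / 4 * (4 * Sxx) := by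
    rw [abs_mul, abs_of_nonneg (by positivity : 0 ≤ β ^ 2 / 4)]
    exact mul_le_mul_of_nonneg_left h3 (by positivity)
  have h6 := abs_add_le (β * Sxy - β / √2 * T)
    (β ^ 2 / 4 * ((2 * Scx + Sxx) ^ 2 - 2 * (1 - C) * Sxx))
  have h7 := abs_sub (β * Sxy) (β / √2 * T)
  have h8 : (β / 2 + β ^ 2) * (Sxx + Syy) =
      β * ((Sxx + Syy) / 2) + β ^ 2 / 4 * (4 * Sxx) + β ^ 2 * Syy := by ring
  have h9 := mul_nonneg (sq_nonneg β) hSyy0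
  linarith

variable {N : ℕ}

/-- Change of reference measure from uniform spins to the product measure with fields `H`, whose
normalization produces the product of `cosh`. -/
theorem annealed_eq (β h : ℝ) (g : Matrix (Fin N) (Fin N) ℝ) (k : ℕ) (H : Fin N → ℝ) :
    annealed β h g k = (∏ i, Real.cosh (H i)) * ∑ σ, gibbs H σ *
      Real.exp (N * exponent β h g k (spinVec σ) - ∑ i, H i * spin (σ i)) := by
  rw [annealed, Finset.mul_sum, Finset.mul_sum]
  refine Finset.sum_congr rfl fun σ _ => ?_
  have h0 : ∀ i, Real.cosh (H i) ≠ 0 := fun i => (Real.cosh_pos _).ne'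
  have h1 : ∏ i : Fin N, Real.cosh (H i) ≠ 0 := Finset.prod_ne_zero_iff.2 fun i _ => h0 i
  rw [gibbs, Finset.prod_div_distrib, ← Real.exp_sum, Finset.prod_mul_distrib, Real.exp_sub,
    Finset.prod_const, Finset.card_univ, Fintype.card_fin]
  have := (Real.exp_pos (∑ i, H i * spin (σ i))).ne'
  field_simp

theorem nrm_sum_smul_phi_sq_le (β h : ℝ) (g : Matrix (Fin N) (Fin N) ℝ) (k : ℕ) (t : ℕ → ℝ) :
    nrm (∑ m ∈ Finset.Icc 1 k, t m • phi β h g m) ^ 2 ≤ ∑ m ∈ Finset.Icc 1 k, t m ^ 2 := by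
  have hO := orthoFamily_phi β h g k
  rw [nrm_sq, ip_sum_left]
  refine Finset.sum_le_sum fun m hm => ?_
  rw [ip_sum_right, Finset.sum_eq_single m]
  · rw [ip_smul_left, ip_smul_right, ← mul_assoc, ← sq]
    refine mul_le_of_le_one_right (sq_nonneg _) ?_
    rcases hO.2 m hm with h1 | h1
    · rw [h1, ip_zero_left]; exact zero_le_one
    · exact h1.le
  · intro n hn hnm
    rw [ip_smul_left, ip_smul_right, hO.1 m hm n hn hnm.symm, mul_zero, mul_zero]
  · exact fun h1 => absurd hm h1

theorem sum_ip_phi_sq_le (β h : ℝ) (g : Matrix (Fin N) (Fin N) ℝ) (k : ℕ) (s : Fin N → ℝ) :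
    ∑ m ∈ Finset.Icc 1 k, ip s (phi β h g m) ^ 2 ≤ ip s s := by
  have h1 := ip_Qmat_mulVec_self β h g k s
  have h2 := ip_self_nonneg (Qmat β h g k *ᵥ s)
  linarith

/-- The leading term of `N⁻¹ log E(Z_N | 𝒢_k)`, apart from the term with `log cosh`. -/
noncomputable def mainTerm (β h : ℝ) (g : Matrix (Fin N) (Fin N) ℝ) (k : ℕ) : ℝ :=
  β * ∑ m ∈ Finset.Icc 1 k, ip (nextMag β h (iter β h g) k) (zeta (iter β h g m)) *
      (ip (nextMag β h (iter β h g) k) (phi β h g m) - fieldCoeff β h k m) +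
    β ^ 2 / 4 * (1 - ∑ m ∈ Finset.Icc 1 k,
      ip (nextMag β h (iter β h g) k) (phi β h g m) ^ 2) ^ 2

/-- The squared size of the gradient of the exponent at its center. -/
noncomputable def gradTerm (β h : ℝ) (g : Matrix (Fin N) (Fin N) ℝ) (k : ℕ) : ℝ :=
  ∑ m ∈ Finset.Icc 1 k, (β * ip (nextMag β h (iter β h g) k) (zeta (iter β h g m)) -
      β ^ 2 * (1 - ∑ m ∈ Finset.Icc 1 k, ip (nextMag β h (iter β h g) k) (phi β h g m) ^ 2) *
        ip (nextMag β h (iter β h g) k) (phi β h g m)) ^ 2 +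
    ∑ m ∈ Finset.Icc 1 k,
      (β * (ip (nextMag β h (iter β h g) k) (phi β h g m) - fieldCoeff β h k m)) ^ 2

/-- The family of `2k` vectors meets the norm bound with constant `4`: Bessel gives `1` for the `φ`,
the hypothesis gives `2` for the `ζ`, and adding the two sums costs another factor `2`. The bound is
then `√2 ^ (2k)`. -/
theorem sum_gibbs_mul_exp_quadratic_le (hN : 0 < N) (β h : ℝ) (g : Matrix (Fin N) (Fin N) ℝ)
    (k : ℕ) (hζ : ∀ t : ℕ → ℝ, nrm (∑ m ∈ Finset.Icc 1 k, t m • zeta (iter β h g m)) ^ 2 ≤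
      2 * ∑ m ∈ Finset.Icc 1 k, t m ^ 2) (H : Fin N → ℝ) :
    ∑ σ, gibbs H σ * Real.exp (N / 16 *
      (∑ m ∈ Finset.Icc 1 k, ip (spinVec σ - fun i => Real.tanh (H i)) (phi β h g m) ^ 2 +
        ∑ m ∈ Finset.Icc 1 k, ip (spinVec σ - fun i => Real.tanh (H i)) (zeta (iter β h g m)) ^ 2)) ≤
      2 ^ k := by
  have h1 := sum_gibbs_mul_exp_sq_le hN H
    (v := (Sum.elim (fun m => phi β h g m) (fun m => zeta (iter β h g m)) :
      Finset.Icc 1 k ⊕ Finset.Icc 1 k → Fin N → ℝ)) fun t => by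
    -- Extension by `0`, to pass between sums over the subtype and sums over `Finset.Icc 1 k`.
    let T : (Finset.Icc 1 k → ℝ) → ℕ → ℝ := fun t m =>
      if hm : m ∈ Finset.Icc 1 k then t ⟨m, hm⟩ else 0
    have hT : ∀ t (m : Finset.Icc 1 k), T t m = t m := fun t m => dif_pos m.2
    have e1 : ∀ (t : Finset.Icc 1 k → ℝ) (v : ℕ → Fin N → ℝ),
        ∑ m : Finset.Icc 1 k, t m • v m = ∑ m ∈ Finset.Icc 1 k, T t m • v m := fun t v => by
      rw [← Finset.sum_coe_sort (Finset.Icc 1 k) fun m => T t m • v m]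
      simp only [hT]
    have e2 : ∀ (t : Finset.Icc 1 k → ℝ),
        ∑ m : Finset.Icc 1 k, t m ^ 2 = ∑ m ∈ Finset.Icc 1 k, T t m ^ 2 := fun t => by
      rw [← Finset.sum_coe_sort (Finset.Icc 1 k) fun m => T t m ^ 2]
      simp only [hT]
    rw [Fintype.sum_sum_type, Fintype.sum_sum_type]
    simp only [Sum.elim_inl, Sum.elim_inr]
    rw [e1 (fun m => t (Sum.inl m)) (phi β h g),
      e1 (fun m => t (Sum.inr m)) (fun m => zeta (iter β h g m)), e2 fun m => t (Sum.inl m),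
      e2 fun m => t (Sum.inr m)]
    have h2 := nrm_sum_smul_phi_sq_le β h g k (T fun m => t (Sum.inl m))
    have h3 := hζ (T fun m => t (Sum.inr m))
    have h4 := nrm_add_le (∑ m ∈ Finset.Icc 1 k, T (fun m => t (Sum.inl m)) m • phi β h g m)
      (∑ m ∈ Finset.Icc 1 k, T (fun m => t (Sum.inr m)) m • zeta (iter β h g m))
    have h5 : 0 ≤ ∑ m ∈ Finset.Icc 1 k, T (fun m => t (Sum.inl m)) m ^ 2 :=
      Finset.sum_nonneg fun _ _ => sq_nonneg _
    refine (pow_le_pow_left₀ (nrm_nonneg _) h4 2).trans (add_sq_le.trans ?_)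
    linarith
  rw [Fintype.card_sum, Fintype.card_coe, Nat.card_Icc, Nat.add_sub_cancel, ← two_mul, pow_mul,
    Real.sq_sqrt zero_le_two] at h1
  refine le_trans (le_of_eq (Finset.sum_congr rfl fun σ _ => ?_)) h1
  rw [Fintype.sum_sum_type]
  simp only [Sum.elim_inl, Sum.elim_inr]
  rw [Finset.sum_coe_sort (Finset.Icc 1 k)
      fun m => ip (spinVec σ - fun i => Real.tanh (H i)) (phi β h g m) ^ 2,
    Finset.sum_coe_sort (Finset.Icc 1 k)
      fun m => ip (spinVec σ - fun i => Real.tanh (H i)) (zeta (iter β h g m)) ^ 2]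

/-- With `H = h^{(k+1)}` the exponent divided by `N` is `R + L` up to `β Δ` and a small multiple of
`D`, where `L` is linear in the centered functionals and `D` is the sum of their squares. The upper
bound absorbs `L` by Young's inequality and `D` by the exponential moment; the lower bound is
Jensen, where `L` averages to zero. -/
theorem abs_log_annealed_sub_le (hN : 0 < N) {β : ℝ} (hβ : 0 < β) (hβ1 : β ≤ 1 / 16) (h : ℝ)
    (g : Matrix (Fin N) (Fin N) ℝ) {k : ℕ} (hk : 1 ≤ k)
    (hζ : ∀ t : ℕ → ℝ, nrm (∑ m ∈ Finset.Icc 1 k, t m • zeta (iter β h g m)) ^ 2 ≤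
      2 * ∑ m ∈ Finset.Icc 1 k, t m ^ 2) :
    |(N : ℝ)⁻¹ * Real.log (annealed β h g k) -
        (N : ℝ)⁻¹ * ∑ i, Real.log (Real.cosh (nextField β h (iter β h g) k i)) -
        mainTerm β h g k| ≤
      16 * gradTerm β h g k +
        β * ∑ m ∈ Finset.Icc 1 k, |ip (phi β h g m) (xi (iter β h g m))| + 2 ^ k / N := by
  have hN' : (0 : ℝ) < N := by exact_mod_cast hN
  set H := nextField β h (iter β h g) k with hH
  set M := nextMag β h (iter β h g) k with hM
  have hMH : M = fun i => Real.tanh (H i) := rfl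
  set a := fieldCoeff β h k
  set δ : ℕ → ℝ := fun m => ip (phi β h g m) (xi (iter β h g m)) with hδ
  set c : ℕ → ℝ := fun m => ip M (phi β h g m) with hc
  set b : ℕ → ℝ := fun m => ip M (zeta (iter β h g m)) with hb
  set f : (Fin N → Bool) → ℝ := fun σ =>
    N * exponent β h g k (spinVec σ) - ∑ i, H i * spin (σ i) with hf
  set D : (Fin N → Bool) → ℝ := fun σ =>
    ∑ m ∈ Finset.Icc 1 k, ip (spinVec σ - fun i => Real.tanh (H i)) (phi β h g m) ^ 2 +
      ∑ m ∈ Finset.Icc 1 k, ip (spinVec σ - fun i => Real.tanh (H i))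
        (zeta (iter β h g m)) ^ 2 with hD
  set L : (Fin N → Bool) → ℝ := fun σ => ∑ m ∈ Finset.Icc 1 k,
    ((β * b m - β ^ 2 * (1 - ∑ m ∈ Finset.Icc 1 k, c m ^ 2) * c m) *
        ip (spinVec σ - fun i => Real.tanh (H i)) (phi β h g m) +
      β * (c m - a m) * ip (spinVec σ - fun i => Real.tanh (H i)) (zeta (iter β h g m))) with hL
  set Δ := ∑ m ∈ Finset.Icc 1 k, |δ m| with hΔ
  set R := mainTerm β h g k with hR
  set G := gradTerm β h g k with hG
  have hΔ0 : 0 ≤ Δ := Finset.sum_nonneg fun _ _ => abs_nonneg _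
  have hD0 : ∀ σ, 0 ≤ D σ := fun σ => add_nonneg (Finset.sum_nonneg fun _ _ => sq_nonneg _)
    (Finset.sum_nonneg fun _ _ => sq_nonneg _)
  have hMM : ip M M ≤ 1 := by
    rw [← nrm_sq]
    exact pow_le_one₀ (nrm_nonneg _) (nextMag_le_one β h _ _)
  have hexp : ∀ σ, |f σ / N - R - L σ| ≤ β * Δ + (β / 2 + β ^ 2) * D σ := by
    intro σ
    have h1 := abs_expansion_sub_le hβ (Finset.Icc 1 k) (fun m => ip (spinVec σ) (phi β h g m))
      (fun m => ip (spinVec σ) (zeta (iter β h g m))) a b c δ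
      ((sum_ip_phi_sq_le β h g k _).trans (ip_spinVec_self hN σ).le)
      ((sum_ip_phi_sq_le β h g k M).trans hMM)
    have e1 : ∑ i, H i * spin (σ i) = N * (h * ip (spinVec σ) 1 +
        β * ∑ m ∈ Finset.Icc 1 k, a m * ip (spinVec σ) (zeta (iter β h g m))) := by
      have e2 : H = h • (1 : Fin N → ℝ) +
          β • ∑ m ∈ Finset.Icc 1 k, a m • zeta (iter β h g m) := by
        funext i
        rw [hH, nextField_eq β h _ hk le_rfl]
        simp only [Pi.add_apply, Pi.smul_apply, smul_eq_mul, Pi.one_apply, mul_one,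
          Finset.sum_apply]
        rfl
      have e3 : ∑ i, H i * spin (σ i) = N * ip (spinVec σ) H := by
        rw [ip, mul_inv_cancel_left₀ hN'.ne']
        exact Finset.sum_congr rfl fun i _ => mul_comm _ _
      rw [e3, e2, ip_add_right, ip_smul_right, ip_smul_right, ip_sum_right]
      simp only [ip_smul_right]
    have e4 : f σ / N = β * ∑ m ∈ Finset.Icc 1 k,
          ip (spinVec σ) (zeta (iter β h g m)) * ip (spinVec σ) (phi β h g m) -
        β / √2 * ∑ m ∈ Finset.Icc 1 k, δ m * ip (spinVec σ) (phi β h g m) ^ 2 +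
        β ^ 2 / 4 * (1 - ∑ m ∈ Finset.Icc 1 k, ip (spinVec σ) (phi β h g m) ^ 2) ^ 2 -
        β * ∑ m ∈ Finset.Icc 1 k, a m * ip (spinVec σ) (zeta (iter β h g m)) := by
      simp only [hf]
      rw [e1, exponent, ← mul_sub, mul_div_cancel_left₀ _ hN'.ne']
      ring
    rw [e4]
    simp only [hD, hL, ← hMH, ip_sub_left]
    exact h1
  have hLb : ∀ σ, |L σ| ≤ 16 * G + D σ / 64 := fun σ =>
    abs_sum_linear_le (Finset.Icc 1 k) _ _ _ _
  -- The smallness of `β` is used here: the quadratic remainder and the share from Young's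
  -- inequality must together fit into the controlled exponent `N D / 16`.
  have hβ2 : β / 2 + β ^ 2 + 1 / 64 ≤ 1 / 16 := by nlinarith
  have hG0 : 0 ≤ G := add_nonneg (Finset.sum_nonneg fun _ _ => sq_nonneg _)
    (Finset.sum_nonneg fun _ _ => sq_nonneg _)
  have hU := sum_gibbs_mul_exp_quadratic_le hN β h g k hζ H
  change ∑ σ, gibbs H σ * Real.exp (N / 16 * D σ) ≤ 2 ^ k at hU
  have hw := gibbs_nonneg H
  have hw1 := sum_gibbs H
  obtain ⟨hpos, hlow⟩ := sum_mul_le_log_sum_exp (f := f) hw hw1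
  have hlog : Real.log (annealed β h g k) = ∑ i, Real.log (Real.cosh (H i)) +
      Real.log (∑ σ, gibbs H σ * Real.exp (f σ)) := by
    rw [annealed_eq β h g k H, Real.log_mul (Finset.prod_ne_zero_iff.2
      fun i _ => (Real.cosh_pos _).ne') hpos.ne', Real.log_prod fun i _ => (Real.cosh_pos _).ne']
  have e0 : (N : ℝ)⁻¹ * Real.log (annealed β h g k) -
      (N : ℝ)⁻¹ * ∑ i, Real.log (Real.cosh (H i)) - R =
      (Real.log (∑ σ, gibbs H σ * Real.exp (f σ)) - N * R) / N := by
    rw [hlog]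
    field_simp
    ring
  have hup : Real.log (∑ σ, gibbs H σ * Real.exp (f σ)) ≤
      N * (R + 16 * G + β * Δ) + 2 ^ k := by
    have h1 : ∑ σ, gibbs H σ * Real.exp (f σ) ≤
        Real.exp (N * (R + 16 * G + β * Δ)) * 2 ^ k := by
      refine le_trans ?_ (mul_le_mul_of_nonneg_left hU (Real.exp_pos _).le)
      rw [Finset.mul_sum]
      refine Finset.sum_le_sum fun σ _ => ?_
      rw [mul_left_comm, ← Real.exp_add]
      refine mul_le_mul_of_nonneg_left (Real.exp_le_exp.2 ?_) (hw σ)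
      have h2 := (abs_le.1 (hexp σ)).2
      have h3 := (abs_le.1 (hLb σ)).2
      have h4 := mul_le_mul_of_nonneg_right hβ2 (hD0 σ)
      have h5 : f σ / N ≤ R + 16 * G + β * Δ + D σ / 16 := by linarith
      rw [div_le_iff₀ hN'] at h5
      linarith
    have h2 := Real.log_le_log hpos h1
    rw [Real.log_mul (Real.exp_pos _).ne' (by positivity), Real.log_exp] at h2
    -- The crude `log (2 ^ k) ≤ 2 ^ k` suffices, as the term is later divided by `N` at fixed `k`.
    have h3 := Real.log_le_sub_one_of_pos (show (0 : ℝ) < 2 ^ k by positivity)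
    linarith
  have hdown : N * (R - β * Δ) - 2 ^ k ≤ Real.log (∑ σ, gibbs H σ * Real.exp (f σ)) := by
    refine le_trans ?_ hlow
    have h0 : ∑ σ, gibbs H σ * L σ = 0 := by
      simp only [hL, Finset.mul_sum]
      rw [Finset.sum_comm]
      refine Finset.sum_eq_zero fun m _ => ?_
      simp only [mul_add, mul_left_comm (gibbs H _)]
      rw [Finset.sum_add_distrib, ← Finset.mul_sum, ← Finset.mul_sum, sum_gibbs_mul_sub,
        sum_gibbs_mul_sub, mul_zero, mul_zero, add_zero]
    -- The mean of `D` follows from its exponential moment through `x + 1 ≤ exp x`.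
    have h1 : ∑ σ, gibbs H σ * (N / 16 * D σ) ≤ 2 ^ k := by
      refine le_trans (Finset.sum_le_sum fun σ _ => mul_le_mul_of_nonneg_left ?_ (hw σ)) hU
      linarith [Real.add_one_le_exp (N / 16 * D σ)]
    have h2 : ∑ σ, gibbs H σ * (N * (R - β * Δ) + N * L σ - N / 16 * D σ) ≤
        ∑ σ, gibbs H σ * f σ := by
      refine Finset.sum_le_sum fun σ _ => mul_le_mul_of_nonneg_left ?_ (hw σ)
      have h2 := (abs_le.1 (hexp σ)).1
      have h4 := mul_le_mul_of_nonneg_right hβ2 (hD0 σ)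
      have h5 : R - β * Δ + L σ - D σ / 16 ≤ f σ / N := by linarith [hD0 σ]
      rw [le_div_iff₀ hN'] at h5
      linarith
    have h3 : ∀ r : ℝ, ∑ σ, gibbs H σ * (r + N * L σ - N / 16 * D σ) =
        r * ∑ σ, gibbs H σ + N * ∑ σ, gibbs H σ * L σ -
          ∑ σ, gibbs H σ * (N / 16 * D σ) := by
      intro r
      rw [Finset.mul_sum, Finset.mul_sum, ← Finset.sum_add_distrib, ← Finset.sum_sub_distrib]
      exact Finset.sum_congr rfl fun σ _ => by ring
    rw [h3, hw1, h0] at h2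
    linarith
  rw [e0, abs_le, le_div_iff₀ hN', div_le_iff₀ hN']
  have e1 : (16 * G + β * Δ + 2 ^ k / (N : ℝ)) * N = N * (16 * G) + N * (β * Δ) + 2 ^ k := by
    field_simp
  have h16 : 0 ≤ (N : ℝ) * (16 * G) := by positivity
  rw [neg_mul, e1]
  constructor
  · linarith
  · linarith

end laplace

/-! ### The limit in probability of the annealed free energy -/

section limit

variable {N : ℕ}

/-- The Gram matrix differs from the identity by entries of total absolute value at most one, so its
quadratic form is at most twice that of the identity. -/
theorem nrm_sum_smul_sq_le (v : ℕ → Fin N → ℝ) (k : ℕ)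
    (hv : ∑ m ∈ Finset.Icc 1 k, ∑ n ∈ Finset.Icc 1 k, |ip (v m) (v n) - if m = n then 1 else 0| ≤ 1)
    (t : ℕ → ℝ) : nrm (∑ m ∈ Finset.Icc 1 k, t m • v m) ^ 2 ≤ 2 * ∑ m ∈ Finset.Icc 1 k, t m ^ 2 := by
  set I := Finset.Icc 1 k
  set S := ∑ m ∈ I, t m ^ 2
  have hS : ∀ m ∈ I, t m ^ 2 ≤ S := fun m hm =>
    Finset.single_le_sum (f := fun m => t m ^ 2) (fun _ _ => sq_nonneg _) hm
  have hS0 : 0 ≤ S := Finset.sum_nonneg fun _ _ => sq_nonneg _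
  have e1 : nrm (∑ m ∈ I, t m • v m) ^ 2 = ∑ m ∈ I, ∑ n ∈ I, t m * t n * ip (v m) (v n) := by
    rw [nrm_sq, ip_sum_left]
    refine Finset.sum_congr rfl fun m _ => ?_
    rw [ip_sum_right]
    refine Finset.sum_congr rfl fun n _ => ?_
    rw [ip_smul_left, ip_smul_right, mul_assoc]
  have e2 : S = ∑ m ∈ I, ∑ n ∈ I, t m * t n * (if m = n then 1 else 0) := by
    refine Finset.sum_congr rfl fun m hm => ?_
    simp [hm, sq]
  have h1 : nrm (∑ m ∈ I, t m • v m) ^ 2 - S ≤ S * 1 := by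
    refine le_trans ?_ (mul_le_mul_of_nonneg_left hv hS0)
    conv_lhs => rw [e1, e2]
    rw [← Finset.sum_sub_distrib, Finset.mul_sum]
    refine Finset.sum_le_sum fun m hm => ?_
    rw [← Finset.sum_sub_distrib, Finset.mul_sum]
    refine Finset.sum_le_sum fun n hn => ?_
    rw [← mul_sub]
    refine (le_abs_self _).trans ?_
    rw [abs_mul]
    refine mul_le_mul_of_nonneg_right ?_ (abs_nonneg _)
    rw [abs_le]
    have h2 := hS m hm
    have h3 := hS n hn
    constructor
    · nlinarith [sq_nonneg (t m + t n)]
    · nlinarith [sq_nonneg (t m - t n)]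
  linarith

variable {β h : ℝ} (hβ : 0 < β) (hβ1 : β < 1) (hh : 0 < h)

/-- The limit of `mainTerm` as `N → ∞`. -/
noncomputable def mainLimit (β h : ℝ) (k : ℕ) : ℝ :=
  β * ∑ m ∈ Finset.Icc 1 k, β * fieldCoeff β h k m * (1 - overlap β h) *
      (gamma β h m - fieldCoeff β h k m) +
    β ^ 2 / 4 * (1 - GammaSq β h k) ^ 2

/-- The limit of `gradTerm` as `N → ∞`. -/
noncomputable def gradLimit (β h : ℝ) (k : ℕ) : ℝ :=
  ∑ m ∈ Finset.Icc 1 k, (β * (β * fieldCoeff β h k m * (1 - overlap β h)) -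
      β ^ 2 * (1 - GammaSq β h k) * gamma β h m) ^ 2 +
    ∑ m ∈ Finset.Icc 1 k, (β * (gamma β h m - fieldCoeff β h k m)) ^ 2

theorem gradLimit_nonneg (β h : ℝ) (k : ℕ) : 0 ≤ gradLimit β h k :=
  add_nonneg (Finset.sum_nonneg fun _ _ => sq_nonneg _) (Finset.sum_nonneg fun _ _ => sq_nonneg _)

/-- The coefficients of the field coincide with the limits `γ_m` for all but the last index, so only
one summand survives. -/
theorem mainLimit_succ (β h : ℝ) (k : ℕ) : mainLimit β h (k + 1) =
    β * (β * √(overlap β h - GammaSq β h k) * (1 - overlap β h) *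
      (gamma β h (k + 1) - √(overlap β h - GammaSq β h k))) +
    β ^ 2 / 4 * (1 - GammaSq β h (k + 1)) ^ 2 := by
  rw [mainLimit, Finset.sum_Icc_succ_top (by omega), fieldCoeff_self, Nat.add_sub_cancel,
    Finset.sum_eq_zero, zero_add]
  intro m hm
  have := Finset.mem_Icc.1 hm
  rw [fieldCoeff_of_lt (by omega), sub_self, mul_zero]

/-- For the earlier indices the second family of summands vanishes and the first reduces to `β² γ_m
(Γ_{k+1}² - q)`. The iterates are thus approximate critical points, and the gradient disappears as
`Γ² → q`. -/
theorem gradLimit_succ (β h : ℝ) (k : ℕ) : gradLimit β h (k + 1) =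
    β ^ 4 * (GammaSq β h (k + 1) - overlap β h) ^ 2 * GammaSq β h k +
      (β * (β * √(overlap β h - GammaSq β h k) * (1 - overlap β h)) -
        β ^ 2 * (1 - GammaSq β h (k + 1)) * gamma β h (k + 1)) ^ 2 +
      (β * (gamma β h (k + 1) - √(overlap β h - GammaSq β h k))) ^ 2 := by
  have e1 : ∑ m ∈ Finset.Icc 1 k, (β * (gamma β h m - fieldCoeff β h (k + 1) m)) ^ 2 = 0 := by
    refine Finset.sum_eq_zero fun m hm => ?_
    have := Finset.mem_Icc.1 hm
    rw [fieldCoeff_of_lt (by omega), sub_self, mul_zero, zero_pow two_ne_zero]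
  have e2 : ∑ m ∈ Finset.Icc 1 k, (β * (β * fieldCoeff β h (k + 1) m * (1 - overlap β h)) -
      β ^ 2 * (1 - GammaSq β h (k + 1)) * gamma β h m) ^ 2 =
      β ^ 4 * (GammaSq β h (k + 1) - overlap β h) ^ 2 * GammaSq β h k := by
    conv_rhs => rw [GammaSq.eq_def β h k]
    rw [Finset.mul_sum]
    refine Finset.sum_congr rfl fun m hm => ?_
    have := Finset.mem_Icc.1 hm
    rw [fieldCoeff_of_lt (by omega)]
    ring
  rw [gradLimit, Finset.sum_Icc_succ_top (by omega), Finset.sum_Icc_succ_top (by omega), e1, e2,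
    fieldCoeff_self, Nat.add_sub_cancel, zero_add]

/-- An upper bound for the distance between the annealed free energy and the replica-symmetric
formula, as `N → ∞`. -/
noncomputable def limitError (β h : ℝ) (k : ℕ) : ℝ :=
  |mainLimit β h k - β ^ 2 * (1 - overlap β h) ^ 2 / 4| + 16 * gradLimit β h k

include hβ hβ1 hh

/-- `γ_{k+1}²` is the increment of the convergent sequence `Γ_k²`. -/
theorem tendsto_gamma_zero : Tendsto (fun k => gamma β h (k + 1)) atTop (𝓝 0) := by
  have h1 := tendsto_GammaSq hβ hβ1 hh
  have h2 := (h1.comp (tendsto_add_atTop_nat 1)).sub h1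
  rw [sub_self] at h2
  have h3 := h2.sqrt
  rw [Real.sqrt_zero] at h3
  refine h3.congr fun k => ?_
  simp only [Function.comp_apply]
  rw [GammaSq_succ, add_sub_cancel_left, Real.sqrt_sq (gamma_nonneg hβ hβ1 hh k)]

theorem tendsto_sqrt_sub_GammaSq :
    Tendsto (fun k => √(overlap β h - GammaSq β h k)) atTop (𝓝 0) := by
  have h1 := ((tendsto_const_nhds (x := overlap β h)).sub (tendsto_GammaSq hβ hβ1 hh)).sqrt
  rwa [sub_self, Real.sqrt_zero] at h1

theorem tendsto_mainLimit :
    Tendsto (mainLimit β h) atTop (𝓝 (β ^ 2 * (1 - overlap β h) ^ 2 / 4)) := by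
  rw [← tendsto_add_atTop_iff_nat 1]
  simp only [mainLimit_succ]
  have h1 : Tendsto (fun k => GammaSq β h (k + 1)) atTop (𝓝 (overlap β h)) :=
    (tendsto_GammaSq hβ hβ1 hh).comp (tendsto_add_atTop_nat 1)
  have h2 := tendsto_gamma_zero hβ hβ1 hh
  have h3 := tendsto_sqrt_sub_GammaSq hβ hβ1 hh
  have h4 := ((((h3.const_mul β).mul_const (1 - overlap β h)).mul (h2.sub h3)).const_mul β).add
    (((h1.const_sub 1).pow 2).const_mul (β ^ 2 / 4))
  convert h4 using 2
  ring

theorem tendsto_gradLimit : Tendsto (gradLimit β h) atTop (𝓝 0) := by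
  rw [← tendsto_add_atTop_iff_nat 1]
  simp only [gradLimit_succ]
  have h0 := tendsto_GammaSq hβ hβ1 hh
  have h1 : Tendsto (fun k => GammaSq β h (k + 1)) atTop (𝓝 (overlap β h)) :=
    h0.comp (tendsto_add_atTop_nat 1)
  have h2 := tendsto_gamma_zero hβ hβ1 hh
  have h3 := tendsto_sqrt_sub_GammaSq hβ hβ1 hh
  have h4 := (((((h1.sub_const (overlap β h)).pow 2).const_mul (β ^ 4)).mul h0).add
    ((((h3.const_mul β).mul_const (1 - overlap β h)).const_mul β).sub
      (((h1.const_sub 1).const_mul (β ^ 2)).mul h2) |>.pow 2)).add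
    (((h2.sub h3).const_mul β).pow 2)
  convert h4 using 2
  ring

theorem tendsto_limitError : Tendsto (limitError β h) atTop (𝓝 0) := by
  have h1 := ((tendsto_mainLimit hβ hβ1 hh).sub_const
    (β ^ 2 * (1 - overlap β h) ^ 2 / 4)).abs.add ((tendsto_gradLimit hβ hβ1 hh).const_mul 16)
  simp only [sub_self, abs_zero, mul_zero, add_zero] at h1
  exact h1

theorem eventually_nrm_sum_smul_zeta_le (k : ℕ) : ∀ᶠ p in whp, ∀ t : ℕ → ℝ,
    nrm (∑ m ∈ Finset.Icc 1 k, t m • zeta (iter β h (matrixAt β h k p) m)) ^ 2 ≤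
      2 * ∑ m ∈ Finset.Icc 1 k, t m ^ 2 := by
  have h1 : Tendsto (fun p : SampleSpace => ∑ m ∈ Finset.Icc 1 k, ∑ n ∈ Finset.Icc 1 k,
      |ip (zeta (iter β h (matrixAt β h k p) m)) (zeta (iter β h (matrixAt β h k p) n)) -
        if m = n then 1 else 0|) whp
      (𝓝 (∑ m ∈ Finset.Icc 1 k, ∑ n ∈ Finset.Icc 1 k, (0 : ℝ))) := by
    refine tendsto_finsetSum _ fun m hm => tendsto_finsetSum _ fun n hn => ?_
    have h2 := (tendsto_ip_zeta (β := β) (h := h) hm hn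
      (controlled hβ hβ1 hh m (Finset.mem_Icc.1 hm).1 (Finset.mem_Icc.1 hm).2)
      (controlled hβ hβ1 hh n (Finset.mem_Icc.1 hn).1 (Finset.mem_Icc.1 hn).2)).sub_const
      (if m = n then 1 else 0)
    simpa only [sub_self, abs_zero] using h2.abs
  simp only [Finset.sum_const_zero] at h1
  filter_upwards [h1.eventually_le_const zero_lt_one] with p hp t
  exact nrm_sum_smul_sq_le (fun m => zeta (iter β h (matrixAt β h k p) m)) k hp t

variable {k : ℕ} (hk : 1 ≤ k)

include hk

theorem tendsto_mainTerm :
    Tendsto (fun p => mainTerm β h (matrixAt β h k p) k) whp (𝓝 (mainLimit β h k)) := by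
  have hc : ∀ m, 1 ≤ m → m ≤ k → Controlled β h k m := fun m h1 h2 =>
    controlled hβ hβ1 hh m h1 h2
  have hφ := fun (m) (hm : m ∈ Finset.Icc 1 k) =>
    tendsto_ip_nextMag_phi hβ hβ1 hh le_rfl hc m (Finset.mem_Icc.1 hm).1 k
      (Finset.mem_Icc.1 hm).2 le_rfl
  have hζ := fun (m) (hm : m ∈ Finset.Icc 1 k) =>
    tendsto_ip_nextMag_zeta hβ hβ1 hh hk le_rfl (Finset.mem_Icc.1 hm).1
      (Finset.mem_Icc.1 hm).2 hc
  have hS := tendsto_finsetSum (Finset.Icc 1 k) fun m hm => (hφ m hm).pow 2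
  exact ((tendsto_finsetSum _ fun m hm => (hζ m hm).mul ((hφ m hm).sub_const _)).const_mul β).add
    (((hS.const_sub 1).pow 2).const_mul (β ^ 2 / 4))

theorem tendsto_gradTerm :
    Tendsto (fun p => gradTerm β h (matrixAt β h k p) k) whp (𝓝 (gradLimit β h k)) := by
  have hc : ∀ m, 1 ≤ m → m ≤ k → Controlled β h k m := fun m h1 h2 =>
    controlled hβ hβ1 hh m h1 h2
  have hφ := fun (m) (hm : m ∈ Finset.Icc 1 k) =>
    tendsto_ip_nextMag_phi hβ hβ1 hh le_rfl hc m (Finset.mem_Icc.1 hm).1 k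
      (Finset.mem_Icc.1 hm).2 le_rfl
  have hζ := fun (m) (hm : m ∈ Finset.Icc 1 k) =>
    tendsto_ip_nextMag_zeta hβ hβ1 hh hk le_rfl (Finset.mem_Icc.1 hm).1
      (Finset.mem_Icc.1 hm).2 hc
  have hS := tendsto_finsetSum (Finset.Icc 1 k) fun m hm => (hφ m hm).pow 2
  exact (tendsto_finsetSum _ fun m hm => (((hζ m hm).const_mul β).sub
      (((hS.const_sub 1).const_mul (β ^ 2)).mul (hφ m hm))).pow 2).add
    (tendsto_finsetSum _ fun m hm => (((hφ m hm).sub_const _).const_mul β).pow 2)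

theorem eventually_abs_log_annealed_sub_RS_le (hβ2 : β ≤ 1 / 16) {ε : ℝ} (hε : 0 < ε) :
    ∀ᶠ p : SampleSpace in whp,
      |(p.1 : ℝ)⁻¹ * Real.log (annealed β h (matrixAt β h k p) k) - RS β h| ≤
        limitError β h k + ε := by
  have hc : ∀ m, 1 ≤ m → m ≤ k → Controlled β h k m := fun m h1 h2 =>
    controlled hβ hβ1 hh m h1 h2
  have hδ : Tendsto (fun p : SampleSpace => ∑ m ∈ Finset.Icc 1 k,
      |ip (phi β h (matrixAt β h k p) m) (xi (iter β h (matrixAt β h k p) m))|) whp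
      (𝓝 (∑ m ∈ Finset.Icc 1 k, |(0 : ℝ)|)) := tendsto_finsetSum _ fun m hm => by
    have := Finset.mem_Icc.1 hm
    exact (tendsto_ip_phi_xi this.1 this.2 (hc m this.1 this.2)).abs
  have hN : Tendsto (fun p : SampleSpace => (2 : ℝ) ^ k / (p.1 : ℝ)) whp (𝓝 0) :=
    (tendsto_const_div_atTop_nhds_zero_nat _).comp tendsto_whp_fst
  have hE := (((tendsto_gradTerm hβ hβ1 hh hk).const_mul 16).add (hδ.const_mul β)).add hN
  have hlc := (tendsto_average_log_cosh hβ hβ1 hh hk le_rfl hc).add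
    (tendsto_mainTerm hβ hβ1 hh hk)
  have hD := ((hlc.sub_const (RS β h)).abs.add hE)
  have hRS : RS β h = (∫ x, Real.log (Real.cosh (h + β * √(overlap β h) * x)) ∂stdGauss) +
      β ^ 2 * (1 - overlap β h) ^ 2 / 4 := RS_eq (by nlinarith)
  have hlim : |(∫ x, Real.log (Real.cosh (h + β * √(overlap β h) * x)) ∂stdGauss) +
      mainLimit β h k - RS β h| + (16 * gradLimit β h k +
        β * ∑ m ∈ Finset.Icc 1 k, |(0 : ℝ)| + 0) = limitError β h k := by
    rw [hRS, limitError, add_sub_add_left_eq_sub]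
    simp
  rw [hlim] at hD
  filter_upwards [hD.eventually_le_const (show limitError β h k < limitError β h k + ε by linarith),
    eventually_whp_pos, eventually_nrm_sum_smul_zeta_le hβ hβ1 hh k] with p hp hpN hpζ
  refine le_trans ?_ hp
  have h1 := abs_log_annealed_sub_le hpN hβ hβ2 h (matrixAt β h k p) hk hpζ
  have h2 := abs_add_le ((p.1 : ℝ)⁻¹ * ∑ i, Real.log (Real.cosh
      (nextField β h (iter β h (matrixAt β h k p)) k i)) + mainTerm β h (matrixAt β h k p) k -
      RS β h) ((p.1 : ℝ)⁻¹ * Real.log (annealed β h (matrixAt β h k p) k) -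
        (p.1 : ℝ)⁻¹ * ∑ i, Real.log (Real.cosh
          (nextField β h (iter β h (matrixAt β h k p)) k i)) - mainTerm β h (matrixAt β h k p) k)
  refine le_trans (le_of_eq ?_) (h2.trans (add_le_add le_rfl h1))
  congr 1
  ring

end limit

/-! ### From convergence in probability to convergence in the mean -/

/-- Uniform integrability in quantitative form: outside a bad set `A` of vanishing probability `|X|
≤ e + ε`, and everywhere `|X| ≤ T + X² / T`. The mean is then at most `e + ε`, plus `T` times the
probability of `A`, plus `S / T`. -/
theorem limsup_lintegral_le {X W : SampleSpace → ℝ}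
    (hX : ∀ N, Measurable fun ω : BaseSpace N => X ⟨N, ω⟩) {e S : ℝ} (he : 0 ≤ e) (hS : 0 ≤ S)
    (hbound : ∀ ε > 0, ∀ᶠ p in whp, |X p| ≤ e + ε)
    (hW : ∀ N, 0 < N → ∫⁻ ω, ENNReal.ofReal (W ⟨N, ω⟩) ∂(baseMeasure N) ≤ ENNReal.ofReal S)
    (hXW : ∀ p : SampleSpace, 0 < p.1 → X p ^ 2 ≤ W p) :
    limsup (fun N => ∫⁻ ω, ENNReal.ofReal |X ⟨N, ω⟩| ∂(baseMeasure N)) atTop ≤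
      ENNReal.ofReal e := by
  have key : ∀ ε > 0, limsup (fun N => ∫⁻ ω, ENNReal.ofReal |X ⟨N, ω⟩| ∂(baseMeasure N)) atTop ≤
      ENNReal.ofReal (e + 3 * ε) := by
    intro ε hε
    -- This level makes `S / T ≤ ε`; the added `1` keeps it positive when `S = 0`. It does not
    -- depend on `N`, so `T` times the bad probability still tends to zero.
    set T : ℝ := (S + 1) / ε with hT
    have hT0 : 0 < T := by positivity
    have hST : T⁻¹ * S ≤ ε := by
      rw [hT, inv_div, div_mul_eq_mul_div, div_le_iff₀ (by positivity)]
      nlinarith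
    have hbad := mem_whp.1 (hbound ε hε)
    have hbad2 : ∀ᶠ N in atTop, ENNReal.ofReal T *
        baseMeasure N {ω | (⟨N, ω⟩ : SampleSpace) ∉ {p | |X p| ≤ e + ε}} ≤ ENNReal.ofReal ε := by
      have h1 := ENNReal.Tendsto.const_mul hbad (Or.inr (ENNReal.ofReal_ne_top (r := T)))
      rw [mul_zero] at h1
      exact h1.eventually_le_const (ENNReal.ofReal_pos.2 hε)
    refine limsup_le_of_le (by isBoundedDefault) ?_
    filter_upwards [hbad2, eventually_gt_atTop 0] with N hN1 hN
    set A : Set (BaseSpace N) := {ω | (⟨N, ω⟩ : SampleSpace) ∉ {p | |X p| ≤ e + ε}} with hA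
    have hAm : MeasurableSet A := by
      have : A = {ω | |X ⟨N, ω⟩| ≤ e + ε}ᶜ := rfl
      rw [this]
      exact (measurableSet_le (hX N).abs measurable_const).compl
    have hpt : ∀ ω : BaseSpace N, ENNReal.ofReal |X ⟨N, ω⟩| ≤
        (ENNReal.ofReal (e + ε) + A.indicator (fun _ => ENNReal.ofReal T) ω) +
          ENNReal.ofReal T⁻¹ * ENNReal.ofReal (W ⟨N, ω⟩) := by
      intro ω
      by_cases hω : ω ∈ A
      · rw [Set.indicator_of_mem hω, add_right_comm]
        refine le_trans ?_ (add_le_add_left le_add_self _)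
        rw [← ENNReal.ofReal_mul (inv_nonneg.2 hT0.le), ← ENNReal.ofReal_add
          (mul_nonneg (inv_nonneg.2 hT0.le) ((sq_nonneg _).trans (hXW ⟨N, ω⟩ hN))) hT0.le]
        refine ENNReal.ofReal_le_ofReal ?_
        have h1 := hXW ⟨N, ω⟩ hN
        rw [← sq_abs] at h1
        have h2 : |X ⟨N, ω⟩| ≤ T⁻¹ * |X ⟨N, ω⟩| ^ 2 + T := by
          rcases le_or_gt |X ⟨N, ω⟩| T with h3 | h3
          · have : 0 ≤ T⁻¹ * |X ⟨N, ω⟩| ^ 2 := by positivity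
            linarith
          · have h4 : |X ⟨N, ω⟩| ≤ T⁻¹ * |X ⟨N, ω⟩| ^ 2 := by
              rw [inv_mul_eq_div, le_div_iff₀ hT0, sq]
              exact mul_le_mul_of_nonneg_left h3.le (abs_nonneg _)
            linarith
        have h3 := mul_le_mul_of_nonneg_left h1 (inv_nonneg.2 hT0.le)
        linarith
      · rw [Set.indicator_of_notMem hω, add_zero]
        refine le_trans (ENNReal.ofReal_le_ofReal ?_) le_self_add
        simpa [hA] using hω
    refine (lintegral_mono hpt).trans ?_
    have hm1 : Measurable fun ω : BaseSpace N =>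
        ENNReal.ofReal (e + ε) + A.indicator (fun _ => ENNReal.ofReal T) ω :=
      (measurable_const (a := ENNReal.ofReal (e + ε))).add
        ((measurable_const (a := ENNReal.ofReal T)).indicator hAm)
    rw [lintegral_add_left hm1,
      lintegral_add_left measurable_const, lintegral_const, measure_univ, mul_one,
      lintegral_indicator_const hAm, lintegral_const_mul' _ _ ENNReal.ofReal_ne_top]
    have h1 : ENNReal.ofReal T⁻¹ * ∫⁻ ω, ENNReal.ofReal (W ⟨N, ω⟩) ∂(baseMeasure N) ≤
        ENNReal.ofReal ε := by
      refine (mul_le_mul_right (hW N hN) _).trans ?_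
      rw [← ENNReal.ofReal_mul (inv_nonneg.2 hT0.le)]
      exact ENNReal.ofReal_le_ofReal hST
    refine (add_le_add (add_le_add le_rfl hN1) h1).trans ?_
    rw [← ENNReal.ofReal_add (by positivity) hε.le, ← ENNReal.ofReal_add (by positivity) hε.le]
    refine ENNReal.ofReal_le_ofReal (le_of_eq (by ring))
  have hlim : Tendsto (fun ε : ℝ => ENNReal.ofReal (e + 3 * ε)) (𝓝[>] 0) (𝓝 (ENNReal.ofReal e)) := by
    refine ENNReal.tendsto_ofReal (tendsto_nhdsWithin_of_tendsto_nhds ?_)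
    have : Continuous fun ε : ℝ => e + 3 * ε := by fun_prop
    simpa using this.tendsto 0
  exact ge_of_tendsto hlim (eventually_nhdsWithin_of_forall fun ε hε => key ε hε)

/-! ### Second-moment bounds that are uniform in `N`. -/

section moments

variable {N : ℕ}

theorem abs_log_annealed_le (hN : 0 < N) (β h : ℝ) (g : Matrix (Fin N) (Fin N) ℝ) (k : ℕ) {B : ℝ}
    (hB : ∀ σ : Fin N → Bool, |exponent β h g k (spinVec σ)| ≤ B) :
    |(N : ℝ)⁻¹ * Real.log (annealed β h g k)| ≤ B := by
  have hN' : (0 : ℝ) < N := by exact_mod_cast hN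
  have hcard : ((Finset.univ : Finset (Fin N → Bool)).card : ℝ) = 2 ^ N := by
    simp
  have e : ∀ r : ℝ, r = (2 ^ N : ℝ)⁻¹ * ∑ _σ : Fin N → Bool, r := fun r => by
    rw [Finset.sum_const, nsmul_eq_mul, hcard]
    field_simp
  have hup : annealed β h g k ≤ Real.exp (N * B) := by
    rw [e (Real.exp (N * B)), annealed]
    refine mul_le_mul_of_nonneg_left (Finset.sum_le_sum fun σ _ => Real.exp_le_exp.2 ?_)
      (by positivity)
    exact mul_le_mul_of_nonneg_left (abs_le.1 (hB σ)).2 hN'.le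
  have hlow : Real.exp (-(N * B)) ≤ annealed β h g k := by
    rw [e (Real.exp (-(N * B))), annealed]
    refine mul_le_mul_of_nonneg_left (Finset.sum_le_sum fun σ _ => Real.exp_le_exp.2 ?_)
      (by positivity)
    rw [← mul_neg]
    exact mul_le_mul_of_nonneg_left (abs_le.1 (hB σ)).1 hN'.le
  have hpos := (Real.exp_pos _).trans_le hlow
  have h1 := (Real.log_le_iff_le_exp hpos).2 hup
  have h2 := (Real.le_log_iff_exp_le hpos).2 hlow
  rw [abs_mul, abs_of_pos (inv_pos.2 hN'), inv_mul_le_iff₀ hN', abs_le]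
  exact ⟨h2, h1⟩

theorem abs_exponent_le (hN : 0 < N) {β h : ℝ} (hβ : 0 < β) (hβ1 : β ≤ 1) (hh : 0 < h)
    (g : Matrix (Fin N) (Fin N) ℝ) (k : ℕ) (σ : Fin N → Bool) :
    |exponent β h g k (spinVec σ)| ≤ h + 1 + 2 * ∑ m ∈ Finset.Icc 1 k,
      (nrm (xi (iter β h g m)) + nrm (eta (iter β h g m))) := by
  have hs : nrm (spinVec σ) = 1 := by rw [nrm, ip_spinVec_self hN, Real.sqrt_one]
  have hφ : ∀ m ∈ Finset.Icc 1 k, nrm (phi β h g m) ≤ 1 := fun m hm =>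
    nrm_phi_le_one β h g (Finset.mem_Icc.1 hm).1
  have hX : ∀ m ∈ Finset.Icc 1 k, |ip (spinVec σ) (phi β h g m)| ≤ 1 := fun m hm => by
    refine (abs_ip_le _ _).trans ?_
    rw [hs, one_mul]
    exact hφ m hm
  have hsq2 : (1 : ℝ) ≤ √2 := Real.one_le_sqrt.2 one_le_two
  have hζ : ∀ m, nrm (zeta (iter β h g m)) ≤ nrm (xi (iter β h g m)) + nrm (eta (iter β h g m)) := by
    intro m
    have e : zeta (iter β h g m) = (√2)⁻¹ • (xi (iter β h g m) + eta (iter β h g m)) := by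
      funext i
      simp [zeta, div_eq_inv_mul]
    rw [e, nrm_smul, abs_of_nonneg (by positivity)]
    refine (mul_le_of_le_one_left (nrm_nonneg _) (inv_le_one_of_one_le₀ hsq2)).trans
      (nrm_add_le _ _)
  have h1 : |h * ip (spinVec σ) 1| ≤ h := by
    rw [abs_mul, abs_of_pos hh]
    refine mul_le_of_le_one_right hh.le ((abs_ip_le _ _).trans ?_)
    rw [hs, one_mul]
    exact nrm_le_one_of_abs_le fun i => by simp
  have h2 : |β * ∑ m ∈ Finset.Icc 1 k, ip (spinVec σ) (zeta (iter β h g m)) *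
      ip (spinVec σ) (phi β h g m)| ≤
      ∑ m ∈ Finset.Icc 1 k, (nrm (xi (iter β h g m)) + nrm (eta (iter β h g m))) := by
    rw [abs_mul, abs_of_pos hβ]
    refine (mul_le_of_le_one_left (abs_nonneg _) hβ1).trans
      ((Finset.abs_sum_le_sum_abs _ _).trans (Finset.sum_le_sum fun m hm => ?_))
    rw [abs_mul]
    refine (mul_le_of_le_one_right (abs_nonneg _) (hX m hm)).trans ((abs_ip_le _ _).trans ?_)
    rw [hs, one_mul]
    exact hζ m
  have h3 : |β / √2 * ∑ m ∈ Finset.Icc 1 k, ip (phi β h g m) (xi (iter β h g m)) *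
      ip (spinVec σ) (phi β h g m) ^ 2| ≤
      ∑ m ∈ Finset.Icc 1 k, (nrm (xi (iter β h g m)) + nrm (eta (iter β h g m))) := by
    rw [abs_mul, abs_of_nonneg (by positivity : 0 ≤ β / √2)]
    refine (mul_le_of_le_one_left (abs_nonneg _) ((div_le_self hβ.le hsq2).trans hβ1)).trans
      ((Finset.abs_sum_le_sum_abs _ _).trans (Finset.sum_le_sum fun m hm => ?_))
    rw [abs_mul, abs_pow]
    refine (mul_le_of_le_one_right (abs_nonneg _)
      (pow_le_one₀ (abs_nonneg _) (hX m hm))).trans ((abs_ip_le _ _).trans ?_)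
    refine (mul_le_of_le_one_left (nrm_nonneg _) (hφ m hm)).trans ?_
    exact le_add_of_nonneg_right (nrm_nonneg _)
  have h4 : |β ^ 2 / 4 * (1 - ∑ m ∈ Finset.Icc 1 k, ip (spinVec σ) (phi β h g m) ^ 2) ^ 2| ≤ 1 := by
    have h5 := (sum_ip_phi_sq_le β h g k (spinVec σ)).trans (ip_spinVec_self hN σ).le
    have h6 : 0 ≤ ∑ m ∈ Finset.Icc 1 k, ip (spinVec σ) (phi β h g m) ^ 2 :=
      Finset.sum_nonneg fun _ _ => sq_nonneg _
    rw [abs_of_nonneg (by positivity)]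
    refine mul_le_one₀ (by nlinarith) (by positivity) (pow_le_one₀ (by linarith) (by linarith))
  rw [exponent]
  have h5 := abs_add_le (h * ip (spinVec σ) 1 + β * ∑ m ∈ Finset.Icc 1 k,
    ip (spinVec σ) (zeta (iter β h g m)) * ip (spinVec σ) (phi β h g m) -
    β / √2 * ∑ m ∈ Finset.Icc 1 k, ip (phi β h g m) (xi (iter β h g m)) *
      ip (spinVec σ) (phi β h g m) ^ 2)
    (β ^ 2 / 4 * (1 - ∑ m ∈ Finset.Icc 1 k, ip (spinVec σ) (phi β h g m) ^ 2) ^ 2)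
  have h6 := abs_sub (h * ip (spinVec σ) 1 + β * ∑ m ∈ Finset.Icc 1 k,
    ip (spinVec σ) (zeta (iter β h g m)) * ip (spinVec σ) (phi β h g m))
    (β / √2 * ∑ m ∈ Finset.Icc 1 k, ip (phi β h g m) (xi (iter β h g m)) *
      ip (spinVec σ) (phi β h g m) ^ 2)
  have h7 := abs_add_le (h * ip (spinVec σ) 1) (β * ∑ m ∈ Finset.Icc 1 k,
    ip (spinVec σ) (zeta (iter β h g m)) * ip (spinVec σ) (phi β h g m))
  linarith

theorem nrm_Qmat_mulVec_le (β h : ℝ) (g : Matrix (Fin N) (Fin N) ℝ) (k : ℕ) (v : Fin N → ℝ) :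
    nrm (Qmat β h g k *ᵥ v) ≤ nrm v := by
  rw [nrm, nrm, ip_Qmat_mulVec_self]
  refine Real.sqrt_le_sqrt (sub_le_self _ (Finset.sum_nonneg fun _ _ => sq_nonneg _))

/-- A vanishing direction gives `ξ = η = 0`. Otherwise the explicit formulas apply and contribute
`1` for `ξ` and `3` for `η`; no event has to be excluded. -/
theorem nrm_xi_add_nrm_eta_le (β h : ℝ) (ω : BaseSpace N) {m K : ℕ} (hm : 1 ≤ m) (hK : m ≤ K) :
    nrm (xi (iter β h (explored β h K ω) m)) + nrm (eta (iter β h (explored β h K ω) m)) ≤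
      4 * (nrm (yPart (noise m ω)) + nrm (yPart' (noise m ω))) := by
  obtain ⟨j, rfl⟩ : ∃ j, m = j + 1 := ⟨m - 1, by omega⟩
  set y := yPart (noise (j + 1) ω)
  set y' := yPart' (noise (j + 1) ω)
  have hy := nrm_nonneg y
  have hy' := nrm_nonneg y'
  have hφ1 := nrm_phi_le_one β h (explored β h K ω) hm
  rcases (orthoFamily_phi β h (explored β h K ω) (j + 1)).2 (j + 1)
    (Finset.mem_Icc.2 ⟨hm, le_rfl⟩) with h0 | hu
  · have e1 : xi (iter β h (explored β h K ω) (j + 1)) = 0 := by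
      rw [xi, show (iter β h (explored β h K ω) (j + 1)).2 = 0 from h0, Matrix.mulVec_zero]
    have e2 : eta (iter β h (explored β h K ω) (j + 1)) = 0 := by
      rw [eta, show (iter β h (explored β h K ω) (j + 1)).2 = 0 from h0, Matrix.mulVec_zero]
    rw [e1, e2, nrm_zero]
    linarith
  · have hs : (√2)⁻¹ ≤ (1 : ℝ) := inv_le_one_of_one_le₀ (Real.one_le_sqrt.2 one_le_two)
    have hs0 : (0 : ℝ) ≤ (√2)⁻¹ := by positivity
    have hx : nrm (xPart (noise (j + 1) ω)) ≤ nrm y + nrm y' := by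
      rw [xPart, nrm_smul, abs_of_nonneg hs0]
      exact (mul_le_of_le_one_left (nrm_nonneg _) hs).trans (nrm_add_le _ _)
    have hx' : nrm (xPart' (noise (j + 1) ω)) ≤ nrm y + nrm y' := by
      rw [xPart', nrm_smul, abs_of_nonneg hs0]
      refine (mul_le_of_le_one_left (nrm_nonneg _) hs).trans ?_
      have := nrm_add_le y (-y')
      rw [← sub_eq_add_neg] at this
      refine this.trans (le_of_eq ?_)
      rw [← neg_one_smul ℝ y', nrm_smul, abs_neg, abs_one, one_mul]
    have h1 : nrm (xi (iter β h (explored β h K ω) (j + 1))) ≤ nrm y + nrm y' := by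
      rw [xi_explored_of_unit hK hu]
      exact (nrm_Qmat_mulVec_le _ _ _ _ _).trans hx
    have h2 : nrm (eta (iter β h (explored β h K ω) (j + 1))) ≤ 3 * (nrm y + nrm y') := by
      rw [eta_explored_of_unit hK hu]
      refine (nrm_add_le _ _).trans ?_
      have h3 := (nrm_Qmat_mulVec_le β h (explored β h K ω) j (xPart' (noise (j + 1) ω))).trans hx'
      have h4 : nrm (ip (phi β h (explored β h K ω) (j + 1))
          (xPart (noise (j + 1) ω) - xPart' (noise (j + 1) ω)) •
          phi β h (explored β h K ω) (j + 1)) ≤ 2 * (nrm y + nrm y') := by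
        rw [nrm_smul]
        refine (mul_le_of_le_one_right (abs_nonneg _) hφ1).trans ((abs_ip_le _ _).trans ?_)
        refine (mul_le_of_le_one_left (nrm_nonneg _) hφ1).trans ?_
        have := nrm_add_le (xPart (noise (j + 1) ω)) (-xPart' (noise (j + 1) ω))
        rw [← sub_eq_add_neg, ← neg_one_smul ℝ (xPart' (noise (j + 1) ω)), nrm_smul, abs_neg,
          abs_one, one_mul] at this
        linarith
      linarith
    linarith

theorem integrable_ip_noise (m : ℕ) {L : (StepIndex N → ℝ) → Fin N → ℝ}
    (hL : L = yPart ∨ L = yPart') :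
    Integrable (fun ω : BaseSpace N => ip (L (noise m ω)) (L (noise m ω))) (baseMeasure N) ∧
      ∫ ω : BaseSpace N, ip (L (noise m ω)) (L (noise m ω)) ∂(baseMeasure N) ≤ 1 := by
  have hc : ∀ p : ℕ × StepIndex N, Integrable (fun ω : BaseSpace N => ω p * ω p) (baseMeasure N) ∧
      ∫ ω : BaseSpace N, ω p * ω p ∂(baseMeasure N) = 1 := by
    intro p
    have h1 : Integrable (fun x : ℝ => x * x) ((baseMeasure N).map fun ω => ω p) := by
      rw [map_coord]
      simpa only [sq] using integrable_sq_stdGauss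
    refine ⟨h1.comp_measurable (measurable_pi_apply p), ?_⟩
    have h2 := integral_map (μ := baseMeasure N) (φ := fun ω => ω p)
      (measurable_pi_apply p).aemeasurable h1.aestronglyMeasurable
    rw [map_coord] at h2
    rw [← h2]
    simpa only [sq] using integral_sq_stdGauss
  obtain ⟨s, hs⟩ : ∃ s : Fin N → StepIndex N, ∀ (r : StepIndex N → ℝ) i, L r i = r (s i) := by
    rcases hL with rfl | rfl
    · exact ⟨fun i => Sum.inr (Sum.inl i), fun _ _ => rfl⟩
    · exact ⟨fun i => Sum.inr (Sum.inr i), fun _ _ => rfl⟩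
  simp only [ip, hs, noise]
  refine ⟨(integrable_finsetSum _ fun i _ => (hc (m, s i)).1).const_mul _, ?_⟩
  rw [integral_const_mul, integral_finsetSum _ fun i _ => (hc (m, s i)).1]
  simp only [(hc _).2, Finset.sum_const, Finset.card_univ, Fintype.card_fin, nsmul_eq_mul, mul_one]
  exact inv_mul_le_one

end moments

/-- A dominating function for the square of the annealed free energy. -/
noncomputable def dominating (C : ℝ) (k : ℕ) (p : SampleSpace) : ℝ :=
  2 * C ^ 2 + 256 * k * ∑ m ∈ Finset.Icc 1 k,
    (ip (yPart (noise m p.2)) (yPart (noise m p.2)) +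
      ip (yPart' (noise m p.2)) (yPart' (noise m p.2)))

theorem lintegral_dominating_le (C : ℝ) (k N : ℕ) :
    ∫⁻ ω, ENNReal.ofReal (dominating C k ⟨N, ω⟩) ∂(baseMeasure N) ≤
      ENNReal.ofReal (2 * C ^ 2 + 512 * k ^ 2) := by
  have hi : ∀ m ∈ Finset.Icc 1 k, Integrable (fun ω : BaseSpace N =>
      ip (yPart (noise m ω)) (yPart (noise m ω)) + ip (yPart' (noise m ω)) (yPart' (noise m ω)))
      (baseMeasure N) := fun m _ =>
    (integrable_ip_noise m (Or.inl rfl)).1.add (integrable_ip_noise m (Or.inr rfl)).1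
  have hI : Integrable (fun ω : BaseSpace N => dominating C k ⟨N, ω⟩) (baseMeasure N) :=
    (integrable_const _).add ((integrable_finsetSum _ hi).const_mul _)
  have h0 : ∀ ω : BaseSpace N, 0 ≤ dominating C k ⟨N, ω⟩ := fun ω =>
    add_nonneg (by positivity) (mul_nonneg (by positivity) (Finset.sum_nonneg fun m _ =>
      add_nonneg (ip_self_nonneg _) (ip_self_nonneg _)))
  rw [← ofReal_integral_eq_lintegral_ofReal hI (Eventually.of_forall h0)]
  refine ENNReal.ofReal_le_ofReal ?_
  simp only [dominating]
  rw [integral_add (integrable_const _) ((integrable_finsetSum _ hi).const_mul _),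
    integral_const_mul (256 * (k : ℝ)), integral_finsetSum _ hi]
  have h1 : ∑ m ∈ Finset.Icc 1 k, ∫ ω : BaseSpace N,
      (ip (yPart (noise m ω)) (yPart (noise m ω)) + ip (yPart' (noise m ω)) (yPart' (noise m ω)))
      ∂(baseMeasure N) ≤ ∑ m ∈ Finset.Icc 1 k, (2 : ℝ) := by
    refine Finset.sum_le_sum fun m _ => ?_
    rw [integral_add (integrable_ip_noise m (Or.inl rfl)).1 (integrable_ip_noise m (Or.inr rfl)).1]
    have h2 := (integrable_ip_noise (N := N) m (Or.inl rfl)).2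
    have h3 := (integrable_ip_noise (N := N) m (Or.inr rfl)).2
    linarith
  rw [Finset.sum_const, Nat.card_Icc, Nat.add_sub_cancel, nsmul_eq_mul] at h1
  simp only [integral_const, probReal_univ, smul_eq_mul, one_mul]
  have h2 := mul_le_mul_of_nonneg_left h1 (show (0 : ℝ) ≤ 256 * k by positivity)
  linarith

/-- The absolute value is at most `C + 8 S`, with `8` from the factor `2` in `abs_exponent_le` and
the factor `4` in `nrm_xi_add_nrm_eta_le`. Squaring gives `2 C² + 128 S²`, and Cauchy–Schwarz over
the `k` steps turns `128` into `256 k`. -/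
theorem sq_log_annealed_sub_RS_le {β h : ℝ} (hβ : 0 < β) (hβ1 : β ≤ 1) (hh : 0 < h) (k : ℕ)
    (p : SampleSpace) (hp : 0 < p.1) :
    ((p.1 : ℝ)⁻¹ * Real.log (annealed β h (matrixAt β h k p) k) - RS β h) ^ 2 ≤
      dominating (h + 1 + |RS β h|) k p := by
  have h1 := abs_log_annealed_le hp β h (matrixAt β h k p) k
    fun σ => abs_exponent_le hp hβ hβ1 hh (matrixAt β h k p) k σ
  have h2 : ∑ m ∈ Finset.Icc 1 k, (nrm (xi (iter β h (matrixAt β h k p) m)) +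
      nrm (eta (iter β h (matrixAt β h k p) m))) ≤
      4 * ∑ m ∈ Finset.Icc 1 k, (nrm (yPart (noise m p.2)) + nrm (yPart' (noise m p.2))) := by
    rw [Finset.mul_sum]
    refine Finset.sum_le_sum fun m hm => ?_
    have := Finset.mem_Icc.1 hm
    exact nrm_xi_add_nrm_eta_le β h p.2 this.1 this.2
  set S := ∑ m ∈ Finset.Icc 1 k, (nrm (yPart (noise m p.2)) + nrm (yPart' (noise m p.2)))
  have h3 : S ^ 2 ≤ k * ∑ m ∈ Finset.Icc 1 k,
      2 * (ip (yPart (noise m p.2)) (yPart (noise m p.2)) +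
        ip (yPart' (noise m p.2)) (yPart' (noise m p.2))) := by
    refine sq_sum_le_card_mul_sum_sq.trans ?_
    rw [Nat.card_Icc, Nat.add_sub_cancel]
    refine mul_le_mul_of_nonneg_left (Finset.sum_le_sum fun m _ => ?_) (Nat.cast_nonneg k)
    rw [← nrm_sq, ← nrm_sq]
    exact add_sq_le
  have h4 := abs_sub ((p.1 : ℝ)⁻¹ * Real.log (annealed β h (matrixAt β h k p) k)) (RS β h)
  have h5 : |(p.1 : ℝ)⁻¹ * Real.log (annealed β h (matrixAt β h k p) k) - RS β h| ≤
      (h + 1 + |RS β h|) + 8 * S := by linarith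
  rw [← sq_abs]
  refine (pow_le_pow_left₀ (abs_nonneg _) h5 2).trans (add_sq_le.trans ?_)
  rw [dominating]
  rw [← Finset.mul_sum] at h3
  linarith

theorem measurable_annealed (β h : ℝ) (k N : ℕ) :
    Measurable fun g : Matrix (Fin N) (Fin N) ℝ => annealed β h g k :=
  measurable_annealed_of_measurable (g := id) β h (fun s _ _ => measurable_xi_iter β h s)
    fun s _ _ => measurable_eta_iter β h s

/-- `annealed` is a function of the matrix alone, and the matrix explored in `k` steps has law
`gaussMatrix N`, so the estimates on the exploration space transfer. -/
theorem limsup_lintegral_annealed_le {β h : ℝ} (hβ : 0 < β) (hβ1 : β ≤ 1 / 16) (hh : 0 < h) {k : ℕ}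
    (hk : 1 ≤ k) : limsup (fun N => ∫⁻ g, ENNReal.ofReal |(N : ℝ)⁻¹ *
      Real.log (annealed β h g k) - RS β h| ∂(gaussMatrix N)) atTop ≤
      ENNReal.ofReal (limitError β h k) := by
  have h1 := limsup_lintegral_le (X := fun p : SampleSpace =>
      (p.1 : ℝ)⁻¹ * Real.log (annealed β h (matrixAt β h k p) k) - RS β h)
    (W := dominating (h + 1 + |RS β h|) k) (e := limitError β h k)
    (S := 2 * (h + 1 + |RS β h|) ^ 2 + 512 * k ^ 2)
    (fun N => by
      have hA : Measurable fun ω : BaseSpace N => annealed β h (explored β h k ω) k :=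
        (measurable_annealed β h k N).comp (measurable_explored β h k)
      exact (hA.log.const_mul (N : ℝ)⁻¹).sub_const (RS β h))
    (add_nonneg (abs_nonneg _) (mul_nonneg (by norm_num) (gradLimit_nonneg β h k)))
    (by positivity)
    (fun ε hε => eventually_abs_log_annealed_sub_RS_le hβ (by linarith) hh hk hβ1 hε)
    (fun N _ => lintegral_dominating_le _ k N)
    (fun p hp => sq_log_annealed_sub_RS_le hβ (by linarith) hh k p hp)
  refine le_trans (le_of_eq (limsup_congr ?_)) h1
  filter_upwards [eventually_gt_atTop 0] with N hN
  rw [← (map_explored hN β h k).1, lintegral_map _ (measurable_explored β h k)]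
  exact ((((measurable_annealed β h k N).log.const_mul _).sub_const _).abs).ennreal_ofReal

/-! ### Matrices with independent Gaussian entries -/

theorem map_eq_gaussMatrix {N : ℕ} (hN : 0 < N) {Ω : Type*} [MeasurableSpace Ω] {P : Measure Ω}
    [IsProbabilityMeasure P] {g : Ω → Matrix (Fin N) (Fin N) ℝ}
    (hg : ∀ i j, Measurable fun ω => g ω i j)
    (hlaw : ∀ i j, P.map (fun ω => g ω i j) = gaussianReal 0 (N : ℝ≥0)⁻¹)
    (hind : iIndepFun (fun (p : Fin N × Fin N) ω => g ω p.1 p.2) P) :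
    P.map g = gaussMatrix N := by
  have hgm : Measurable g := measurable_matrix_iff.2 hg
  have := Measure.isProbabilityMeasure_map (μ := P) hgm.aemeasurable
  have hN' : (0 : ℝ) < N := by exact_mod_cast hN
  have hs : √(N : ℝ) ≠ 0 := (Real.sqrt_pos.2 hN').ne'
  have hlaw' : ∀ p : Fin N × Fin N, P.map (fun ω => √(N : ℝ) * g ω p.1 p.2) = stdGauss := by
    intro p
    have h1 := gaussianReal_map_const_mul (μ := 0) (v := (N : ℝ≥0)⁻¹) (√(N : ℝ))
    rw [← hlaw p.1 p.2, Measure.map_map (measurable_const_mul _) (hg p.1 p.2)] at h1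
    refine h1.trans ?_
    rw [mul_zero]
    congr 1
    ext
    simp [hN'.ne']
  have hind' := hind.comp (fun _ x => √(N : ℝ) * x) fun _ => measurable_const_mul _
  refine eq_gaussMatrix_of_char hN fun T => ?_
  have h1 := integral_exp_sum_of_iIndepFun (X := fun (p : Fin N × Fin N) ω => √(N : ℝ) * g ω p.1 p.2)
    (fun p => (hg p.1 p.2).const_mul _) hlaw' hind' fun p => T p.1 p.2 / √(N : ℝ)
  have e1 : ∀ ω, ∑ p : Fin N × Fin N, T p.1 p.2 / √(N : ℝ) * (√(N : ℝ) * g ω p.1 p.2) =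
      mdot T (g ω) := fun ω => by
    rw [Fintype.sum_prod_type, mdot]
    refine Finset.sum_congr rfl fun i _ => Finset.sum_congr rfl fun j _ => ?_
    field_simp
  have e2 : ∑ p : Fin N × Fin N, (T p.1 p.2 / √(N : ℝ)) ^ 2 = mdot T T / N := by
    rw [Fintype.sum_prod_type, mdot, Finset.sum_div]
    refine Finset.sum_congr rfl fun i _ => ?_
    rw [Finset.sum_div]
    refine Finset.sum_congr rfl fun j _ => ?_
    rw [div_pow, Real.sq_sqrt hN'.le, sq]
  simp only [e1, e2] at h1
  rw [integral_map hgm.aemeasurable]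
  · exact h1
  · have := measurable_mdot T
    exact (by fun_prop : Measurable fun x => Complex.exp ((mdot T x : ℝ) * Complex.I)).aestronglyMeasurable

/-- Once the conditional expectation is a fixed function of `g`, the error depends only on the law
of `g` and no longer on the underlying probability space. -/
theorem firstMomentError_eq {N : ℕ} (hN : 0 < N) (β h : ℝ) {Ω : Type*} [MeasurableSpace Ω]
    {P : Measure Ω} [IsProbabilityMeasure P] {g : Ω → Matrix (Fin N) (Fin N) ℝ}
    (hg : ∀ i j, Measurable fun ω => g ω i j)
    (hlaw : ∀ i j, P.map (fun ω => g ω i j) = gaussianReal 0 (N : ℝ≥0)⁻¹)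
    (hind : iIndepFun (fun (p : Fin N × Fin N) ω => g ω p.1 p.2) P) (k : ℕ) :
    firstMomentError β h P g k = ∫⁻ x, ENNReal.ofReal |(N : ℝ)⁻¹ *
      Real.log (annealed β h x k) - RS β h| ∂(gaussMatrix N) := by
  have hgm : Measurable g := measurable_matrix_iff.2 hg
  have hmap := map_eq_gaussMatrix hN hg hlaw hind
  have hZ : Integrable (fun x => partitionFunction β h x) (gaussMatrix N) := by
    -- At level `0` the projection is the identity, so resampling returns `w` itself and this is
    -- integrability under the Gaussian law.
    have := (integrable_partitionFunction_resample hN β h (0 : Matrix (Fin N) (Fin N) ℝ) 0)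
    refine this.congr (Eventually.of_forall fun w => ?_)
    simp [resample, Qmat, coproj_zero]
  have hint : Integrable (fun ω => partitionFunction β h (g ω)) P := by
    rw [← hmap] at hZ
    exact hZ.comp_measurable hgm
  rw [firstMomentError, ← hmap, lintegral_map _ hgm]
  · refine lintegral_congr_ae ?_
    filter_upwards [condExp_partitionFunction hN β h hgm hmap hint k] with ω hω
    rw [hω]
  · exact ((((measurable_annealed β h k N).log.const_mul _).sub_const _).abs).ennreal_ofReal

end SK

/-! ### Conclusion. -/

theorem proposition3 :
    ∃ β₀ : ℝ, 0 < β₀ ∧ ∀ β : ℝ, 0 < β → β ≤ β₀ → ∀ h : ℝ, 0 < h →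
      ∀ (Ω : Type*) [MeasurableSpace Ω] (P : Measure Ω) [IsProbabilityMeasure P]
        (g : ∀ N : ℕ, Ω → Matrix (Fin N) (Fin N) ℝ),
        (∀ (N : ℕ) (i j : Fin N), Measurable fun ω => g N ω i j) →
        (∀ (N : ℕ) (i j : Fin N), P.map (fun ω => g N ω i j) = gaussianReal 0 (N : ℝ≥0)⁻¹) →
        (∀ N : ℕ, iIndepFun (fun (p : Fin N × Fin N) ω => g N ω p.1 p.2) P) →
        Tendsto (fun k : ℕ => limsup (fun N : ℕ => SK.firstMomentError β h P (g N) k) atTop)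
          atTop (𝓝 0) := by
  -- The threshold `1 / 16` is the one of the Laplace estimate `abs_log_annealed_sub_le`; the other
  -- parts need only `β < 1`.
  refine ⟨1 / 16, by norm_num, fun β hβ hβ1 h hh Ω _ P _ g hg hlaw hind => ?_⟩
  have h0 := ENNReal.tendsto_ofReal (SK.tendsto_limitError hβ (by linarith) hh)
  rw [ENNReal.ofReal_zero] at h0
  refine tendsto_of_tendsto_of_tendsto_of_le_of_le' tendsto_const_nhds h0
    (Eventually.of_forall fun _ => zero_le) ?_
  -- At least one step is needed, since the Laplace argument is centered at `m^{(k+1)}` with `k ≥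
  -- 1`.
  filter_upwards [eventually_ge_atTop 1] with k hk
  refine le_trans (le_of_eq (limsup_congr ?_)) (SK.limsup_lintegral_annealed_le hβ hβ1 hh hk)
  filter_upwards [eventually_gt_atTop 0] with N hN
  exact SK.firstMomentError_eq hN β h (hg N) (hlaw N) (hind N) k
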